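/- **Setting.** Let $\mathcal N$ be a one-qubit quantum channel (the noise). An ansatz with $n$ qubits and $L$ layers is the random circuit $$\Phi=(\mathcal V_L\circ\mathcal N^{\otimes n}\circ\mathcal U_L)\circ\cdots\circ(\mathcal V_1\circ\mathcal N^{\otimes n}\circ\mathcal U_1).$$ Here $\mathcal V_j$ is a layer of one-qubit gates, each drawn from a one-qubit unitary $2$-design, and $\mathcal U_j$ is conjugation by a product of two-qubit gates such that every qubit is acted on by at least one of them. Each two-qubit gate is of the form $U e^{-i\theta_\mu H_\mu}$ with $U$ drawn from a two-qubit unitary $2$-design and $H_\mu$ a Hermitian operator on the same two qubits, $\|H_\mu\|_\infty\le1$. A gate without parameter has $H_\mu=0$; a gate with a parameter is placed at the start of its layer, that is, no earlier gate of the layer shares a qubit with it. All random gates are independent, and variances are taken over them at fixed, arbitrary parameters $\theta$. Let $P$ be an $n$-qubit Pauli operator of weight $|P|$, let $\rho_0$ be any $n$-qubit state, let $C(\theta)=\mathrm{Tr}(P\,\Phi(\rho_0))$, and let $\mu$ be a parameter of a gate of layer $k$. The support of an operator is the union of the supports of the Pauli operators in its Pauli expansion. The light cone is $\bigcup_{\Phi}\mathrm{supp}(\Phi_{[k,L]}^*(P))$,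 the union over the support of the distribution of the circuit $\Phi_{[k,L]}$ formed by the layers $k,\dots,L$, where $^*$ is the Hilbert–Schmidt adjoint. Let $H_\mu^0=H_\mu-\frac{\mathrm{Tr}H_\mu}{4}I$. Let $c=\frac13\sum_{Q\in\{X,Y,Z\}}\sum_{R\in\{I,X,Y,Z\}}T_{Q,R}^2$, where $T_{Q,R}=\frac12\mathrm{Tr}(Q\,\mathcal N(R))$. A layer has depth at most $r$ if its gates can be scheduled in at most $r$ successive rounds of gates acting on disjoint pairs of qubits. **Theorem.** 1. (Only the last few layers are trainable.) Assume that $\mathcal N$ is not unital and is not a replacer channel (it does not output a fixed state). Given $r$, $w$ and $h>0$, there are constants $a,b>0$ and $K$, depending only on $\mathcal N,r,w,h$, such that for every $n$, $L$, every ansatz whose layers have depth at most $r$, every state $\rho_0$, all $\theta$, every $P$ with $|P|\le w$ and every parameter $\mu$ of a layer $k\ge2$ with $\|H_\mu^0\|_\infty\ge h$, $\mathrm{supp}(H_\mu)$ contained in the light cone, and $L-k\ge K$: $$e^{-b(L-k)}\le \mathrm{Var}[\partial_\mu C]\le e^{-a(L-k)}.$$ Geometric locality of the gates is not needed; the statement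 covers geometrically local circuits in any dimension (such as brickwork circuits) with layers of constant depth. 2. (Contraction coefficient.) If, up to unitary channels before and after, $\mathcal N$ maps $I\mapsto I+\sum_Q t_QQ$ and $Q\mapsto D_QQ$ for $Q\in\{X,Y,Z\}$, then $c=\frac13(\|\mathbf t\|_2^2+\|\mathbf D\|_2^2)$. 3. (Upper bound.) If $\mathcal N$ is not a unitary channel, then $c<1$ and, for every ansatz, $P$, $\rho_0$, $\theta$ and $\mu$, $$\mathrm{Var}[\partial_\mu C]\le 4c^{|P|+L-k-1}.$$ 4. (Lower bound.) Assume that $\mathcal N$ is not unital and is not a replacer channel. Given $r$, there is a constant $b>0$, depending only on $\mathcal N$ and $r$, such that for every ansatz whose layers have depth at most $r$, every $P$, $\rho_0$, $\theta$ and every $\mu$ of a layer $k\ge2$ with $\mathrm{supp}(H_\mu)$ contained in the light cone, $$\mathrm{Var}[\partial_\mu C]\ge\|H_\mu^0\|_\infty^2\,e^{-b|P|(L-k+1)}.$$ 5. (Outside the light cone.) For every channel $\mathcal N$ and every ansatz, if $\mathrm{supp}(H_\mu)$ is disjoint from the light cone, then $\mathrm{Var}[\partial_\mu C]=0$. -/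

import Mathlib

open MeasureTheory ProbabilityTheory
open scoped Kronecker ComplexOrder

noncomputable section

namespace NoisyCircuit

/-! ### Matrices, Pauli strings and supports -/

/-- Operators on one qubit. -/
abbrev Op1 : Type := Matrix (Fin 2) (Fin 2) ℂ

/-- Operators on two qubits, in the computational basis indexed by `Fin 2 × Fin 2`. -/
abbrev Op2 : Type := Matrix (Fin 2 × Fin 2) (Fin 2 × Fin 2) ℂ

/-- Operators on `n` qubits, in the computational basis indexed by bit strings. -/
abbrev Op (n : ℕ) : Type := Matrix (Fin n → Fin 2) (Fin n → Fin 2) ℂ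

/-- The one-qubit Pauli matrices `I, X, Y, Z`, numbered `0, 1, 2, 3`. -/
def pauli : Fin 4 → Op1 :=
  ![1, !![0, 1; 1, 0], !![0, -Complex.I; Complex.I, 0], !![1, 0; 0, -1]]

/-- Labels of the elements of the `n`-qubit Pauli basis `{I, X, Y, Z}^{⊗ n}`. -/
abbrev PauliString (n : ℕ) : Type := Fin n → Fin 4

/-- The tensor product `⨂_q A q` of one-qubit operators. -/
def tensorOp {n : ℕ} (A : Fin n → Op1) : Op n :=
  Matrix.of fun x y => ∏ q, A q (x q) (y q)

/-- The `n`-qubit Pauli operator with label `P`. -/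
def pauliOp {n : ℕ} (P : PauliString n) : Op n := tensorOp fun q => pauli (P q)

/-- The Pauli weight `|P|`. -/
def weight {n : ℕ} (P : PauliString n) : ℕ := (Finset.univ.filter fun q => P q ≠ 0).card

/-- The support of an operator: the union of the supports of the Pauli operators that occur with
a nonzero coefficient in its expansion in the Pauli basis (the coefficient of the Pauli operator
`R` in `A` is `Tr(R A) / 2 ^ n`). -/
def opSupport {n : ℕ} (A : Op n) : Set (Fin n) :=
  {q | ∃ R : PauliString n, (pauliOp R * A).trace ≠ 0 ∧ R q ≠ 0}

/-- The two-qubit operator `G` acting on the qubits `a` (first factor) and `b` (second factor),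
tensored with the identity on the other qubits. -/
def embed {n : ℕ} (a b : Fin n) (G : Op2) : Op n :=
  Matrix.of fun x y =>
    if ∀ q, q ≠ a → q ≠ b → x q = y q then G (x a, x b) (y a, y b) else 0

/-- The operator norm (largest singular value) of a matrix. -/
def opNorm {m : Type} [Fintype m] [DecidableEq m] (A : Matrix m m ℂ) : ℝ :=
  ‖Matrix.toEuclideanCLM (n := m) (𝕜 := ℂ) A‖

/-- The traceless part `G - (Tr G / 4) I` of a two-qubit operator. -/
def tracelessPart (G : Op2) : Op2 := G - (G.trace / 4) • (1 : Op2)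

/-- Density matrices. -/
def IsDensity {m : Type} [Fintype m] (ρ : Matrix m m ℂ) : Prop :=
  ρ.PosSemidef ∧ ρ.trace = 1

/-! ### Linear maps on matrices and one-qubit channels -/

/-- The map `A ↦ U A U†`. -/
def conjMap {m : Type} [Fintype m] (U : Matrix m m ℂ) : Matrix m m ℂ →ₗ[ℂ] Matrix m m ℂ where
  toFun A := U * A * U.conjTranspose
  map_add' A B := by rw [mul_add, add_mul]
  map_smul' c A := by simp

/-- The adjoint of a map on matrices with respect to the Hilbert-Schmidt scalar product
`⟨A, B⟩ = Tr(A† B)`; see `hsAdjoint_spec`. -/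
def hsAdjoint {m : Type} [Fintype m] [DecidableEq m] (Φ : Matrix m m ℂ →ₗ[ℂ] Matrix m m ℂ)
    (A : Matrix m m ℂ) : Matrix m m ℂ :=
  Matrix.of fun i j => ((Φ (Matrix.single i j 1)).conjTranspose * A).trace

theorem hsAdjoint_spec {m : Type} [Fintype m] [DecidableEq m]
    (Φ : Matrix m m ℂ →ₗ[ℂ] Matrix m m ℂ) (A B : Matrix m m ℂ) :
    ((hsAdjoint Φ A).conjTranspose * B).trace = (A.conjTranspose * Φ B).trace := by
  have h : ∀ i j, star (hsAdjoint Φ A i j)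
      = (A.conjTranspose * Φ (Matrix.single i j 1)).trace := by
    intro i j
    simp only [hsAdjoint, Matrix.of_apply]
    rw [← Matrix.trace_conjTranspose, Matrix.conjTranspose_mul, Matrix.conjTranspose_conjTranspose]
  conv_rhs => rw [Matrix.matrix_eq_sum_single B]
  simp only [map_sum, Matrix.mul_sum, Matrix.trace_sum]
  rw [Matrix.trace, Finset.sum_comm]
  refine Finset.sum_congr rfl fun j _ => ?_
  simp only [Matrix.diag_apply, Matrix.mul_apply, Matrix.conjTranspose_apply]
  refine Finset.sum_congr rfl fun i _ => ?_
  rw [h, show Matrix.single i j (B i j) = B i j • Matrix.single i j (1 : ℂ) by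
    simp [Matrix.smul_single], map_smul, Matrix.mul_smul, Matrix.trace_smul, smul_eq_mul, mul_comm]

/-- One-qubit quantum channels (completely positive and trace preserving maps), given by a Kraus
representation. -/
def IsQuantumChannel (N : Op1 →ₗ[ℂ] Op1) : Prop :=
  ∃ (r : ℕ) (K : Fin r → Op1), ∑ i, (K i).conjTranspose * K i = 1 ∧
    ∀ A, N A = ∑ i, K i * A * (K i).conjTranspose

/-- The channel is unitary. -/
def IsUnitaryChannel (N : Op1 →ₗ[ℂ] Op1) : Prop :=
  ∃ U ∈ Matrix.unitaryGroup (Fin 2) ℂ, N = conjMap U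

/-- The channel is unital. -/
def IsUnital (N : Op1 →ₗ[ℂ] Op1) : Prop := N 1 = 1

/-- The channel is a replacer channel: it outputs a fixed state. -/
def IsReplacer (N : Op1 →ₗ[ℂ] Op1) : Prop :=
  ∃ τ : Op1, ∀ ρ : Op1, IsDensity ρ → N ρ = τ

/-- The linear map with `I ↦ I + t_X X + t_Y Y + t_Z Z` and `Q ↦ D_Q Q` for `Q ∈ {X, Y, Z}`. -/
def normalFormMap (t D : Fin 3 → ℝ) (A : Op1) : Op1 :=
  (A.trace / 2) • (1 + ∑ i, (t i : ℂ) • pauli i.succ)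
    + ∑ i, ((D i : ℂ) * (pauli i.succ * A).trace / 2) • pauli i.succ

/-- `t` and `D` are normal-form parameters of the channel `N`: up to unitaries before and after,
`N` is the map `normalFormMap t D`. -/
def IsNormalForm (N : Op1 →ₗ[ℂ] Op1) (t D : Fin 3 → ℝ) : Prop :=
  ∃ U ∈ Matrix.unitaryGroup (Fin 2) ℂ, ∃ V ∈ Matrix.unitaryGroup (Fin 2) ℂ,
    ∀ A, N A = U * normalFormMap t D (V.conjTranspose * A * V) * U.conjTranspose

/-- The entry `T_{Q,P} = Tr(Q N(P)) / 2` of the Pauli transfer matrix, which is real for a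
channel. -/
def transferEntry (N : Op1 →ₗ[ℂ] Op1) (Q P : Fin 4) : ℝ :=
  ((pauli Q * N (pauli P)).trace / 2).re

/-- The contraction coefficient `c` of a channel: a third of the sum of the squares of the entries
of its Pauli transfer matrix outside the row of the identity. This number does not change under
unitaries before and after the channel, and equals `normalFormContraction t D` for all
normal-form parameters `t`, `D` of the channel. -/
def contraction (N : Op1 →ₗ[ℂ] Op1) : ℝ :=
  (∑ Q : Fin 3, ∑ P : Fin 4, transferEntry N Q.succ P ^ 2) / 3

/-- `(‖t‖² + ‖D‖²) / 3`. -/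
def normalFormContraction (t D : Fin 3 → ℝ) : ℝ := (∑ i, t i ^ 2 + ∑ i, D i ^ 2) / 3

/-- The layer of noise `N^{⊗ n}`: the linear map that sends the tensor product
`⨂_q |u q⟩⟨v q|` to `⨂_q N(|u q⟩⟨v q|)`. -/
def noiseLayer (n : ℕ) (N : Op1 →ₗ[ℂ] Op1) : Op n →ₗ[ℂ] Op n where
  toFun A := ∑ u : Fin n → Fin 2, ∑ v : Fin n → Fin 2,
    A u v • tensorOp fun q => N (Matrix.single (u q) (v q) 1)
  map_add' A B := by simp only [Matrix.add_apply, add_smul, Finset.sum_add_distrib]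
  map_smul' c A := by
    simp only [Matrix.smul_apply, smul_assoc, Finset.smul_sum, RingHom.id_apply]

/-! ### Haar measure and unitary 2-designs -/

instance (m : Type) [Fintype m] [DecidableEq m] :
    MeasurableSpace (Matrix.unitaryGroup m ℂ) := borel _

instance (m : Type) [Fintype m] [DecidableEq m] :
    BorelSpace (Matrix.unitaryGroup m ℂ) := ⟨rfl⟩

/-- The (unique) left and right invariant probability measure on the unitary group. -/
def IsHaarProbability {m : Type} [Fintype m] [DecidableEq m]
    (μ : Measure (Matrix.unitaryGroup m ℂ)) : Prop :=
  IsProbabilityMeasure μ ∧ μ.IsMulLeftInvariant ∧ μ.IsMulRightInvariant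

/-- The second moment operator `E_{U ∼ μ} [U^{⊗ 2} O U^{† ⊗ 2}]`. -/
def secondMoment {m : Type} [Fintype m] [DecidableEq m]
    (μ : Measure (Matrix.unitaryGroup m ℂ)) (O : Matrix (m × m) (m × m) ℂ) :
    Matrix (m × m) (m × m) ℂ :=
  Matrix.of fun i j => ∫ U : Matrix.unitaryGroup m ℂ,
    (((U : Matrix m m ℂ) ⊗ₖ (U : Matrix m m ℂ)) * O *
      ((U : Matrix m m ℂ) ⊗ₖ (U : Matrix m m ℂ)).conjTranspose) i j ∂μ

/-- Unitary `2`-designs: probability distributions with the second moments of the Haar measure. -/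
def IsTwoDesign {m : Type} [Fintype m] [DecidableEq m]
    (ν : Measure (Matrix.unitaryGroup m ℂ)) : Prop :=
  IsProbabilityMeasure ν ∧ ∃ μ : Measure (Matrix.unitaryGroup m ℂ), IsHaarProbability μ ∧
    ∀ O, secondMoment ν O = secondMoment μ O

/-! ### Random circuit ansatz -/

/-- A random circuit ansatz on `n` qubits with `L` layers (numbered `0, …, L - 1`).
Layer `j` applies the two-qubit gates `0, 1, …, numGates j - 1` in this order; gate `i` acts on
the distinct qubits `left j i` and `right j i`, and every qubit is acted on by at least one gate
of each layer. Gate `(j, i)` is the product `U exp(-i θ H)` of a random unitary `U`, drawn from a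
two-qubit `2`-design, and of a gate with parameter `θ` and Hermitian generator `H` of norm at
most `1`, where `H = 0` for a gate without parameter. Parametrised gates stand at the start of
their layer. After the noise, each layer ends with one-qubit gates drawn from
`2`-designs. -/
structure Ansatz (n L : ℕ) where
  numGates : Fin L → ℕ
  left : (j : Fin L) → Fin (numGates j) → Fin n
  right : (j : Fin L) → Fin (numGates j) → Fin n
  left_ne_right : ∀ j i, left j i ≠ right j i
  covers : ∀ j q, ∃ i, left j i = q ∨ right j i = q
  gateLaw : (g : Σ j : Fin L, Fin (numGates j)) → Measure (Matrix.unitaryGroup (Fin 2 × Fin 2) ℂ)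
  gateLaw_design : ∀ g, IsTwoDesign (gateLaw g)
  singleLaw : Fin L × Fin n → Measure (Matrix.unitaryGroup (Fin 2) ℂ)
  singleLaw_design : ∀ s, IsTwoDesign (singleLaw s)
  generator : (g : Σ j : Fin L, Fin (numGates j)) → Op2
  generator_hermitian : ∀ g, (generator g).IsHermitian
  generator_norm_le : ∀ g, opNorm (generator g) ≤ 1
  generator_start : ∀ (j : Fin L) (i : Fin (numGates j)), generator ⟨j, i⟩ ≠ 0 →
    ∀ i' < i, left j i' ≠ left j i ∧ left j i' ≠ right j i ∧
      right j i' ≠ left j i ∧ right j i' ≠ right j i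

namespace Ansatz

variable {n L : ℕ} (A : Ansatz n L)

/-- The two-qubit gates (equivalently, the parameters) of the ansatz. -/
abbrev Gate : Type := Σ j : Fin L, Fin (A.numGates j)

/-- A realisation of all random gates: the two-qubit gates and the one-qubit gates. -/
abbrev Config : Type :=
  (A.Gate → Matrix.unitaryGroup (Fin 2 × Fin 2) ℂ) ×
    (Fin L × Fin n → Matrix.unitaryGroup (Fin 2) ℂ)

/-- The law of the random gates: all gates are independent. -/
def law : Measure A.Config := (Measure.pi A.gateLaw).prod (Measure.pi A.singleLaw)

/-- Each layer is made of at most `r` rounds of gates acting on disjoint pairs of qubits: gates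
of a layer can be scheduled in `r` rounds such that of two gates that share a qubit the one that
is applied first is in an earlier round. -/
def LayerDepthLE (r : ℕ) : Prop :=
  ∀ j : Fin L, ∃ round : Fin (A.numGates j) → Fin r, ∀ i i', i < i' →
    (A.left j i = A.left j i' ∨ A.left j i = A.right j i' ∨
      A.right j i = A.left j i' ∨ A.right j i = A.right j i') → round i < round i'

/-- Gate `g`, as an operator on two qubits. -/
def gateOp (ω : A.Config) (θ : A.Gate → ℝ) (g : A.Gate) : Op2 :=
  (ω.1 g : Op2) * NormedSpace.exp (-(Complex.I * (θ g : ℂ)) • A.generator g)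

/-- The unitary of layer `j`: the product of its gates, with later gates to the left. -/
def layerUnitary (ω : A.Config) (θ : A.Gate → ℝ) (j : Fin L) : Op n :=
  (List.finRange (A.numGates j)).foldl
    (fun M i => embed (A.left j i) (A.right j i) (A.gateOp ω θ ⟨j, i⟩) * M) 1

/-- Layer `j` with its noise: two-qubit gates, then noise, then one-qubit gates. -/
def layerMap (N : Op1 →ₗ[ℂ] Op1) (ω : A.Config) (θ : A.Gate → ℝ) (j : Fin L) :
    Op n →ₗ[ℂ] Op n :=
  conjMap (tensorOp fun q => (ω.2 (j, q) : Op1)) ∘ₗ noiseLayer n N ∘ₗ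
    conjMap (A.layerUnitary ω θ j)

/-- The composition of the layers with the given numbers, the head of the list acting first. -/
def layersMap (N : Op1 →ₗ[ℂ] Op1) (ω : A.Config) (θ : A.Gate → ℝ) (l : List (Fin L)) :
    Op n →ₗ[ℂ] Op n :=
  l.foldl (fun Φ j => A.layerMap N ω θ j ∘ₗ Φ) LinearMap.id

/-- The whole noisy circuit. -/
def circuit (N : Op1 →ₗ[ℂ] Op1) (ω : A.Config) (θ : A.Gate → ℝ) : Op n →ₗ[ℂ] Op n :=
  A.layersMap N ω θ (List.finRange L)

/-- The part of the noisy circuit from layer `k` (included) to the last layer. -/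
def circuitFrom (N : Op1 →ₗ[ℂ] Op1) (ω : A.Config) (θ : A.Gate → ℝ) (k : Fin L) :
    Op n →ₗ[ℂ] Op n :=
  A.layersMap N ω θ ((List.finRange L).filter fun j => k ≤ j)

/-- The light cone of `P` with respect to the random circuit formed by the layers from `k` to the
last one: the union of the supports of `Φ*(P)` over all circuits `Φ` in the support of its
distribution. -/
def lightCone (N : Op1 →ₗ[ℂ] Op1) (θ : A.Gate → ℝ) (k : Fin L) (P : PauliString n) :
    Set (Fin n) :=
  ⋃ ω ∈ A.law.support, opSupport (hsAdjoint (A.circuitFrom N ω θ k) (pauliOp P))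

/-- The cost function `C(θ) = Tr(P Φ(ρ₀))`, a real number. -/
def cost (N : Op1 →ₗ[ℂ] Op1) (ρ₀ : Op n) (P : PauliString n) (ω : A.Config)
    (θ : A.Gate → ℝ) : ℝ :=
  ((pauliOp P * A.circuit N ω θ ρ₀).trace).re

/-- The partial derivative `∂_μ C` at `θ` with respect to the parameter of gate `μ`. -/
def partialCost (N : Op1 →ₗ[ℂ] Op1) (ρ₀ : Op n) (P : PauliString n) (θ : A.Gate → ℝ)
    (μ : A.Gate) (ω : A.Config) : ℝ :=
  deriv (fun s : ℝ => A.cost N ρ₀ P ω (Function.update θ μ s)) (θ μ)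

/-- `Var[∂_μ C]`, over the random gates, at fixed parameters `θ`. -/
def varPartial (N : Op1 →ₗ[ℂ] Op1) (ρ₀ : Op n) (P : PauliString n) (θ : A.Gate → ℝ)
    (μ : A.Gate) : ℝ :=
  variance (A.partialCost N ρ₀ P θ μ) A.law

/-- The number `L - k` of layers after the layer of the gate `μ`. -/
def layersAfter (μ : A.Gate) : ℕ := L - (μ.1 + 1)

/-- The support of the generator `H_μ` in the `n`-qubit system. -/
def genSupport (μ : A.Gate) : Set (Fin n) :=
  opSupport (embed (A.left μ.1 μ.2) (A.right μ.1 μ.2) (A.generator μ))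

end Ansatz

end NoisyCircuit

end

noncomputable section

namespace NoisyCircuit

/-! The proof works in the Heisenberg picture with real coefficients in the Pauli basis. Gates,
one-qubit unitaries and noise act on such coefficients through their transfer matrices. For a
unitary drawn from a 2-design, distinct transfer entries are uncorrelated, and the mean squares are
uniform over nontrivial labels (`IsPauliBasis.integral_ptm_mul_ptm`). Since the gates are
independent, the mean squares of the coefficients obey a linear evolution with nonnegative weights:
a gate redistributes the mass of a nontrivial label evenly over the 15 nontrivial labels of its
pair, and noise multiplies by `noiseKernel` on each qubit.

A generator commutes with the earlier gates of its layer, so `∂_μ C = Tr(i[H_μ, O] σ)`, where `O` is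
the observable evolved back through layer `k` and `σ` is the state entering that layer
(`partialCost_eq`). The two are independent. Every layer covers all qubits, so the coefficients of
`O` are uncorrelated and the variance is a sum over strings `R` of the mean square of the
coefficient `O_R` times the second moment of `Tr(i[H_μ, R] σ)` (`varPartial_eq`).

Upper bound: the second factor is at most 4. Noise leaves a fraction `c` of the mass for each qubit
in the support, so the mass off the identity is at most `c^|P|` after the last layer and loses a
further factor `c` in every earlier one (`sumNonId_evolve`). That `c < 1` is the equality case of
Cauchy-Schwarz for the Gram matrix of the Kraus operators (`contraction_lt_one`).

Lower bound: non-unital noise sends a nontrivial label to the identity with weight `τ = noiseKernel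
N 1 0 > 0`, and noise that is not a replacer keeps some nontrivial label `x₀` with weight `β =
noiseKernel N 1 x₀ > 0`. All qubits of `P` but one can therefore be erased at the cost of powers of
`τ`, and a string of weight one can be followed through the light cone at a cost of at least `β
15^{-r}` per layer (`le_meanSq_evolve`). At the parametrised gate the mass is uniform over the
nontrivial labels of the pair (`meanSq_setPair_eq`), so some label that does not commute with `H_μ`
is reached. The commutator acts on two qubits and is erased by the noise of the preceding layers at
cost `τ²`; the identity has expectation one in every state, so the bound is independent of the state
(`le_integral_genExpect`). Outside the light cone the commutator vanishes almost surely. -/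

/-! ### Operator bases of Pauli type -/

/-- An orthogonal basis of Hermitian unitaries that commute or anticommute pairwise, as recorded
by `anti`, and such that the commutation relations tell the elements apart. -/
structure IsPauliBasis {m ι : Type} [Fintype m] [DecidableEq m] [Fintype ι] [DecidableEq ι]
    [Zero ι] (B : ι → Matrix m m ℂ) (anti : ι → ι → Bool) : Prop where
  zero : B 0 = 1
  herm : ∀ i, (B i).conjTranspose = B i
  sq : ∀ i, B i * B i = 1
  trace_mul : ∀ i j, (B i * B j).trace = if i = j then (Fintype.card m : ℂ) else 0
  expand : ∀ A, A = ∑ i, ((B i * A).trace / (Fintype.card m : ℂ)) • B i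
  comm : ∀ i j, B i * B j = (if anti i j then (-1 : ℂ) else 1) • (B j * B i)
  separate : ∀ i j, i ≠ j → ∃ k, anti k i ≠ anti k j
  link : ∀ i j, i ≠ 0 → j ≠ 0 → i ≠ j → anti i j = true ∨ ∃ k, anti k i = true ∧ anti k j = true

/-- The entries of the Pauli transfer matrix of the map `A ↦ U A U†` with respect to the
basis `B`. -/
def ptm {m ι : Type} [Fintype m] (B : ι → Matrix m m ℂ) (U : Matrix m m ℂ) (i j : ι) : ℝ :=
  (B i * (U * B j * U.conjTranspose)).trace.re / (Fintype.card m : ℝ)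

/-- The second moments of the entries of the transfer matrix of a random unitary. -/
def twirl {ι : Type} [Fintype ι] [DecidableEq ι] [Zero ι] (i j : ι) : ℝ :=
  if i = 0 then (if j = 0 then 1 else 0) else if j = 0 then 0 else 1 / ((Fintype.card ι : ℝ) - 1)

/-- Cyclicity of the trace moves `W` to the observable side. When `W` carries one basis element to
another, Haar invariance then compares two rows of the transfer matrix. -/
theorem ptm_conj {m ι : Type} [Fintype m] {B : ι → Matrix m m ℂ} (W U : Matrix m m ℂ) {i i' : ι}
    (h : W.conjTranspose * B i * W = B i') (j : ι) : ptm B (W * U) i j = ptm B U i' j := by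
  have : (B i * (W * U * B j * (W * U).conjTranspose)).trace
      = (W.conjTranspose * B i * W * (U * B j * U.conjTranspose)).trace := by
    rw [Matrix.conjTranspose_mul, Matrix.mul_assoc W.conjTranspose, Matrix.mul_assoc W.conjTranspose,
      Matrix.trace_mul_comm W.conjTranspose]
    simp only [Matrix.mul_assoc]
  rw [ptm, this, h, ptm]

namespace IsPauliBasis

variable {m ι : Type} [Fintype m] [DecidableEq m] [Fintype ι] [DecidableEq ι]
  [Zero ι] {B : ι → Matrix m m ℂ} {anti : ι → ι → Bool}

/-- The trace of a product of two Hermitian matrices is real, so nothing is lost by working with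
real coefficients. -/
theorem trace_im (hB : IsPauliBasis B anti) {A : Matrix m m ℂ} (hA : A.conjTranspose = A) (i : ι) :
    ((B i * A).trace.re : ℂ) = (B i * A).trace := by
  rw [← Complex.conj_eq_iff_re]
  change star _ = _
  rw [← Matrix.trace_conjTranspose, Matrix.conjTranspose_mul, hA, hB.herm, Matrix.trace_mul_comm]

theorem expand_re (hB : IsPauliBasis B anti) {A : Matrix m m ℂ} (hA : A.conjTranspose = A) :
    A = ∑ i, (((B i * A).trace.re / (Fintype.card m : ℝ) : ℝ) : ℂ) • B i := by
  conv_lhs => rw [hB.expand A]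
  refine Finset.sum_congr rfl fun i _ => ?_
  push_cast
  rw [hB.trace_im hA]

theorem trace_sq (hB : IsPauliBasis B anti) (a : ι → ℝ) :
    ((∑ i, (a i : ℂ) • B i) * ∑ i, (a i : ℂ) • B i).trace
      = (((Fintype.card m : ℝ) * ∑ i, a i ^ 2 : ℝ) : ℂ) := by
  simp only [Finset.sum_mul, Finset.mul_sum, Matrix.trace_sum, Matrix.smul_mul, Matrix.mul_smul,
    Matrix.trace_smul, hB.trace_mul, smul_eq_mul]
  push_cast
  refine Finset.sum_congr rfl fun i _ => ?_
  simp only [mul_ite, mul_zero, Finset.sum_ite_eq', Finset.mem_univ, if_true]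
  ring

theorem conj_expand (hB : IsPauliBasis B anti) (U : Matrix m m ℂ) (i : ι) :
    U.conjTranspose * B i * U = ∑ j, (ptm B U i j : ℂ) • B j := by
  have h : (U.conjTranspose * B i * U).conjTranspose = U.conjTranspose * B i * U := by
    simp [Matrix.conjTranspose_mul, hB.herm, Matrix.mul_assoc]
  rw [hB.expand_re h]
  refine Finset.sum_congr rfl fun j _ => ?_
  have : (B j * (U.conjTranspose * B i * U)).trace = (B i * (U * B j * U.conjTranspose)).trace := by
    rw [← Matrix.mul_assoc, ← Matrix.mul_assoc, Matrix.trace_mul_comm _ U,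
      Matrix.trace_mul_comm (B i)]
    simp only [Matrix.mul_assoc]
  rw [this, ptm]

theorem ptm_zero_left [Nonempty m] (hB : IsPauliBasis B anti) {U : Matrix m m ℂ}
    (hU : U ∈ Matrix.unitaryGroup m ℂ) (j : ι) : ptm B U 0 j = if j = 0 then 1 else 0 := by
  have hU' : U.conjTranspose * U = 1 := Matrix.mem_unitaryGroup_iff'.1 hU
  have hd : (Fintype.card m : ℝ) ≠ 0 := by simp
  have := hB.trace_mul 0 j
  rw [ptm, hB.zero, Matrix.one_mul, Matrix.trace_mul_comm, ← Matrix.mul_assoc, hU',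
    Matrix.one_mul]
  rw [hB.zero, Matrix.one_mul] at this
  rw [this]
  by_cases h : j = 0
  · subst h; simp
  · simp [h, Ne.symm h]

theorem ptm_zero_right [Nonempty m] (hB : IsPauliBasis B anti) {U : Matrix m m ℂ}
    (hU : U ∈ Matrix.unitaryGroup m ℂ) (i : ι) : ptm B U i 0 = if i = 0 then 1 else 0 := by
  have hU' : U * U.conjTranspose = 1 := Matrix.mem_unitaryGroup_iff.1 hU
  have hd : (Fintype.card m : ℝ) ≠ 0 := by simp
  have := hB.trace_mul i 0
  rw [ptm, hB.zero, Matrix.mul_one, hU']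
  rw [hB.zero] at this
  rw [this]
  by_cases h : i = 0
  · subst h; simp
  · simp [h]

/-- Unitary conjugation preserves `B j * B j = 1`; Parseval for the basis turns this into a column
of unit length. -/
theorem sum_ptm_sq [Nonempty m] (hB : IsPauliBasis B anti) {U : Matrix m m ℂ}
    (hU : U ∈ Matrix.unitaryGroup m ℂ) (j : ι) : ∑ i, ptm B U i j ^ 2 = 1 := by
  have hU' : U.conjTranspose * U = 1 := Matrix.mem_unitaryGroup_iff'.1 hU
  have hU'' : U * U.conjTranspose = 1 := Matrix.mem_unitaryGroup_iff.1 hU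
  have hd : (Fintype.card m : ℝ) ≠ 0 := by simp
  have h : (U * B j * U.conjTranspose).conjTranspose = U * B j * U.conjTranspose := by
    simp [Matrix.conjTranspose_mul, hB.herm, Matrix.mul_assoc]
  have h1 := hB.trace_sq (fun i => ptm B U i j)
  have h2 : ∑ i, (ptm B U i j : ℂ) • B i = U * B j * U.conjTranspose := (hB.expand_re h).symm
  have h3 : (U * B j * U.conjTranspose) * (U * B j * U.conjTranspose) = 1 := by
    calc _ = U * (B j * (U.conjTranspose * U) * B j) * U.conjTranspose := by
          simp only [Matrix.mul_assoc]
      _ = _ := by rw [hU', Matrix.mul_one, hB.sq, Matrix.mul_one, hU'']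
  rw [h2, h3, Matrix.trace_one] at h1
  have h4 : (Fintype.card m : ℝ) = (Fintype.card m : ℝ) * ∑ i, ptm B U i j ^ 2 := by exact_mod_cast h1
  have := mul_left_cancel₀ hd (h4.symm.trans (mul_one _).symm)
  exact this

theorem conj_basis (hB : IsPauliBasis B anti) (k i : ι) :
    B k * B i * B k = (if anti k i then (-1 : ℂ) else 1) • B i := by
  rw [hB.comm, Matrix.smul_mul, Matrix.mul_assoc, hB.sq, Matrix.mul_one]

theorem mem_unitaryGroup (hB : IsPauliBasis B anti) (k : ι) : B k ∈ Matrix.unitaryGroup m ℂ := by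
  rw [Matrix.mem_unitaryGroup_iff, Matrix.star_eq_conjTranspose, hB.herm, hB.sq]

/-- Conjugating one basis element by another only changes its sign. These signs, here for rows and
in `ptm_mul_basis` for columns, are the symmetries that kill mixed second moments. -/
theorem ptm_basis_mul (hB : IsPauliBasis B anti) (U : Matrix m m ℂ) (k i j : ι) :
    ptm B (B k * U) i j = (if anti k i then -1 else 1) * ptm B U i j := by
  have h : (B i * (B k * U * B j * (B k * U).conjTranspose)).trace
      = (B k * B i * B k * (U * B j * U.conjTranspose)).trace := by
    rw [Matrix.conjTranspose_mul, hB.herm]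
    conv_rhs => rw [Matrix.mul_assoc, Matrix.mul_assoc, Matrix.trace_mul_comm]
    simp only [Matrix.mul_assoc]
  rw [ptm, h, hB.conj_basis, Matrix.smul_mul, Matrix.trace_smul, ptm]
  split_ifs <;> simp [neg_div]

theorem ptm_mul_basis (hB : IsPauliBasis B anti) (U : Matrix m m ℂ) (k i j : ι) :
    ptm B (U * B k) i j = (if anti k j then -1 else 1) * ptm B U i j := by
  have h : B i * (U * B k * B j * (U * B k).conjTranspose)
      = B i * (U * (B k * B j * B k) * U.conjTranspose) := by
    rw [Matrix.conjTranspose_mul, hB.herm]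
    simp only [Matrix.mul_assoc]
  rw [ptm, h, hB.conj_basis, ptm]
  split_ifs <;> simp [neg_div]

/-- Two elements other than the identity are conjugate up to a sign when they anticommute. -/
theorem exists_conj_of_anti (hB : IsPauliBasis B anti) {i j : ι} (h : anti i j = true) :
    ∃ W ∈ Matrix.unitaryGroup m ℂ, W.conjTranspose * B i * W = B j := by
  have hc := hB.comm i j
  rw [h, if_pos rfl] at hc
  have hc' : B j * B i = -(B i * B j) := by rw [hc]; simp
  have hs : ((Real.sqrt 2 : ℂ)⁻¹) * ((Real.sqrt 2 : ℂ)⁻¹) = 1 / 2 := by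
    rw [← mul_inv, ← Complex.ofReal_mul, Real.mul_self_sqrt (by norm_num)]; simp
  -- The normalised sum is a Hermitian unitary because the cross terms cancel. It generalises the
  -- Hadamard gate, which is the case of `X` and `Z`.
  refine ⟨(Real.sqrt 2 : ℂ)⁻¹ • (B i + B j), ?_, ?_⟩
  · rw [Matrix.mem_unitaryGroup_iff, Matrix.star_eq_conjTranspose, Matrix.conjTranspose_smul,
      Matrix.conjTranspose_add, hB.herm, hB.herm]
    simp only [star_inv₀, Complex.star_def, Complex.conj_ofReal, Matrix.smul_mul, Matrix.mul_smul,
      add_mul, mul_add, hB.sq, hc']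
    rw [← smul_add, smul_smul, hs]
    rw [show (1 : Matrix m m ℂ) + -(B i * B j) + (B i * B j + 1) = (2 : ℂ) • 1 by
      rw [two_smul]; abel, smul_smul]
    norm_num
  · rw [Matrix.conjTranspose_smul, Matrix.conjTranspose_add, hB.herm, hB.herm]
    simp only [star_inv₀, Complex.star_def, Complex.conj_ofReal, Matrix.smul_mul, Matrix.mul_smul,
      add_mul, mul_add, hB.sq, hc']
    rw [← smul_add, smul_smul, hs, Matrix.one_mul, Matrix.neg_mul, Matrix.mul_assoc (B i) (B j) (B i), hc', Matrix.mul_neg,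
      ← Matrix.mul_assoc, hB.sq, Matrix.neg_mul, Matrix.mul_assoc (B i) (B j) (B j), hB.sq]
    rw [show B i + -(-(1 * B j)) + (1 * B j + -(B i * 1)) = (2 : ℂ) • B j by
      rw [two_smul]; simp; abel, smul_smul]
    norm_num

end IsPauliBasis

end NoisyCircuit
end

noncomputable section

namespace NoisyCircuit

/-! ### The one-qubit and the two-qubit Pauli basis -/

/-- Two one-qubit Pauli matrices anticommute. -/
def pauliAnti (i j : Fin 4) : Bool := decide (i ≠ 0 ∧ j ≠ 0 ∧ i ≠ j)

/-- The two-qubit Pauli operators. -/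
def pauli2 (s : Fin 4 × Fin 4) : Op2 := pauli s.1 ⊗ₖ pauli s.2

theorem pauli_isPauliBasis : IsPauliBasis pauli pauliAnti where
  zero := rfl
  herm i := by
    fin_cases i <;> ext a b <;> fin_cases a <;> fin_cases b <;>
      simp [pauli, Matrix.conjTranspose_apply]
  sq i := by
    fin_cases i <;> ext a b <;> fin_cases a <;> fin_cases b <;>
      simp [pauli, Matrix.mul_apply, Fin.sum_univ_two]
  trace_mul i j := by
    fin_cases i <;> fin_cases j <;>
      simp [pauli, Matrix.trace_fin_two, Fin.ext_iff] <;> norm_num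
  expand A := by
    ext a b
    fin_cases a <;> fin_cases b <;>
      simp [pauli, Matrix.trace_fin_two, Matrix.mul_apply, Fin.sum_univ_two, Fin.sum_univ_four] <;>
      ring_nf <;> simp <;> ring
  comm i j := by
    fin_cases i <;> fin_cases j <;> ext a b <;> fin_cases a <;> fin_cases b <;>
      simp [pauli, pauliAnti, Matrix.mul_apply, Fin.sum_univ_two]
  separate := by decide
  link := by decide

theorem pauli2_isPauliBasis :
    IsPauliBasis pauli2 fun s t => xor (pauliAnti s.1 t.1) (pauliAnti s.2 t.2) where
  zero := by
    change pauli 0 ⊗ₖ pauli 0 = 1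
    rw [pauli_isPauliBasis.zero, Matrix.one_kronecker_one]
  herm i := by
    rw [pauli2, Matrix.conjTranspose_kronecker, pauli_isPauliBasis.herm, pauli_isPauliBasis.herm]
  sq i := by
    rw [pauli2, ← Matrix.mul_kronecker_mul, pauli_isPauliBasis.sq, pauli_isPauliBasis.sq,
      Matrix.one_kronecker_one]
  trace_mul i j := by
    rw [pauli2, pauli2, ← Matrix.mul_kronecker_mul, Matrix.trace_kronecker,
      pauli_isPauliBasis.trace_mul, pauli_isPauliBasis.trace_mul]
    simp only [Fintype.card_prod, Nat.cast_mul, Prod.ext_iff]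
    split_ifs <;> simp_all
  expand A := by
    -- By linearity it suffices to expand product operators, where the sum splits into two one-qubit
    -- expansions; matrix units are products.
    have key : ∀ C D : Op1, ∑ s, ((pauli2 s * C ⊗ₖ D).trace / (Fintype.card (Fin 2 × Fin 2) : ℂ)) •
        pauli2 s = C ⊗ₖ D := by
      intro C D
      conv_rhs => rw [pauli_isPauliBasis.expand C, pauli_isPauliBasis.expand D]
      rw [Fintype.sum_prod_type]
      simp only [pauli2, ← Matrix.mul_kronecker_mul, Matrix.trace_kronecker, Fintype.card_prod,
        Nat.cast_mul, mul_div_mul_comm]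
      ext x y
      simp only [Matrix.sum_apply, Matrix.smul_apply, Matrix.kroneckerMap_apply, smul_eq_mul,
        Finset.sum_mul, Finset.mul_sum]
      rw [Finset.sum_comm]
      refine Finset.sum_congr rfl fun _ _ => Finset.sum_congr rfl fun _ _ => ?_
      ring
    have hs : ∀ i j : Fin 2 × Fin 2, Matrix.single i j (A i j)
        = A i j • (Matrix.single i.1 j.1 (1 : ℂ) ⊗ₖ Matrix.single i.2 j.2 (1 : ℂ)) := by
      intro i j
      rw [Matrix.single_kronecker_single, Matrix.smul_single]
      simp
    have hA := Matrix.matrix_eq_sum_single A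
    simp only [hs] at hA
    symm
    rw [hA]
    simp only [Matrix.mul_sum, Matrix.trace_sum, Matrix.mul_smul, Matrix.trace_smul,
      Finset.sum_div, Finset.sum_smul, smul_eq_mul, mul_div_assoc]
    rw [Finset.sum_comm]
    refine Finset.sum_congr rfl fun i _ => ?_
    rw [Finset.sum_comm]
    refine Finset.sum_congr rfl fun j _ => ?_
    conv_rhs => rw [← key]
    rw [Finset.smul_sum]
    refine Finset.sum_congr rfl fun s _ => ?_
    rw [smul_smul]
  comm i j := by
    rw [pauli2, pauli2, ← Matrix.mul_kronecker_mul, ← Matrix.mul_kronecker_mul,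
      pauli_isPauliBasis.comm i.1, pauli_isPauliBasis.comm i.2]
    rw [Matrix.smul_kronecker, Matrix.kronecker_smul, smul_smul]
    cases pauliAnti i.1 j.1 <;> cases pauliAnti i.2 j.2 <;> simp
  separate := by decide
  link := by decide

/-! ### Integrals over the unitary group -/

section Haar

variable {m : Type} [Fintype m] [DecidableEq m]

instance : SecondCountableTopology (Matrix m m ℂ) :=
  inferInstanceAs (SecondCountableTopology (m → m → ℂ))

instance : SecondCountableTopology (Matrix.unitaryGroup m ℂ) :=
  TopologicalSpace.Subtype.secondCountableTopology (Matrix.unitaryGroup m ℂ : Set (Matrix m m ℂ))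

/-- A closed subset of a polydisc, since the entries of a unitary have modulus at most one.
Compactness makes every continuous function of the gates integrable. -/
instance : CompactSpace (Matrix.unitaryGroup m ℂ) := by
  refine isCompact_iff_compactSpace (s := (Matrix.unitaryGroup m ℂ : Set (Matrix m m ℂ))) |>.1 ?_
  have hc : IsClosed (Matrix.unitaryGroup m ℂ : Set (Matrix m m ℂ)) := by
    have : (Matrix.unitaryGroup m ℂ : Set (Matrix m m ℂ)) = {U | U * U.conjTranspose = 1} := by
      ext U
      exact Matrix.mem_unitaryGroup_iff
    rw [this]
    exact isClosed_eq (by fun_prop) continuous_const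
  have hK : IsCompact (Set.pi Set.univ fun _ : m => Set.pi Set.univ fun _ : m =>
      Metric.closedBall (0 : ℂ) 1) :=
    isCompact_univ_pi fun _ => isCompact_univ_pi fun _ => isCompact_closedBall _ _
  refine IsCompact.of_isClosed_subset (s := Set.pi Set.univ fun _ : m => Set.pi Set.univ
    fun _ : m => Metric.closedBall (0 : ℂ) 1) hK hc ?_
  intro U hU i _ j _
  simpa using entry_norm_bound_of_unitary hU i j

theorem integrable_of_continuous {X : Type} [TopologicalSpace X] [CompactSpace X]
    [MeasurableSpace X] [OpensMeasurableSpace X] (μ : Measure X) [IsFiniteMeasure μ]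
    {E : Type} [NormedAddCommGroup E] [SecondCountableTopology E]
    {f : X → E} (hf : Continuous f) : Integrable f μ := by
  borelize E
  obtain ⟨C, hC⟩ := (isCompact_range hf).isBounded.exists_norm_le
  exact Integrable.of_bound hf.measurable.aestronglyMeasurable C
    (Filter.Eventually.of_forall fun x => hC _ ⟨x, rfl⟩)

end Haar
end NoisyCircuit
end

/-! ### Second moments of transfer matrices of random unitaries -/

noncomputable section

namespace NoisyCircuit

theorem continuous_ptm {m ι : Type} [Fintype m] (B : ι → Matrix m m ℂ) (i j : ι) : Continuous fun U => ptm B U i j := by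
  unfold ptm
  fun_prop

theorem continuous_ptm_mul {m ι : Type} [Fintype m] [DecidableEq m] (B : ι → Matrix m m ℂ) (F : Matrix m m ℂ) (i j : ι) :
    Continuous fun U : Matrix.unitaryGroup m ℂ => ptm B ((U : Matrix m m ℂ) * F) i j :=
  (continuous_ptm B i j).comp (by fun_prop)

section Haar

variable {m ι : Type} [Fintype m] [DecidableEq m] [Fintype ι] [DecidableEq ι]
  [Zero ι] {B : ι → Matrix m m ℂ} {anti : ι → ι → Bool}

/-- A product of traces is the trace of a Kronecker product, so such an integral depends on the law
only through `secondMoment`. -/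
theorem integral_trace_mul_trace (ν : Measure (Matrix.unitaryGroup m ℂ)) [IsProbabilityMeasure ν]
    (A A' C D : Matrix m m ℂ) :
    ∫ U : Matrix.unitaryGroup m ℂ, (A * ((U : Matrix m m ℂ) * C * (U : Matrix m m ℂ).conjTranspose)).trace *
      (A' * ((U : Matrix m m ℂ) * D * (U : Matrix m m ℂ).conjTranspose)).trace ∂ν
      = ((A ⊗ₖ A') * secondMoment ν (C ⊗ₖ D)).trace := by
  have h : ∀ U : Matrix.unitaryGroup m ℂ,
      (A * ((U : Matrix m m ℂ) * C * (U : Matrix m m ℂ).conjTranspose)).trace *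
      (A' * ((U : Matrix m m ℂ) * D * (U : Matrix m m ℂ).conjTranspose)).trace
      = ∑ x, ∑ y, (A ⊗ₖ A') x y * (((U : Matrix m m ℂ) ⊗ₖ (U : Matrix m m ℂ)) * (C ⊗ₖ D) *
      ((U : Matrix m m ℂ) ⊗ₖ (U : Matrix m m ℂ)).conjTranspose) y x := by
    intro U
    rw [← Matrix.trace_kronecker, Matrix.mul_kronecker_mul, Matrix.mul_kronecker_mul,
      Matrix.mul_kronecker_mul, Matrix.conjTranspose_kronecker]
    simp only [Matrix.trace, Matrix.diag_apply, Matrix.mul_apply]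
  have hc : ∀ x y, Continuous fun U : Matrix.unitaryGroup m ℂ =>
      (A ⊗ₖ A') x y * (((U : Matrix m m ℂ) ⊗ₖ (U : Matrix m m ℂ)) * (C ⊗ₖ D) *
      ((U : Matrix m m ℂ) ⊗ₖ (U : Matrix m m ℂ)).conjTranspose) y x := by
    intro x y
    have : Continuous fun U : Matrix.unitaryGroup m ℂ => (U : Matrix m m ℂ) ⊗ₖ (U : Matrix m m ℂ) := by
      refine continuous_matrix fun i j => ?_
      exact (continuous_subtype_val.matrix_elem i.1 j.1).mul (continuous_subtype_val.matrix_elem i.2 j.2)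
    fun_prop
  simp only [h]
  rw [integral_finsetSum _ fun x _ => integrable_finsetSum _ fun y _ =>
    integrable_of_continuous ν (hc x y)]
  simp only [Matrix.trace, Matrix.diag_apply, Matrix.mul_apply (M := A ⊗ₖ A')]
  refine Finset.sum_congr rfl fun x _ => ?_
  rw [integral_finsetSum _ fun y _ => integrable_of_continuous ν (hc x y)]
  refine Finset.sum_congr rfl fun y _ => ?_
  rw [integral_const_mul, secondMoment, Matrix.of_apply]

theorem IsPauliBasis.ofReal_ptm_mul (hB : IsPauliBasis B anti) (U F : Matrix m m ℂ) (i j : ι) :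
    (ptm B (U * F) i j : ℂ)
      = (B i * (U * (F * B j * F.conjTranspose) * U.conjTranspose)).trace / (Fintype.card m : ℂ) := by
  have h : (U * (F * B j * F.conjTranspose) * U.conjTranspose).conjTranspose
      = U * (F * B j * F.conjTranspose) * U.conjTranspose := by
    simp [Matrix.conjTranspose_mul, hB.herm, Matrix.mul_assoc]
  rw [← hB.trace_im h, ptm]
  push_cast
  congr 4
  simp [Matrix.conjTranspose_mul, Matrix.mul_assoc]

/-- A product of two transfer entries is a linear functional of the second moment operator. A
2-design may thus be replaced by Haar measure, for which invariance is available. -/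
theorem IsPauliBasis.integral_ptm_congr (hB : IsPauliBasis B anti)
    {ν μ : Measure (Matrix.unitaryGroup m ℂ)} [IsProbabilityMeasure ν] [IsProbabilityMeasure μ]
    (h : ∀ O, secondMoment ν O = secondMoment μ O) (F : Matrix m m ℂ) (i j i' j' : ι) :
    ∫ U : Matrix.unitaryGroup m ℂ, ptm B ((U : Matrix m m ℂ) * F) i j * ptm B ((U : Matrix m m ℂ) * F) i' j' ∂ν
      = ∫ U : Matrix.unitaryGroup m ℂ, ptm B ((U : Matrix m m ℂ) * F) i j *
          ptm B ((U : Matrix m m ℂ) * F) i' j' ∂μ := by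
  have key : ∀ (ν : Measure (Matrix.unitaryGroup m ℂ)) [IsProbabilityMeasure ν],
      ((∫ U : Matrix.unitaryGroup m ℂ, ptm B ((U : Matrix m m ℂ) * F) i j *
          ptm B ((U : Matrix m m ℂ) * F) i' j' ∂ν : ℝ) : ℂ)
      = ((B i ⊗ₖ B i') * secondMoment ν ((F * B j * F.conjTranspose) ⊗ₖ
        (F * B j' * F.conjTranspose))).trace / ((Fintype.card m : ℂ) * (Fintype.card m : ℂ)) := by
    intro ν _
    rw [← integral_trace_mul_trace, ← integral_complex_ofReal, ← integral_div]
    congr 1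
    ext U
    push_cast
    rw [hB.ofReal_ptm_mul, hB.ofReal_ptm_mul, div_mul_div_comm]
  have := (key ν).trans (by rw [h]) |>.trans (key μ).symm
  exact_mod_cast this

variable {μ : Measure (Matrix.unitaryGroup m ℂ)}

/-- Some `B k` commutes with exactly one of the two row labels. Invariance under left multiplication
by `B k` then equates the integral with its negative. -/
theorem IsPauliBasis.haar_ne_left (hB : IsPauliBasis B anti) (hμ : IsHaarProbability μ)
    {i i' : ι} (hi : i ≠ i') (j j' : ι) :
    ∫ U : Matrix.unitaryGroup m ℂ, ptm B U i j * ptm B U i' j' ∂μ = 0 := by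
  obtain ⟨_, _, _⟩ := hμ
  obtain ⟨k, hk⟩ := hB.separate i i' hi
  have h := integral_mul_left_eq_self (μ := μ)
    (fun U : Matrix.unitaryGroup m ℂ => ptm B U i j * ptm B U i' j') ⟨B k, hB.mem_unitaryGroup k⟩
  simp only [Submonoid.coe_mul, hB.ptm_basis_mul] at h
  have h' : ∀ U : Matrix.unitaryGroup m ℂ,
      (if anti k i = true then (-1 : ℝ) else 1) * ptm B U i j *
        ((if anti k i' = true then (-1 : ℝ) else 1) * ptm B U i' j')
      = -(ptm B U i j * ptm B U i' j') := by
    intro U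
    cases h1 : anti k i <;> cases h2 : anti k i' <;> simp_all
  simp only [h', integral_neg] at h
  linarith

theorem IsPauliBasis.haar_ne_right (hB : IsPauliBasis B anti) (hμ : IsHaarProbability μ)
    (i i' : ι) {j j' : ι} (hj : j ≠ j') :
    ∫ U : Matrix.unitaryGroup m ℂ, ptm B U i j * ptm B U i' j' ∂μ = 0 := by
  obtain ⟨_, _, _⟩ := hμ
  obtain ⟨k, hk⟩ := hB.separate j j' hj
  have h := integral_mul_right_eq_self (μ := μ)
    (fun U : Matrix.unitaryGroup m ℂ => ptm B U i j * ptm B U i' j') ⟨B k, hB.mem_unitaryGroup k⟩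
  simp only [Submonoid.coe_mul, hB.ptm_mul_basis] at h
  have h' : ∀ U : Matrix.unitaryGroup m ℂ,
      (if anti k j = true then (-1 : ℝ) else 1) * ptm B U i j *
        ((if anti k j' = true then (-1 : ℝ) else 1) * ptm B U i' j')
      = -(ptm B U i j * ptm B U i' j') := by
    intro U
    cases h1 : anti k j <;> cases h2 : anti k j' <;> simp_all
  simp only [h', integral_neg] at h
  linarith

/-- Anticommuting labels are exchanged by left multiplication with a fixed unitary
(`exists_conj_of_anti`). Two commuting labels are compared through a third one that anticommutes
with both, supplied by `link`. -/
theorem IsPauliBasis.haar_sq_eq (hB : IsPauliBasis B anti) (hμ : IsHaarProbability μ)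
    {i i' : ι} (hi : i ≠ 0) (hi' : i' ≠ 0) (j : ι) :
    ∫ U : Matrix.unitaryGroup m ℂ, ptm B U i j ^ 2 ∂μ
      = ∫ U : Matrix.unitaryGroup m ℂ, ptm B U i' j ^ 2 ∂μ := by
  obtain ⟨_, _, _⟩ := hμ
  have key : ∀ a b : ι, anti a b = true → ∫ U : Matrix.unitaryGroup m ℂ, ptm B U a j ^ 2 ∂μ
      = ∫ U : Matrix.unitaryGroup m ℂ, ptm B U b j ^ 2 ∂μ := by
    intro a b hab
    obtain ⟨W, hW, hWab⟩ := hB.exists_conj_of_anti hab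
    have h := integral_mul_left_eq_self (μ := μ)
      (fun U : Matrix.unitaryGroup m ℂ => ptm B U a j ^ 2) ⟨W, hW⟩
    simp only [Submonoid.coe_mul, ptm_conj W _ hWab] at h
    exact h.symm
  by_cases hii : i = i'
  · rw [hii]
  rcases hB.link i i' hi hi' hii with h | ⟨k, h1, h2⟩
  · exact key _ _ h
  · exact (key _ _ h1).symm.trans (key _ _ h2)

/-- A column other than that of the identity has unit length and no identity entry; by `haar_sq_eq`
its squared length is shared evenly by the remaining `card ι - 1` rows. -/
theorem IsPauliBasis.haar_sq [Nonempty m] (hB : IsPauliBasis B anti) (hμ : IsHaarProbability μ)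
    (i j : ι) : ∫ U : Matrix.unitaryGroup m ℂ, ptm B U i j ^ 2 ∂μ = twirl i j := by
  have := hμ.1
  by_cases hi : i = 0
  · subst hi
    have : ∀ U : Matrix.unitaryGroup m ℂ, ptm B (U : Matrix m m ℂ) 0 j ^ 2 = if j = 0 then 1 else 0 := by
      intro U
      rw [hB.ptm_zero_left U.2]
      split_ifs <;> simp
    simp [this, twirl]
  by_cases hj : j = 0
  · subst hj
    have : ∀ U : Matrix.unitaryGroup m ℂ, ptm B (U : Matrix m m ℂ) i 0 ^ 2 = 0 := by
      intro U
      rw [hB.ptm_zero_right U.2, if_neg hi]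
      simp
    simp [this, twirl, hi]
  have hs : ∑ k, ∫ U : Matrix.unitaryGroup m ℂ, ptm B U k j ^ 2 ∂μ = 1 := by
    rw [← integral_finsetSum]
    · simp [fun U : Matrix.unitaryGroup m ℂ => hB.sum_ptm_sq U.2]
    · intro k _
      exact integrable_of_continuous μ
        (((continuous_ptm B k j).comp continuous_subtype_val).pow 2)
  have h0 : ∫ U : Matrix.unitaryGroup m ℂ, ptm B U 0 j ^ 2 ∂μ = 0 := by
    have : ∀ U : Matrix.unitaryGroup m ℂ, ptm B (U : Matrix m m ℂ) 0 j ^ 2 = 0 := by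
      intro U
      rw [hB.ptm_zero_left U.2, if_neg hj]
      simp
    simp [this]
  rw [← Finset.add_sum_erase _ _ (Finset.mem_univ (0 : ι)), h0, zero_add,
    Finset.sum_congr rfl (g := fun _ => ∫ U : Matrix.unitaryGroup m ℂ, ptm B U i j ^ 2 ∂μ)
      (fun k hk => hB.haar_sq_eq hμ (Finset.ne_of_mem_erase hk) hi j), Finset.sum_const,
    Finset.card_erase_of_mem (Finset.mem_univ _), nsmul_eq_mul, Finset.card_univ,
    Nat.cast_sub Fintype.card_pos, Nat.cast_one] at hs
  rw [twirl, if_neg hi, if_neg hj]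
  have hne : (Fintype.card ι : ℝ) - 1 ≠ 0 := by
    intro h
    rw [h, zero_mul] at hs
    exact zero_ne_one hs
  rw [eq_div_iff hne, mul_comm]
  exact hs

/-- Second moments of the transfer matrix of a gate drawn from a `2`-design, multiplied by a fixed
unitary. -/
theorem IsPauliBasis.integral_ptm_mul_ptm [Nonempty m] (hB : IsPauliBasis B anti)
    {ν : Measure (Matrix.unitaryGroup m ℂ)} (hν : IsTwoDesign ν) {F : Matrix m m ℂ}
    (hF : F ∈ Matrix.unitaryGroup m ℂ) (i j i' j' : ι) :
    ∫ U : Matrix.unitaryGroup m ℂ, ptm B ((U : Matrix m m ℂ) * F) i j *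
      ptm B ((U : Matrix m m ℂ) * F) i' j' ∂ν = if i = i' ∧ j = j' then twirl i j else 0 := by
  obtain ⟨hν1, μ, hμ, h⟩ := hν
  have := hμ.1
  have := hμ.2.2
  rw [hB.integral_ptm_congr h]
  -- The fixed factor `F`, later the rotation by the parameter, is absorbed by right invariance.
  -- This is why the mean squares do not depend on `θ`.
  have h2 := integral_mul_right_eq_self (μ := μ)
    (fun U : Matrix.unitaryGroup m ℂ => ptm B U i j * ptm B U i' j') ⟨F, hF⟩
  simp only [Submonoid.coe_mul] at h2
  rw [h2]
  split_ifs with hc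
  · obtain ⟨rfl, rfl⟩ := hc
    simp only [← pow_two]
    exact hB.haar_sq hμ i j
  · by_cases hi : i = i'
    · exact hB.haar_ne_right hμ i i' fun hj => hc ⟨hi, hj⟩
    · exact hB.haar_ne_left hμ hi j j'

end Haar
end NoisyCircuit
end

noncomputable section

namespace NoisyCircuit

/-! ### Tensor products of one-qubit operators -/

section Tensor

variable {n : ℕ}

theorem tensorOp_mul (A B : Fin n → Op1) :
    tensorOp A * tensorOp B = tensorOp fun q => A q * B q := by
  ext x y
  simp only [tensorOp, Matrix.mul_apply, Matrix.of_apply, ← Finset.prod_mul_distrib]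
  rw [Finset.prod_univ_sum, Fintype.piFinset_univ]

theorem tensorOp_conjTranspose (A : Fin n → Op1) :
    (tensorOp A).conjTranspose = tensorOp fun q => (A q).conjTranspose := by
  ext x y
  simp [tensorOp, Matrix.conjTranspose_apply]

theorem tensorOp_one : tensorOp (fun _ : Fin n => (1 : Op1)) = 1 := by
  ext x y
  simp only [tensorOp, Matrix.of_apply, Matrix.one_apply]
  rw [Finset.prod_ite_zero]
  simp [funext_iff]

theorem trace_tensorOp (A : Fin n → Op1) : (tensorOp A).trace = ∏ q, (A q).trace := by
  simp only [tensorOp, Matrix.trace, Matrix.diag_apply, Matrix.of_apply]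
  rw [Finset.prod_univ_sum, Fintype.piFinset_univ]

theorem tensorOp_sum {κ : Type} [Fintype κ] (c : Fin n → κ → ℂ) (S : Fin n → κ → Op1) :
    tensorOp (fun q => ∑ r, c q r • S q r)
      = ∑ R : Fin n → κ, (∏ q, c q (R q)) • tensorOp fun q => S q (R q) := by
  classical
  ext x y
  simp only [tensorOp, Matrix.of_apply, Matrix.sum_apply, Matrix.smul_apply, smul_eq_mul,
    ← Finset.prod_mul_distrib]
  rw [Finset.prod_univ_sum, Fintype.piFinset_univ]

theorem pauliOp_conjTranspose (P : PauliString n) : (pauliOp P).conjTranspose = pauliOp P := by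
  simp only [pauliOp, tensorOp_conjTranspose, pauli_isPauliBasis.herm]

theorem pauliOp_zero : pauliOp (0 : PauliString n) = 1 := tensorOp_one

theorem pauliOp_sq (P : PauliString n) : pauliOp P * pauliOp P = 1 := by
  simp only [pauliOp, tensorOp_mul, pauli_isPauliBasis.sq, tensorOp_one]

theorem trace_pauliOp_mul (P Q : PauliString n) :
    (pauliOp P * pauliOp Q).trace = if P = Q then 2 ^ n else 0 := by
  simp only [pauliOp, tensorOp_mul, trace_tensorOp, pauli_isPauliBasis.trace_mul]
  rw [Finset.prod_ite_zero]
  simp [funext_iff]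

/-- The operator `K` on the qubits `a`, `b`, tensored with the operators `F q` on the others. -/
def embF (a b : Fin n) (K : Op2) (F : Fin n → Op1) : Op n :=
  Matrix.of fun x y => K (x a, x b) (y a, y b) *
    ∏ q ∈ (Finset.univ.erase a).erase b, F q (x q) (y q)

/-- The Pauli string `R` with its labels on the qubits `a`, `b` replaced by `s`. -/
def setPair (R : PauliString n) (a b : Fin n) (s : Fin 4 × Fin 4) : PauliString n :=
  Function.update (Function.update R a s.1) b s.2

variable {a b : Fin n}

theorem setPair_left (hab : a ≠ b) (R : PauliString n) (s : Fin 4 × Fin 4) :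
    setPair R a b s a = s.1 := by simp [setPair, hab]

theorem setPair_right (R : PauliString n) (s : Fin 4 × Fin 4) :
    setPair R a b s b = s.2 := by simp [setPair]

theorem setPair_of_ne {q : Fin n} (ha : q ≠ a) (hb : q ≠ b) (R : PauliString n)
    (s : Fin 4 × Fin 4) : setPair R a b s q = R q := by simp [setPair, ha, hb]

theorem setPair_setPair (hab : a ≠ b) (R : PauliString n) (s t : Fin 4 × Fin 4) :
    setPair (setPair R a b s) a b t = setPair R a b t := by
  ext1 q
  by_cases hb : q = b
  · subst hb; simp [setPair]
  by_cases ha : q = a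
  · subst ha; simp [setPair, hab]
  simp [setPair, ha, hb]

theorem setPair_self (R : PauliString n) : setPair R a b (R a, R b) = R := by
  simp [setPair]

/-- Exchanging the labels of `Q` on the pair with `S` is an involution. Reindexing by it turns a sum
over target strings into a sum over source strings. -/
theorem sum_setPair {M : Type} [AddCommMonoid M] (hab : a ≠ b)
    (f : PauliString n → Fin 4 × Fin 4 → M) :
    ∑ Q, ∑ S, f Q S = ∑ R, ∑ S, f (setPair R a b S) (R a, R b) := by
  rw [← Fintype.sum_prod_type', ← Fintype.sum_prod_type']
  refine Finset.sum_nbij' (fun p => (setPair p.1 a b p.2, (p.1 a, p.1 b)))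
    (fun p => (setPair p.1 a b p.2, (p.1 a, p.1 b))) (by simp) (by simp) ?_ ?_ ?_
  · rintro ⟨Q, S⟩ -
    simp [setPair_setPair hab, setPair_self, setPair_left hab, setPair_right]
  · rintro ⟨Q, S⟩ -
    simp [setPair_setPair hab, setPair_self, setPair_left hab, setPair_right]
  · rintro ⟨Q, S⟩ -
    simp [setPair_setPair hab, setPair_self, setPair_left hab, setPair_right]

theorem embF_kronecker (hab : a ≠ b) (C D : Op1) (F : Fin n → Op1) :
    embF a b (C ⊗ₖ D) F = tensorOp (Function.update (Function.update F a C) b D) := by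
  ext x y
  simp only [embF, tensorOp, Matrix.of_apply, Matrix.kroneckerMap_apply]
  rw [← Finset.mul_prod_erase Finset.univ _ (Finset.mem_univ a),
    ← Finset.mul_prod_erase (Finset.univ.erase a) _
      (Finset.mem_erase.2 ⟨hab.symm, Finset.mem_univ b⟩)]
  simp only [Function.update_self, Function.update_of_ne hab]
  rw [mul_assoc]
  congr 2
  refine Finset.prod_congr rfl fun q hq => ?_
  rw [Finset.mem_erase, Finset.mem_erase] at hq
  rw [Function.update_of_ne hq.1, Function.update_of_ne hq.2.1]

theorem embF_sum {κ : Type} (s : Finset κ) (K : κ → Op2) (F : Fin n → Op1) :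
    embF a b (∑ i ∈ s, K i) F = ∑ i ∈ s, embF a b (K i) F := by
  ext x y
  simp only [embF, Matrix.of_apply, Matrix.sum_apply, Finset.sum_mul]

theorem embF_smul (c : ℂ) (K : Op2) (F : Fin n → Op1) :
    embF a b (c • K) F = c • embF a b K F := by
  ext x y
  simp only [embF, Matrix.of_apply, Matrix.smul_apply, smul_eq_mul, mul_assoc]

theorem embF_pauli2 (hab : a ≠ b) (s : Fin 4 × Fin 4) (R : PauliString n) :
    embF a b (pauli2 s) (fun q => pauli (R q)) = pauliOp (setPair R a b s) := by
  rw [pauli2, embF_kronecker hab, pauliOp]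
  congr 1
  ext1 q
  by_cases hb : q = b
  · subst hb; simp [setPair]
  by_cases ha : q = a
  · subst ha; simp [setPair, hab]
  simp [setPair, ha, hb]

theorem pauliOp_eq_embF (hab : a ≠ b) (R : PauliString n) :
    pauliOp R = embF a b (pauli2 (R a, R b)) fun q => pauli (R q) := by
  rw [embF_pauli2 hab, setPair_self]

theorem embed_eq_embF (K : Op2) : embed a b K = embF a b K fun _ => 1 := by
  ext x y
  simp only [embed, embF, Matrix.of_apply, Matrix.one_apply, Finset.prod_ite_zero]
  have : (∀ q, q ≠ a → q ≠ b → x q = y q) ↔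
      ∀ q ∈ (Finset.univ.erase a).erase b, x q = y q := by
    simp only [Finset.mem_erase, Finset.mem_univ, and_true]
    exact ⟨fun h q hq => h q hq.2 hq.1, fun h q ha hb => h q ⟨hb, ha⟩⟩
  simp only [this]
  split_ifs <;> simp

/-- Both sides are bilinear in `K` and `K'`, so Pauli products suffice, and for these everything is
a tensor product over the qubits. -/
theorem embF_mul (hab : a ≠ b) (K K' : Op2) (F F' : Fin n → Op1) :
    embF a b K F * embF a b K' F' = embF a b (K * K') fun q => F q * F' q := by
  have h : ∀ s t, embF a b (pauli2 s) F * embF a b (pauli2 t) F'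
      = embF a b (pauli2 s * pauli2 t) fun q => F q * F' q := by
    intro s t
    simp only [pauli2]
    rw [embF_kronecker hab, embF_kronecker hab, tensorOp_mul, ← Matrix.mul_kronecker_mul,
      embF_kronecker hab]
    congr 1
    ext1 q
    by_cases hb : q = b
    · subst hb; simp
    by_cases ha : q = a
    · subst ha; simp [hab]
    simp [ha, hb]
  rw [pauli2_isPauliBasis.expand K, pauli2_isPauliBasis.expand K']
  simp only [Matrix.sum_mul, Matrix.mul_sum, Matrix.smul_mul, Matrix.mul_smul, embF_sum, embF_smul, h,
    Finset.smul_sum]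

theorem embF_conjTranspose (K : Op2) (F : Fin n → Op1) :
    (embF a b K F).conjTranspose = embF a b K.conjTranspose fun q => (F q).conjTranspose := by
  ext x y
  simp [embF, Matrix.conjTranspose_apply]

theorem embed_mul (hab : a ≠ b) (K K' : Op2) : embed a b K * embed a b K' = embed a b (K * K') := by
  simp only [embed_eq_embF, embF_mul hab, mul_one]

theorem embed_conjTranspose (K : Op2) :
    (embed a b K).conjTranspose = embed a b K.conjTranspose := by
  simp only [embed_eq_embF, embF_conjTranspose, Matrix.conjTranspose_one]

theorem embed_one (hab : a ≠ b) : embed a b (1 : Op2) = 1 := by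
  rw [embed_eq_embF, ← Matrix.one_kronecker_one, embF_kronecker hab, ← tensorOp_one]
  congr 1
  simp

theorem embed_sub (K K' : Op2) : embed a b (K - K') = embed a b K - embed a b K' := by
  ext x y
  simp only [embed, Matrix.of_apply, Matrix.sub_apply]
  split_ifs <;> simp

theorem embed_smul (c : ℂ) (K : Op2) : embed a b (c • K) = c • embed a b K := by
  ext x y
  simp only [embed, Matrix.of_apply, Matrix.smul_apply]
  split_ifs <;> simp

theorem embed_sum {κ : Type} (s : Finset κ) (c : κ → ℂ) (K : κ → Op2) :
    embed a b (∑ i ∈ s, c i • K i) = ∑ i ∈ s, c i • embed a b (K i) := by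
  simp only [embed_eq_embF, embF_sum, embF_smul]

theorem embed_pauli2 (hab : a ≠ b) (s : Fin 4 × Fin 4) :
    embed a b (pauli2 s) = pauliOp (setPair (0 : PauliString n) a b s) := by
  rw [embed_eq_embF, ← embF_pauli2 hab]
  rfl

theorem embed_mul_pauliOp (hab : a ≠ b) (K : Op2) (R : PauliString n) :
    embed a b K * pauliOp R = embF a b (K * pauli2 (R a, R b)) fun q => pauli (R q) := by
  rw [embed_eq_embF, pauliOp_eq_embF hab, embF_mul hab]
  simp

theorem pauliOp_mul_embed (hab : a ≠ b) (K : Op2) (R : PauliString n) :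
    pauliOp R * embed a b K = embF a b (pauli2 (R a, R b) * K) fun q => pauli (R q) := by
  rw [embed_eq_embF, pauliOp_eq_embF hab, embF_mul hab]
  simp

/-- Each Pauli term of `K'` is the identity on `a` and `b`. This is what lets a generator slide past
the earlier gates of its layer. -/
theorem embed_commute_of_disjoint {c d : Fin n} (hab : a ≠ b) (hcd : c ≠ d) (hac : c ≠ a)
    (hcb : c ≠ b) (hda : d ≠ a) (hdb : d ≠ b) (K K' : Op2) :
    embed a b K * embed c d K' = embed c d K' * embed a b K := by
  rw [pauli2_isPauliBasis.expand K', embed_sum]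
  simp only [Matrix.mul_sum, Matrix.sum_mul, Matrix.mul_smul, Matrix.smul_mul]
  refine Finset.sum_congr rfl fun s _ => ?_
  rw [embed_pauli2 hcd, embed_mul_pauliOp hab, pauliOp_mul_embed hab]
  have h1 : setPair (0 : PauliString n) c d s a = 0 := by
    rw [setPair_of_ne hac.symm hda.symm]; rfl
  have h2 : setPair (0 : PauliString n) c d s b = 0 := by
    rw [setPair_of_ne hcb.symm hdb.symm]; rfl
  rw [h1, h2, show ((0 : Fin 4), (0 : Fin 4)) = 0 from rfl, pauli2_isPauliBasis.zero, one_mul,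
    mul_one]

theorem trace_embF (hab : a ≠ b) (K : Op2) (F : Fin n → Op1) :
    (embF a b K F).trace = K.trace * ∏ q ∈ (Finset.univ.erase a).erase b, (F q).trace := by
  have h : ∀ s, (embF a b (pauli2 s) F).trace
      = (pauli2 s).trace * ∏ q ∈ (Finset.univ.erase a).erase b, (F q).trace := by
    intro s
    rw [pauli2, embF_kronecker hab, trace_tensorOp, Matrix.trace_kronecker,
      ← Finset.mul_prod_erase Finset.univ _ (Finset.mem_univ a),
      ← Finset.mul_prod_erase (Finset.univ.erase a) _
        (Finset.mem_erase.2 ⟨hab.symm, Finset.mem_univ b⟩)]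
    simp only [Function.update_self, Function.update_of_ne hab]
    rw [mul_assoc]
    congr 2
    refine Finset.prod_congr rfl fun q hq => ?_
    rw [Finset.mem_erase, Finset.mem_erase] at hq
    rw [Function.update_of_ne hq.1, Function.update_of_ne hq.2.1]
  rw [pauli2_isPauliBasis.expand K]
  simp only [embF_sum, embF_smul, Matrix.trace_sum, Matrix.trace_smul, h, Finset.sum_mul, smul_eq_mul,
    mul_assoc]

end Tensor
end NoisyCircuit
end

noncomputable section

namespace NoisyCircuit

/-! ### Heisenberg evolution of Pauli coefficients -/

section Vectors

variable {n : ℕ}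

/-- The operator with the given Pauli coefficients. -/
def ofVec (v : PauliString n → ℝ) : Op n := ∑ R, (v R : ℂ) • pauliOp R

/-- Evolution of Pauli coefficients under a gate on the qubits `a`, `b` with transfer matrix `u`. -/
def gateStep (a b : Fin n) (u : Fin 4 × Fin 4 → Fin 4 × Fin 4 → ℝ) (v : PauliString n → ℝ) :
    PauliString n → ℝ := fun R => ∑ S, u S (R a, R b) * v (setPair R a b S)

/-- Evolution of Pauli coefficients under one-qubit maps with transfer matrices `t q`. -/
def siteStep (t : Fin n → Fin 4 → Fin 4 → ℝ) (v : PauliString n → ℝ) :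
    PauliString n → ℝ := fun R => ∑ Q : PauliString n, (∏ q, t q (Q q) (R q)) * v Q

theorem ofVec_conjTranspose (v : PauliString n → ℝ) : (ofVec v).conjTranspose = ofVec v := by
  simp [ofVec, Matrix.conjTranspose_sum, pauliOp_conjTranspose]

theorem trace_pauliOp_mul_ofVec (R : PauliString n) (v : PauliString n → ℝ) :
    (pauliOp R * ofVec v).trace = 2 ^ n * (v R : ℂ) := by
  simp only [ofVec, Matrix.mul_sum, Matrix.mul_smul, Matrix.trace_sum, Matrix.trace_smul,
    trace_pauliOp_mul, smul_eq_mul, mul_ite, mul_zero, Finset.sum_ite_eq, Finset.mem_univ, if_true]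
  ring

theorem ofVec_single (P : PauliString n) : ofVec (Pi.single P 1) = pauliOp P := by
  rw [ofVec, Finset.sum_eq_single P]
  · simp
  · intro R _ hR
    simp [hR]
  · simp

theorem mem_opSupport_ofVec {v : PauliString n → ℝ} {q : Fin n} :
    q ∈ opSupport (ofVec v) ↔ ∃ R, v R ≠ 0 ∧ R q ≠ 0 := by
  simp [opSupport, trace_pauliOp_mul_ofVec]

theorem conj_embed_pauliOp {a b : Fin n} (hab : a ≠ b) (W : Op2) (R : PauliString n) :
    (embed a b W).conjTranspose * pauliOp R * embed a b W
      = ∑ S, (ptm pauli2 W (R a, R b) S : ℂ) • pauliOp (setPair R a b S) := by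
  rw [embed_conjTranspose, embed_mul_pauliOp hab, embed_eq_embF, embF_mul hab,
    pauli2_isPauliBasis.conj_expand]
  simp only [embF_sum, embF_smul, mul_one, embF_pauli2 hab]

theorem conj_embed_ofVec {a b : Fin n} (hab : a ≠ b) (W : Op2) (v : PauliString n → ℝ) :
    (embed a b W).conjTranspose * ofVec v * embed a b W
      = ofVec (gateStep a b (ptm pauli2 W) v) := by
  simp only [ofVec, gateStep, Matrix.mul_sum, Matrix.sum_mul, Matrix.mul_smul, Matrix.smul_mul,
    conj_embed_pauliOp hab, Finset.smul_sum]
  push_cast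
  simp only [Finset.sum_smul]
  rw [sum_setPair hab]
  refine Finset.sum_congr rfl fun R _ => Finset.sum_congr rfl fun S _ => ?_
  rw [setPair_setPair hab, setPair_self, setPair_left hab, setPair_right, smul_smul, mul_comm]

/-- `A'` is the Hilbert-Schmidt adjoint of `Φ` applied to `A`, for Hermitian `A`. -/
def IsDual {m : Type} [Fintype m] (Φ : Matrix m m ℂ →ₗ[ℂ] Matrix m m ℂ) (A A' : Matrix m m ℂ) :
    Prop := ∀ B, (A * Φ B).trace = (A' * B).trace

theorem IsDual.comp {m : Type} [Fintype m] {Φ Ψ : Matrix m m ℂ →ₗ[ℂ] Matrix m m ℂ}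
    {A A' A'' : Matrix m m ℂ} (h : IsDual Φ A A') (h' : IsDual Ψ A' A'') :
    IsDual (Φ ∘ₗ Ψ) A A'' := fun B => (h (Ψ B)).trans (h' B)

/-- On Hermitian operators the bilinear pairing in `IsDual` agrees with the Hilbert-Schmidt one, and
nondegeneracy of the trace identifies the adjoint. The light cone is thereby expressed through Pauli
coefficients. -/
theorem IsDual.hsAdjoint_eq {m : Type} [Fintype m] [DecidableEq m]
    {Φ : Matrix m m ℂ →ₗ[ℂ] Matrix m m ℂ}
    {A A' : Matrix m m ℂ} (h : IsDual Φ A A') (hA : A.conjTranspose = A)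
    (hA' : A'.conjTranspose = A') : hsAdjoint Φ A = A' := by
  have : (hsAdjoint Φ A).conjTranspose = A' := by
    rw [Matrix.ext_iff_trace_mul_right]
    intro B
    rw [hsAdjoint_spec, hA, h B]
  rw [← hA', ← this, Matrix.conjTranspose_conjTranspose]

theorem isDual_conjMap {m : Type} [Fintype m] (U A : Matrix m m ℂ) :
    IsDual (conjMap U) A (U.conjTranspose * A * U) := by
  intro B
  change (A * (U * B * U.conjTranspose)).trace = _
  rw [Matrix.mul_assoc U.conjTranspose, Matrix.mul_assoc U.conjTranspose,
    Matrix.trace_mul_comm U.conjTranspose]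
  simp only [Matrix.mul_assoc]

theorem isDual_conjMap_embed {a b : Fin n} (hab : a ≠ b) (W : Op2) (v : PauliString n → ℝ) :
    IsDual (conjMap (embed a b W)) (ofVec v) (ofVec (gateStep a b (ptm pauli2 W) v)) := by
  rw [← conj_embed_ofVec hab]
  exact isDual_conjMap _ _

theorem sum_siteStep_smul {M : Type} [AddCommGroup M] [Module ℂ M]
    (t : Fin n → Fin 4 → Fin 4 → ℝ) (v : PauliString n → ℝ) (f : PauliString n → M) :
    ∑ R, (siteStep t v R : ℂ) • f R
      = ∑ Q, (v Q : ℂ) • ∑ R : PauliString n, (∏ q, (t q (Q q) (R q) : ℂ)) • f R := by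
  simp only [siteStep, Complex.ofReal_sum, Complex.ofReal_mul, Complex.ofReal_prod,
    Finset.sum_smul, Finset.smul_sum, smul_smul]
  rw [Finset.sum_comm]
  simp only [mul_comm]

theorem isDual_conjMap_tensorOp (V : Fin n → Op1) (v : PauliString n → ℝ) :
    IsDual (conjMap (tensorOp V)) (ofVec v) (ofVec (siteStep (fun q => ptm pauli (V q)) v)) := by
  have h : (tensorOp V).conjTranspose * ofVec v * tensorOp V
      = ofVec (siteStep (fun q => ptm pauli (V q)) v) := by
    rw [ofVec, ofVec, sum_siteStep_smul, Matrix.mul_sum, Matrix.sum_mul]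
    refine Finset.sum_congr rfl fun Q _ => ?_
    rw [Matrix.mul_smul, Matrix.smul_mul, pauliOp, tensorOp_conjTranspose, tensorOp_mul,
      tensorOp_mul]
    simp only [pauli_isPauliBasis.conj_expand]
    rw [tensorOp_sum]
    rfl
  rw [← h]
  exact isDual_conjMap _ _

theorem trace_mul_eq_sum {m : Type} [Fintype m] [DecidableEq m] (A B : Matrix m m ℂ) :
    (A * B).trace = ∑ u, ∑ v, B u v * (A * Matrix.single u v 1).trace := by
  conv_lhs => rw [Matrix.matrix_eq_sum_single B]
  simp only [Matrix.mul_sum, Matrix.trace_sum]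
  refine Finset.sum_congr rfl fun i _ => Finset.sum_congr rfl fun j _ => ?_
  rw [show Matrix.single i j (B i j) = B i j • Matrix.single i j (1 : ℂ) by
    simp [Matrix.smul_single], Matrix.mul_smul, Matrix.trace_smul, smul_eq_mul]

theorem trace_mul_single {m : Type} [Fintype m] [DecidableEq m] (A : Matrix m m ℂ) (u v : m) :
    (A * Matrix.single u v 1).trace = A v u := by
  simp [Matrix.trace_mul_single]

variable {N : Op1 →ₗ[ℂ] Op1}

theorem IsQuantumChannel.conjTranspose (hN : IsQuantumChannel N) (A : Op1) :
    (N A).conjTranspose = N A.conjTranspose := by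
  obtain ⟨r, K, -, h⟩ := hN
  simp [h, Matrix.conjTranspose_sum, Matrix.conjTranspose_mul, Matrix.mul_assoc]

theorem IsQuantumChannel.trace_map (hN : IsQuantumChannel N) (A : Op1) :
    (N A).trace = A.trace := by
  obtain ⟨r, K, hK, h⟩ := hN
  rw [h, Matrix.trace_sum]
  simp only [Matrix.trace_mul_comm _ (K _).conjTranspose, ← Matrix.mul_assoc]
  rw [← Matrix.trace_sum, ← Matrix.sum_mul, hK, Matrix.one_mul]

theorem IsQuantumChannel.ofReal_transferEntry (hN : IsQuantumChannel N) (Q P : Fin 4) :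
    (transferEntry N Q P : ℂ) = (pauli Q * N (pauli P)).trace / 2 := by
  have h : (N (pauli P)).conjTranspose = N (pauli P) := by
    rw [hN.conjTranspose, pauli_isPauliBasis.herm]
  rw [transferEntry, ← pauli_isPauliBasis.trace_im h]
  norm_num

theorem IsQuantumChannel.transferEntry_zero (hN : IsQuantumChannel N) (P : Fin 4) :
    transferEntry N 0 P = if P = 0 then 1 else 0 := by
  have h := pauli_isPauliBasis.trace_mul 0 P
  rw [pauli_isPauliBasis.zero, one_mul] at h
  rw [transferEntry, pauli_isPauliBasis.zero, one_mul, hN.trace_map, h]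
  by_cases hP : P = 0
  · simp [hP]
  · simp [hP, Ne.symm hP]

theorem IsQuantumChannel.trace_pauli_mul_map (hN : IsQuantumChannel N) (Q : Fin 4) (B : Op1) :
    (pauli Q * N B).trace = ∑ R, (transferEntry N Q R : ℂ) * (pauli R * B).trace := by
  conv_lhs => rw [pauli_isPauliBasis.expand B]
  simp only [map_sum, map_smul, Matrix.mul_sum, Matrix.mul_smul, Matrix.trace_sum,
    Matrix.trace_smul, hN.ofReal_transferEntry, smul_eq_mul]
  refine Finset.sum_congr rfl fun R _ => ?_
  simp only [Fintype.card_fin, Nat.cast_ofNat]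
  ring

theorem isDual_noiseLayer (hN : IsQuantumChannel N) (v : PauliString n → ℝ) :
    IsDual (noiseLayer n N) (ofVec v) (ofVec (siteStep (fun _ => transferEntry N) v)) := by
  -- Both sides are linear in `B`, and on matrix units the noise layer is a tensor product, so the
  -- trace factors over the qubits.
  have key : ∀ (Q : PauliString n) (B : Op n), (pauliOp Q * noiseLayer n N B).trace
      = ((∑ R : PauliString n, (∏ q, (transferEntry N (Q q) (R q) : ℂ)) • pauliOp R) * B).trace := by
    intro Q B
    rw [trace_mul_eq_sum _ B]
    change (pauliOp Q * ∑ u : Fin n → Fin 2, ∑ v : Fin n → Fin 2,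
      B u v • tensorOp fun q => N (Matrix.single (u q) (v q) 1)).trace = _
    simp only [Matrix.mul_sum, Matrix.trace_sum, Matrix.mul_smul, Matrix.trace_smul, smul_eq_mul]
    refine Finset.sum_congr rfl fun x _ => Finset.sum_congr rfl fun y _ => ?_
    congr 1
    rw [pauliOp, tensorOp_mul, trace_tensorOp]
    simp only [hN.trace_pauli_mul_map, Matrix.sum_mul, Matrix.trace_sum, Matrix.smul_mul,
      Matrix.trace_smul, trace_mul_single]
    rw [Finset.prod_univ_sum, Fintype.piFinset_univ]
    refine Finset.sum_congr rfl fun R _ => ?_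
    rw [Finset.prod_mul_distrib]
    rfl
  intro B
  rw [ofVec, ofVec, sum_siteStep_smul]
  simp only [Matrix.sum_mul, Matrix.smul_mul, Matrix.trace_sum, Matrix.trace_smul, key]

end Vectors

namespace Ansatz

variable {n L : ℕ} (A : Ansatz n L)

theorem exp_mem_unitaryGroup {m : Type} [Fintype m] [DecidableEq m] {H : Matrix m m ℂ}
    (hH : H.IsHermitian) (t : ℝ) :
    NormedSpace.exp (-(Complex.I * (t : ℂ)) • H) ∈ Matrix.unitaryGroup m ℂ := by
  rw [Matrix.mem_unitaryGroup_iff, Matrix.star_eq_conjTranspose, ← Matrix.exp_conjTranspose,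
    Matrix.conjTranspose_smul, hH.eq,
    ← Matrix.exp_add_of_commute _ _ (((Commute.refl H).smul_left _).smul_right _), ← add_smul]
  simp [NormedSpace.exp_zero]

/-- The unitary of a gate depending on its parameter, without the random part. -/
def rotation (θ : A.Gate → ℝ) (g : A.Gate) : Op2 :=
  NormedSpace.exp (-(Complex.I * (θ g : ℂ)) • A.generator g)

theorem rotation_mem (θ : A.Gate → ℝ) (g : A.Gate) :
    A.rotation θ g ∈ Matrix.unitaryGroup (Fin 2 × Fin 2) ℂ :=
  exp_mem_unitaryGroup (A.generator_hermitian g) _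

theorem gateOp_mem (ω : A.Config) (θ : A.Gate → ℝ) (g : A.Gate) :
    A.gateOp ω θ g ∈ Matrix.unitaryGroup (Fin 2 × Fin 2) ℂ :=
  mul_mem (ω.1 g).2 (A.rotation_mem θ g)

/-- Evolution of Pauli coefficients under the given gates of a layer, the last one first. -/
def gatesEvolve (ω : A.Config) (θ : A.Gate → ℝ) (j : Fin L) (l : List (Fin (A.numGates j)))
    (v : PauliString n → ℝ) : PauliString n → ℝ :=
  l.foldr (fun i w => gateStep (A.left j i) (A.right j i) (ptm pauli2 (A.gateOp ω θ ⟨j, i⟩)) w) v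

/-- Evolution of Pauli coefficients under the one-qubit gates of a layer and the noise. -/
def noiseEvolve (N : Op1 →ₗ[ℂ] Op1) (ω : A.Config) (j : Fin L)
    (v : PauliString n → ℝ) : PauliString n → ℝ :=
  siteStep (fun _ => transferEntry N) (siteStep (fun q => ptm pauli (ω.2 (j, q) : Op1)) v)

/-- Evolution of Pauli coefficients under the given layers, the last one first. -/
def evolve (N : Op1 →ₗ[ℂ] Op1) (ω : A.Config) (θ : A.Gate → ℝ) (l : List (Fin L))
    (v : PauliString n → ℝ) : PauliString n → ℝ :=
  l.foldr (fun j w => A.gatesEvolve ω θ j (List.finRange _) (A.noiseEvolve N ω j w)) v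

/-- The product of the given gates of a layer. -/
def gatesOp (ω : A.Config) (θ : A.Gate → ℝ) (j : Fin L) (l : List (Fin (A.numGates j))) : Op n :=
  l.foldr (fun i M => M * embed (A.left j i) (A.right j i) (A.gateOp ω θ ⟨j, i⟩)) 1

/-- Converts the left folds of the definitions into right folds, which suit induction on lists. It
serves for products of gates and, in `Module.End`, for compositions of layers. -/
theorem foldl_mul_eq {α M : Type} [Monoid M] (f : α → M) (l : List α) (x : M) :
    l.foldl (fun y i => f i * y) x = l.foldr (fun i y => y * f i) 1 * x := by
  induction l generalizing x with
  | nil => simp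
  | cons i l ih => rw [List.foldl_cons, ih, List.foldr_cons, mul_assoc]

theorem layerUnitary_eq (ω : A.Config) (θ : A.Gate → ℝ) (j : Fin L) :
    A.layerUnitary ω θ j = A.gatesOp ω θ j (List.finRange _) := by
  rw [layerUnitary, foldl_mul_eq, mul_one]
  rfl

theorem isDual_gatesOp (ω : A.Config) (θ : A.Gate → ℝ) (j : Fin L)
    (l : List (Fin (A.numGates j))) (v : PauliString n → ℝ) :
    IsDual (conjMap (A.gatesOp ω θ j l)) (ofVec v) (ofVec (A.gatesEvolve ω θ j l v)) := by
  induction l with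
  | nil => intro B; simp [gatesOp, gatesEvolve, conjMap]
  | cons i l ih =>
    have h : conjMap (A.gatesOp ω θ j (i :: l)) = conjMap (A.gatesOp ω θ j l) ∘ₗ
        conjMap (embed (A.left j i) (A.right j i) (A.gateOp ω θ ⟨j, i⟩)) := by
      ext1 B
      simp [gatesOp, conjMap, Matrix.conjTranspose_mul, Matrix.mul_assoc]
    rw [h]
    exact ih.comp (isDual_conjMap_embed (A.left_ne_right j i) _ _)

theorem isDual_layerMap {N : Op1 →ₗ[ℂ] Op1} (hN : IsQuantumChannel N) (ω : A.Config)
    (θ : A.Gate → ℝ) (j : Fin L) (v : PauliString n → ℝ) :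
    IsDual (A.layerMap N ω θ j) (ofVec v)
      (ofVec (A.gatesEvolve ω θ j (List.finRange _) (A.noiseEvolve N ω j v))) := by
  rw [layerMap, layerUnitary_eq]
  exact (isDual_conjMap_tensorOp _ _).comp ((isDual_noiseLayer hN _).comp (A.isDual_gatesOp ω θ j _ _))

theorem layersMap_cons (N : Op1 →ₗ[ℂ] Op1) (ω : A.Config) (θ : A.Gate → ℝ) (j : Fin L)
    (l : List (Fin L)) :
    A.layersMap N ω θ (j :: l) = A.layersMap N ω θ l ∘ₗ A.layerMap N ω θ j := by
  have := foldl_mul_eq (M := Module.End ℂ (Op n)) (A.layerMap N ω θ)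
  have h1 := this (j :: l) 1
  have h2 := this l 1
  rw [mul_one] at h1 h2
  exact h1.trans (congrArg (· * A.layerMap N ω θ j) h2.symm)

theorem layersMap_append (N : Op1 →ₗ[ℂ] Op1) (ω : A.Config) (θ : A.Gate → ℝ)
    (l l' : List (Fin L)) :
    A.layersMap N ω θ (l ++ l') = A.layersMap N ω θ l' ∘ₗ A.layersMap N ω θ l := by
  induction l with
  | nil => rfl
  | cons j l ih => rw [List.cons_append, layersMap_cons, ih, layersMap_cons, LinearMap.comp_assoc]

theorem isDual_layersMap {N : Op1 →ₗ[ℂ] Op1} (hN : IsQuantumChannel N) (ω : A.Config)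
    (θ : A.Gate → ℝ) (l : List (Fin L)) (v : PauliString n → ℝ) :
    IsDual (A.layersMap N ω θ l) (ofVec v) (ofVec (A.evolve N ω θ l v)) := by
  induction l with
  | nil => intro B; rfl
  | cons j l ih =>
    rw [layersMap_cons]
    exact ih.comp (A.isDual_layerMap hN ω θ j _)

theorem hsAdjoint_circuitFrom {N : Op1 →ₗ[ℂ] Op1} (hN : IsQuantumChannel N) (ω : A.Config)
    (θ : A.Gate → ℝ) (k : Fin L) (P : PauliString n) :
    hsAdjoint (A.circuitFrom N ω θ k) (pauliOp P)
      = ofVec (A.evolve N ω θ ((List.finRange L).filter fun j => k ≤ j) (Pi.single P 1)) := by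
  refine IsDual.hsAdjoint_eq ?_ (pauliOp_conjTranspose P) (ofVec_conjTranspose _)
  rw [← ofVec_single P]
  exact A.isDual_layersMap hN ω θ _ _

end Ansatz
end NoisyCircuit
end

noncomputable section

namespace NoisyCircuit

/-! ### Independence of the gates -/

-- Comparing measures of rectangles, taking the coordinates in `s` from one sample and the others
-- from an independent copy does not change the law. Independence of the gates is used in this form.
open Classical in
theorem measurePreserving_resample {ι : Type} [Fintype ι] {X : ι → Type}
    [∀ i, MeasurableSpace (X i)] (μ : ∀ i, Measure (X i)) [∀ i, IsProbabilityMeasure (μ i)]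
    (s : Set ι) :
    MeasurePreserving (fun p : (∀ i, X i) × (∀ i, X i) => fun i => if i ∈ s then p.1 i else p.2 i)
      ((Measure.pi μ).prod (Measure.pi μ)) (Measure.pi μ) := by
  have hm : Measurable
      (fun p : (∀ i, X i) × (∀ i, X i) => fun i => if i ∈ s then p.1 i else p.2 i) := by
    refine measurable_pi_lambda _ fun i => ?_
    by_cases h : i ∈ s
    · simp only [h, if_true]; fun_prop
    · simp only [h, if_false]; fun_prop
  refine ⟨hm, (Measure.pi_eq fun t ht => ?_).symm⟩
  rw [Measure.map_apply hm (MeasurableSet.univ_pi ht)]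
  have : (fun p : (∀ i, X i) × (∀ i, X i) => fun i => if i ∈ s then p.1 i else p.2 i) ⁻¹'
      Set.univ.pi t = (Set.univ.pi fun i => if i ∈ s then t i else Set.univ) ×ˢ
        (Set.univ.pi fun i => if i ∈ s then Set.univ else t i) := by
    ext p
    simp only [Set.mem_preimage, Set.mem_pi, Set.mem_univ, true_imp_iff, Set.mem_prod]
    rw [← forall_and]
    refine forall_congr' fun i => ?_
    by_cases h : i ∈ s <;> simp [h]
  rw [this, Measure.prod_prod, Measure.pi_pi, Measure.pi_pi, ← Finset.prod_mul_distrib]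
  refine Finset.prod_congr rfl fun i _ => ?_
  by_cases h : i ∈ s <;> simp [h]

theorem measurePreserving_prodComm_inner {α β γ δ : Type} [MeasurableSpace α] [MeasurableSpace β]
    [MeasurableSpace γ] [MeasurableSpace δ] (a : Measure α) (b : Measure β) (c : Measure γ)
    (d : Measure δ) [IsProbabilityMeasure a] [IsProbabilityMeasure b] [IsProbabilityMeasure c]
    [IsProbabilityMeasure d] :
    MeasurePreserving (fun p : (α × β) × (γ × δ) => ((p.1.1, p.2.1), (p.1.2, p.2.2)))
      ((a.prod b).prod (c.prod d)) ((a.prod c).prod (b.prod d)) := by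
  have h1 := measurePreserving_prodAssoc a b (c.prod d)
  have h2 := (MeasurePreserving.id a).prod
    (MeasurePreserving.symm MeasurableEquiv.prodAssoc (measurePreserving_prodAssoc b c d))
  have h3 := (MeasurePreserving.id a).prod
    ((Measure.measurePreserving_swap (μ := b) (ν := c)).prod (MeasurePreserving.id d))
  have h4 := (MeasurePreserving.id a).prod (measurePreserving_prodAssoc c b d)
  have h5 := MeasurePreserving.symm MeasurableEquiv.prodAssoc
    (measurePreserving_prodAssoc a c (b.prod d))
  exact h5.comp (h4.comp (h3.comp (h2.comp h1)))

namespace Ansatz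

variable {n L : ℕ} (A : Ansatz n L)

instance (g : A.Gate) : IsProbabilityMeasure (A.gateLaw g) := (A.gateLaw_design g).1

instance (s : Fin L × Fin n) : IsProbabilityMeasure (A.singleLaw s) := (A.singleLaw_design s).1

instance : IsProbabilityMeasure A.law := by unfold law; infer_instance

theorem integrable {E : Type} [NormedAddCommGroup E] [SecondCountableTopology E]
    {f : A.Config → E} (hf : Continuous f) : Integrable f A.law :=
  integrable_of_continuous A.law hf

/-- `f` is a function of the two-qubit gates in `s` and of the one-qubit gates in `t`. -/
def DependsOnGates {β : Type} (f : A.Config → β) (s : Set A.Gate) (t : Set (Fin L × Fin n)) : Prop :=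
  ∀ ω ω' : A.Config, (∀ g ∈ s, ω.1 g = ω'.1 g) → (∀ p ∈ t, ω.2 p = ω'.2 p) → f ω = f ω'

variable {A}

theorem DependsOnGates.mono {β : Type} {f : A.Config → β} {s s' : Set A.Gate}
    {t t' : Set (Fin L × Fin n)} (h : A.DependsOnGates f s t) (hs : s ⊆ s') (ht : t ⊆ t') :
    A.DependsOnGates f s' t' :=
  fun ω ω' h1 h2 => h ω ω' (fun g hg => h1 g (hs hg)) fun p hp => h2 p (ht hp)

/-- In the resampled configuration `f` sees only the first copy and `F` only the second, so the
integral factors over the product space. -/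
theorem integral_mul_of_disjoint {f F : A.Config → ℝ} (hfc : Continuous f) (hFc : Continuous F)
    {s s' : Set A.Gate} {t t' : Set (Fin L × Fin n)} (hf : A.DependsOnGates f s t)
    (hF : A.DependsOnGates F s' t') (hs : Disjoint s s') (ht : Disjoint t t') :
    ∫ ω, f ω * F ω ∂A.law = (∫ ω, f ω ∂A.law) * ∫ ω, F ω ∂A.law := by
  classical
  have h1 := measurePreserving_resample A.gateLaw s
  have h2 := measurePreserving_resample A.singleLaw t
  have hmp : MeasurePreserving (fun p : A.Config × A.Config =>
      ((fun i => if i ∈ s then p.1.1 i else p.2.1 i, fun i => if i ∈ t then p.1.2 i else p.2.2 i) :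
        A.Config)) (A.law.prod A.law) A.law := by
    have h3 := h1.prod h2
    have h4 : MeasurePreserving (fun p : A.Config × A.Config => ((p.1.1, p.2.1), (p.1.2, p.2.2)))
        (A.law.prod A.law) (((Measure.pi A.gateLaw).prod (Measure.pi A.gateLaw)).prod
          ((Measure.pi A.singleLaw).prod (Measure.pi A.singleLaw))) :=
      measurePreserving_prodComm_inner _ _ _ _
    exact h3.comp h4
  have hint : ∫ ω, f ω * F ω ∂A.law = ∫ p : A.Config × A.Config, f p.1 * F p.2 ∂A.law.prod A.law := by
    conv_lhs => rw [← hmp.map_eq]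
    rw [integral_map (f := fun ω => f ω * F ω) hmp.aemeasurable (hfc.mul hFc).aestronglyMeasurable]
    refine integral_congr_ae (Filter.Eventually.of_forall fun p => ?_)
    have e1 : f ((fun i => if i ∈ s then p.1.1 i else p.2.1 i,
        fun i => if i ∈ t then p.1.2 i else p.2.2 i) : A.Config) = f p.1 :=
      hf _ _ (fun g hg => if_pos hg) fun q hq => if_pos hq
    have e2 : F ((fun i => if i ∈ s then p.1.1 i else p.2.1 i,
        fun i => if i ∈ t then p.1.2 i else p.2.2 i) : A.Config) = F p.2 :=
      hF _ _ (fun g hg => if_neg fun h => Set.disjoint_left.1 hs h hg)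
        fun q hq => if_neg fun h => Set.disjoint_left.1 ht h hq
    simp only [e1, e2]
  rw [hint, integral_prod_mul]

theorem integral_gate (g : A.Gate) {f : Matrix.unitaryGroup (Fin 2 × Fin 2) ℂ → ℝ}
    (hf : Continuous f) : ∫ ω, f (ω.1 g) ∂A.law = ∫ U, f U ∂A.gateLaw g := by
  have h1 : MeasurePreserving (fun ω : A.Config => ω.1 g) A.law (A.gateLaw g) :=
    (measurePreserving_eval A.gateLaw g).comp measurePreserving_fst
  rw [← h1.map_eq, integral_map h1.aemeasurable hf.aestronglyMeasurable]

theorem integral_singles (j : Fin L) (f : Fin n → Matrix.unitaryGroup (Fin 2) ℂ → ℝ)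
    (hf : ∀ q, Continuous (f q)) :
    ∫ ω, ∏ q, f q (ω.2 (j, q)) ∂A.law = ∏ q, ∫ U, f q U ∂A.singleLaw (j, q) := by
  have h1 : MeasurePreserving (fun ω : A.Config => ω.2) A.law (Measure.pi A.singleLaw) :=
    measurePreserving_snd
  have h2 : ∫ ω, ∏ q, f q (ω.2 (j, q)) ∂A.law
      = ∫ V, ∏ q, f q (V (j, q)) ∂Measure.pi A.singleLaw := by
    rw [← h1.map_eq, integral_map h1.aemeasurable]
    exact (continuous_finsetProd _ fun q _ =>
      (hf q).comp (continuous_apply (j, q))).aestronglyMeasurable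
  -- Factors equal to 1 in the other layers extend the product to all coordinates, as the product
  -- formula for `Measure.pi` requires.
  have h3 : ∀ {M : Type} [CommMonoid M] (F : Fin L × Fin n → M),
      ∏ p : Fin L × Fin n, (if p.1 = j then F p else 1) = ∏ q, F (j, q) := by
    intro M _ F
    rw [Fintype.prod_prod_type, Finset.prod_eq_single j]
    · simp
    · intro i _ hi
      simp [hi]
    · simp
  rw [h2]
  have h4 := integral_fintype_prod_eq_prod (𝕜 := ℝ) (μ := A.singleLaw)
    (fun p U => if p.1 = j then f p.2 U else 1)
  calc _ = ∫ V : (p : Fin L × Fin n) → Matrix.unitaryGroup (Fin 2) ℂ,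
        ∏ p, (if p.1 = j then f p.2 (V p) else 1) ∂Measure.pi A.singleLaw := by
        congr 1
        ext V
        exact (h3 fun p => f p.2 (V p)).symm
    _ = ∏ p : Fin L × Fin n, ∫ U, (if p.1 = j then f p.2 U else 1) ∂A.singleLaw p := h4
    _ = ∏ p : Fin L × Fin n, (if p.1 = j then ∫ U, f p.2 U ∂A.singleLaw p else 1) := by
        refine Finset.prod_congr rfl fun p _ => ?_
        split_ifs <;> simp
    _ = _ := h3 fun p => ∫ U, f p.2 U ∂A.singleLaw p

end Ansatz
end NoisyCircuit
end

noncomputable section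

namespace NoisyCircuit

/-! ### Second moments of Pauli coefficients -/

/-- The averaged effect of a random one-qubit gate and of the noise on the squares of the Pauli
coefficients. -/
def noiseKernel (N : Op1 →ₗ[ℂ] Op1) (P R : Fin 4) : ℝ := ∑ Q, twirl P Q * transferEntry N Q R ^ 2

theorem continuous_gateStep {X : Type} [TopologicalSpace X] {n : ℕ} {a b : Fin n}
    {u : X → Fin 4 × Fin 4 → Fin 4 × Fin 4 → ℝ} {v : X → PauliString n → ℝ}
    (hu : ∀ s t, Continuous fun x => u x s t) (hv : Continuous v) :
    Continuous fun x => gateStep a b (u x) (v x) :=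
  continuous_pi fun _ => continuous_finsetSum _ fun S _ =>
    (hu S _).mul ((continuous_apply _).comp hv)

theorem continuous_siteStep {X : Type} [TopologicalSpace X] {n : ℕ}
    {t : X → Fin n → Fin 4 → Fin 4 → ℝ} {v : X → PauliString n → ℝ}
    (ht : ∀ q P Q, Continuous fun x => t x q P Q) (hv : Continuous v) :
    Continuous fun x => siteStep (t x) (v x) :=
  continuous_pi fun _ => continuous_finsetSum _ fun _ _ =>
    (continuous_finsetProd _ fun q _ => ht q _ _).mul ((continuous_apply _).comp hv)

namespace Ansatz

variable {n L : ℕ} {A : Ansatz n L}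

theorem continuous_ptm_gateOp (θ : A.Gate → ℝ) (g : A.Gate) (s t : Fin 4 × Fin 4) :
    Continuous fun ω : A.Config => ptm pauli2 (A.gateOp ω θ g) s t :=
  (continuous_ptm_mul pauli2 (A.rotation θ g) s t).comp
    ((continuous_apply g).comp continuous_fst)

theorem continuous_ptm_single (p : Fin L × Fin n) (s t : Fin 4) :
    Continuous fun ω : A.Config => ptm pauli (ω.2 p : Op1) s t :=
  (continuous_ptm pauli s t).comp
    (continuous_subtype_val.comp ((continuous_apply p).comp continuous_snd))

theorem continuous_gatesEvolve (θ : A.Gate → ℝ) (j : Fin L) (l : List (Fin (A.numGates j)))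
    {v : A.Config → PauliString n → ℝ} (hv : Continuous v) :
    Continuous fun ω => A.gatesEvolve ω θ j l (v ω) := by
  induction l with
  | nil => exact hv
  | cons i l ih => exact continuous_gateStep (fun s t => continuous_ptm_gateOp θ _ s t) ih

theorem continuous_noiseEvolve (N : Op1 →ₗ[ℂ] Op1) (j : Fin L)
    {v : A.Config → PauliString n → ℝ} (hv : Continuous v) :
    Continuous fun ω => A.noiseEvolve N ω j (v ω) :=
  continuous_siteStep (fun _ _ _ => continuous_const)
    (continuous_siteStep (fun q P Q => continuous_ptm_single (j, q) P Q) hv)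

theorem continuous_evolve (N : Op1 →ₗ[ℂ] Op1) (θ : A.Gate → ℝ) (l : List (Fin L))
    (v : PauliString n → ℝ) : Continuous fun ω => A.evolve N ω θ l v := by
  induction l with
  | nil => exact continuous_const
  | cons j l ih => exact continuous_gatesEvolve θ j _ (continuous_noiseEvolve N j ih)

/-- The two-qubit gates of the given layers. -/
def gatesOf (A : Ansatz n L) (l : List (Fin L)) : Set A.Gate := {g | g.1 ∈ l}

/-- The one-qubit gates of the given layers. -/
def singlesOf (l : List (Fin L)) : Set (Fin L × Fin n) := {p | p.1 ∈ l}

theorem dependsOn_gatesEvolve (θ : A.Gate → ℝ) (j : Fin L) (l : List (Fin (A.numGates j)))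
    {v : A.Config → PauliString n → ℝ} {s : Set A.Gate} {t : Set (Fin L × Fin n)}
    (hv : A.DependsOnGates v s t) :
    A.DependsOnGates (fun ω => A.gatesEvolve ω θ j l (v ω)) (s ∪ {g | ∃ i ∈ l, g = ⟨j, i⟩}) t := by
  intro ω ω' h1 h2
  induction l with
  | nil => exact hv _ _ (fun g hg => h1 g (Or.inl hg)) h2
  | cons i l ih =>
    have e1 : A.gatesEvolve ω θ j l (v ω) = A.gatesEvolve ω' θ j l (v ω') := ih fun g hg => h1 g (hg.imp id fun ⟨i', hi', h⟩ => ⟨i', List.mem_cons_of_mem _ hi', h⟩)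
    have e2 : A.gateOp ω θ ⟨j, i⟩ = A.gateOp ω' θ ⟨j, i⟩ := by
      rw [gateOp, gateOp, h1 ⟨j, i⟩ (Or.inr ⟨i, List.mem_cons_self, rfl⟩)]
    change gateStep _ _ (ptm pauli2 (A.gateOp ω θ ⟨j, i⟩)) (A.gatesEvolve ω θ j l (v ω))
      = gateStep _ _ (ptm pauli2 (A.gateOp ω' θ ⟨j, i⟩)) (A.gatesEvolve ω' θ j l (v ω'))
    rw [e1, e2]

theorem dependsOn_noiseEvolve (N : Op1 →ₗ[ℂ] Op1) (j : Fin L)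
    {v : A.Config → PauliString n → ℝ} {s : Set A.Gate} {t : Set (Fin L × Fin n)}
    (hv : A.DependsOnGates v s t) :
    A.DependsOnGates (fun ω => A.noiseEvolve N ω j (v ω)) s (t ∪ {p | p.1 = j}) := by
  intro ω ω' h1 h2
  have e1 := hv ω ω' h1 fun p hp => h2 p (Or.inl hp)
  have e2 : ∀ q, ω.2 (j, q) = ω'.2 (j, q) := fun q => h2 (j, q) (Or.inr rfl)
  simp only [noiseEvolve, e1, e2]

theorem dependsOn_evolve (N : Op1 →ₗ[ℂ] Op1) (θ : A.Gate → ℝ) (l : List (Fin L))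
    (v : PauliString n → ℝ) :
    A.DependsOnGates (fun ω => A.evolve N ω θ l v) (A.gatesOf l) (singlesOf l) := by
  induction l with
  | nil =>
    intro ω ω' _ _
    simp only [evolve, List.foldr_nil]
  | cons j l ih =>
    have h := dependsOn_gatesEvolve (A := A) θ j (List.finRange _)
      (v := fun ω => A.noiseEvolve N ω j (A.evolve N ω θ l v))
      (dependsOn_noiseEvolve N j (v := fun ω => A.evolve N ω θ l v) ih)
    refine DependsOnGates.mono (f := fun ω => A.evolve N ω θ (j :: l) v) h ?_ ?_
    · rintro g (hg | ⟨i, -, rfl⟩)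
      · exact List.mem_cons_of_mem _ hg
      · exact List.mem_cons_self
    · rintro p (hp | hp)
      · exact List.mem_cons_of_mem _ hp
      · exact List.mem_cons.2 (Or.inl hp)

theorem DependsOnGates.comp {β γ : Type} {f : A.Config → β} {s : Set A.Gate}
    {t : Set (Fin L × Fin n)} (h : A.DependsOnGates f s t) (F : β → γ) :
    A.DependsOnGates (fun ω => F (f ω)) s t := fun ω ω' h1 h2 => congrArg F (h ω ω' h1 h2)

theorem integral_sum_mul_sum {κ κ' : Type} [Fintype κ] [Fintype κ'] {f : κ → A.Config → ℝ}
    {g : κ' → A.Config → ℝ} (hf : ∀ i, Continuous (f i)) (hg : ∀ i, Continuous (g i)) :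
    ∫ ω, (∑ i, f i ω) * ∑ k, g k ω ∂A.law = ∑ i, ∑ k, ∫ ω, f i ω * g k ω ∂A.law := by
  simp only [Finset.sum_mul_sum]
  refine (integral_finsetSum _ fun i _ => integrable_finsetSum _ fun k _ =>
    A.integrable ((hf i).mul (hg k))).trans ?_
  exact Finset.sum_congr rfl fun i _ =>
    integral_finsetSum _ fun k _ => A.integrable ((hf i).mul (hg k))

/-- By `hg` the gate is independent of `v` and `w`, so its second moments factor out. They
decorrelate different labels on the pair and mix equal ones by `twirl`. -/
theorem integral_gateStep_mul (θ : A.Gate → ℝ) (g : A.Gate) {a b : Fin n}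
    {v w : A.Config → PauliString n → ℝ} (hvc : Continuous v) (hwc : Continuous w)
    {s : Set A.Gate} {t : Set (Fin L × Fin n)} (hv : A.DependsOnGates v s t)
    (hw : A.DependsOnGates w s t) (hg : g ∉ s) (R R' : PauliString n) :
    ∫ ω, gateStep a b (ptm pauli2 (A.gateOp ω θ g)) (v ω) R *
        gateStep a b (ptm pauli2 (A.gateOp ω θ g)) (w ω) R' ∂A.law
      = if (R a, R b) = (R' a, R' b) then
          ∑ S, twirl S (R a, R b) * ∫ ω, v ω (setPair R a b S) * w ω (setPair R' a b S) ∂A.law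
        else 0 := by
  have hvR : ∀ Q, Continuous fun ω => v ω Q := fun Q => (continuous_apply Q).comp hvc
  have hwR : ∀ Q, Continuous fun ω => w ω Q := fun Q => (continuous_apply Q).comp hwc
  have hu := fun s t => continuous_ptm_gateOp (A := A) θ g s t
  have hterm : ∀ S S' : Fin 4 × Fin 4,
      ∫ ω, (ptm pauli2 (A.gateOp ω θ g) S (R a, R b) * v ω (setPair R a b S)) *
        (ptm pauli2 (A.gateOp ω θ g) S' (R' a, R' b) * w ω (setPair R' a b S')) ∂A.law
      = (if S = S' ∧ (R a, R b) = (R' a, R' b) then twirl S (R a, R b) else 0) *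
        ∫ ω, v ω (setPair R a b S) * w ω (setPair R' a b S') ∂A.law := by
    intro S S'
    have h1 := integral_mul_of_disjoint (A := A)
      (f := fun ω => ptm pauli2 (A.gateOp ω θ g) S (R a, R b) *
        ptm pauli2 (A.gateOp ω θ g) S' (R' a, R' b))
      (F := fun ω => v ω (setPair R a b S) * w ω (setPair R' a b S'))
      (s := {g}) (t := ∅) (s' := s) (t' := t)
      ((hu _ _).mul (hu _ _)) ((hvR _).mul (hwR _))
      (fun ω ω' h _ => by simp only [gateOp, h g rfl])
      (fun ω ω' h h' => by simp only [hv ω ω' h h', hw ω ω' h h'])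
      (Set.disjoint_singleton_left.2 hg) (Set.empty_disjoint _)
    have h2 := integral_gate (A := A) g
      (f := fun U => ptm pauli2 ((U : Op2) * A.rotation θ g) S (R a, R b) *
        ptm pauli2 ((U : Op2) * A.rotation θ g) S' (R' a, R' b))
      ((continuous_ptm_mul _ _ _ _).mul (continuous_ptm_mul _ _ _ _))
    rw [pauli2_isPauliBasis.integral_ptm_mul_ptm (A.gateLaw_design g) (A.rotation_mem θ g)] at h2
    rw [← h2]
    refine Eq.trans ?_ h1
    congr 1
    ext ω
    ring
  refine (integral_sum_mul_sum (fun S => (hu S (R a, R b)).mul (hvR (setPair R a b S)))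
    fun S => (hu S (R' a, R' b)).mul (hwR (setPair R' a b S))).trans ?_
  have : ∀ S, ∑ S', ∫ ω, (ptm pauli2 (A.gateOp ω θ g) S (R a, R b) * v ω (setPair R a b S)) *
        (ptm pauli2 (A.gateOp ω θ g) S' (R' a, R' b) * w ω (setPair R' a b S')) ∂A.law
      = if (R a, R b) = (R' a, R' b) then
          twirl S (R a, R b) * ∫ ω, v ω (setPair R a b S) * w ω (setPair R' a b S) ∂A.law
        else 0 := by
    intro S
    simp only [hterm]
    rw [Finset.sum_eq_single S]
    · simp only [true_and, ite_mul, zero_mul]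
    · intro S' _ hS'
      rw [if_neg fun h => hS' h.1.symm, zero_mul]
    · simp
  refine (Finset.sum_congr rfl fun S _ => this S).trans ?_
  split_ifs <;> simp

theorem integral_gateStep_sq (θ : A.Gate → ℝ) (g : A.Gate) {a b : Fin n}
    {v : A.Config → PauliString n → ℝ} (hvc : Continuous v)
    {s : Set A.Gate} {t : Set (Fin L × Fin n)} (hv : A.DependsOnGates v s t) (hg : g ∉ s)
    (R : PauliString n) :
    ∫ ω, gateStep a b (ptm pauli2 (A.gateOp ω θ g)) (v ω) R ^ 2 ∂A.law
      = ∑ S, twirl S (R a, R b) * ∫ ω, v ω (setPair R a b S) ^ 2 ∂A.law := by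
  have := integral_gateStep_mul θ g (a := a) (b := b) hvc hvc hv hv hg R R
  simpa only [if_true, ← pow_two] using this

/-- After gates of a layer, coefficients whose labels differ on a qubit touched by one of these
gates are uncorrelated. -/
theorem integral_gatesEvolve_mul_eq_zero (θ : A.Gate → ℝ) (j : Fin L)
    {v w : A.Config → PauliString n → ℝ} (hvc : Continuous v) (hwc : Continuous w)
    {s : Set A.Gate} {t : Set (Fin L × Fin n)} (hv : A.DependsOnGates v s t)
    (hw : A.DependsOnGates w s t) (l : List (Fin (A.numGates j))) (hl : l.Nodup)
    (hs : ∀ i, (⟨j, i⟩ : A.Gate) ∉ s) {R R' : PauliString n} {q : Fin n} (hq : R q ≠ R' q)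
    (hlq : ∃ i ∈ l, A.left j i = q ∨ A.right j i = q) :
    ∫ ω, A.gatesEvolve ω θ j l (v ω) R * A.gatesEvolve ω θ j l (w ω) R' ∂A.law = 0 := by
  induction l generalizing R R' with
  | nil => simp at hlq
  | cons i l ih =>
    have hgi : (⟨j, i⟩ : A.Gate) ∉ s ∪ {g | ∃ i' ∈ l, g = ⟨j, i'⟩} := by
      rintro (h | ⟨i', hi', h⟩)
      · exact hs i h
      · obtain rfl : i = i' := by simpa using h
        exact (List.nodup_cons.1 hl).1 hi'
    refine (integral_gateStep_mul θ ⟨j, i⟩ (a := A.left j i) (b := A.right j i)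
      (continuous_gatesEvolve θ j l hvc) (continuous_gatesEvolve θ j l hwc)
      (dependsOn_gatesEvolve θ j l hv) (dependsOn_gatesEvolve θ j l hw) hgi R R').trans ?_
    split_ifs with h
    -- Equal labels on the pair place `q` outside it, so `q` is touched by one of the remaining
    -- gates and every term vanishes by induction.
    · rw [Prod.mk.injEq] at h
      have ha : q ≠ A.left j i := fun hqa => hq (by rw [hqa]; exact h.1)
      have hb : q ≠ A.right j i := fun hqb => hq (by rw [hqb]; exact h.2)
      refine Finset.sum_eq_zero fun S _ => ?_
      rw [ih (List.nodup_cons.1 hl).2, mul_zero]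
      · rwa [setPair_of_ne ha hb, setPair_of_ne ha hb]
      · obtain ⟨i', hi', hi''⟩ := hlq
        rcases List.mem_cons.1 hi' with rfl | h'
        · rcases hi'' with h2 | h2
          · exact absurd h2.symm ha
          · exact absurd h2.symm hb
        · exact ⟨i', h', hi''⟩
    · rfl

/-- The one-qubit gates of a layer are averaged together: the moment factors over the qubits, and a
mismatch on a single qubit annihilates it. -/
theorem integral_single_mul (j : Fin L) {v : A.Config → PauliString n → ℝ} (hvc : Continuous v)
    {s : Set A.Gate} {t : Set (Fin L × Fin n)} (hv : A.DependsOnGates v s t)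
    (ht : ∀ q, (j, q) ∉ t) (R R' : PauliString n) :
    ∫ ω, siteStep (fun q => ptm pauli (ω.2 (j, q) : Op1)) (v ω) R *
        siteStep (fun q => ptm pauli (ω.2 (j, q) : Op1)) (v ω) R' ∂A.law
      = if R = R' then ∑ Q : PauliString n, (∏ q, twirl (Q q) (R q)) * ∫ ω, v ω Q ^ 2 ∂A.law else 0 := by
  have hvR : ∀ Q, Continuous fun ω => v ω Q := fun Q => (continuous_apply Q).comp hvc
  have hu : ∀ Q R : PauliString n, Continuous fun ω : A.Config =>
      ∏ q, ptm pauli (ω.2 (j, q) : Op1) (Q q) (R q) :=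
    fun Q R => continuous_finsetProd _ fun q _ => continuous_ptm_single (j, q) _ _
  have hterm : ∀ Q Q' : PauliString n,
      ∫ ω, ((∏ q, ptm pauli (ω.2 (j, q) : Op1) (Q q) (R q)) * v ω Q) *
        ((∏ q, ptm pauli (ω.2 (j, q) : Op1) (Q' q) (R' q)) * v ω Q') ∂A.law
      = (if Q = Q' ∧ R = R' then ∏ q, twirl (Q q) (R q) else 0) *
        ∫ ω, v ω Q * v ω Q' ∂A.law := by
    intro Q Q'
    have h1 := integral_mul_of_disjoint (A := A)
      (f := fun ω => ∏ q, (ptm pauli (ω.2 (j, q) : Op1) (Q q) (R q) *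
        ptm pauli (ω.2 (j, q) : Op1) (Q' q) (R' q)))
      (F := fun ω => v ω Q * v ω Q')
      (s := ∅) (t := {p | p.1 = j}) (s' := s) (t' := t)
      (continuous_finsetProd _ fun q _ =>
        (continuous_ptm_single (j, q) _ _).mul (continuous_ptm_single (j, q) _ _))
      ((hvR _).mul (hvR _))
      (fun ω ω' _ h => Finset.prod_congr rfl fun q _ => by rw [h (j, q) rfl])
      (fun ω ω' h h' => by simp only [hv ω ω' h h'])
      (Set.empty_disjoint _) (Set.disjoint_left.2 fun p hp hp' => ht p.2 (by
        have : p.1 = j := hp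
        rw [← this]; exact hp'))
    have h2 := integral_singles (A := A) j
      (fun q U => ptm pauli (U : Op1) (Q q) (R q) * ptm pauli (U : Op1) (Q' q) (R' q))
      (fun q => ((continuous_ptm pauli _ _).comp continuous_subtype_val).mul
        ((continuous_ptm pauli _ _).comp continuous_subtype_val))
    have h3 : ∀ q, ∫ U : Matrix.unitaryGroup (Fin 2) ℂ, ptm pauli (U : Op1) (Q q) (R q) *
        ptm pauli (U : Op1) (Q' q) (R' q) ∂A.singleLaw (j, q)
        = if Q q = Q' q ∧ R q = R' q then twirl (Q q) (R q) else 0 := by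
      intro q
      have := pauli_isPauliBasis.integral_ptm_mul_ptm (A.singleLaw_design (j, q))
        (one_mem (Matrix.unitaryGroup (Fin 2) ℂ)) (Q q) (R q) (Q' q) (R' q)
      simpa only [mul_one] using this
    simp only [h3] at h2
    rw [Finset.prod_ite_zero] at h2
    have h4 : (∀ q ∈ Finset.univ, Q q = Q' q ∧ R q = R' q) ↔ Q = Q' ∧ R = R' := by
      simp only [Finset.mem_univ, true_imp_iff, forall_and, funext_iff]
    simp only [h4] at h2
    rw [← h2]
    refine Eq.trans ?_ h1
    congr 1
    ext ω
    rw [Finset.prod_mul_distrib]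
    ring
  refine (integral_sum_mul_sum (fun Q => (hu Q R).mul (hvR Q))
    fun Q => (hu Q R').mul (hvR Q)).trans ?_
  have : ∀ Q : PauliString n, ∑ Q' : PauliString n, ∫ ω,
      ((∏ q, ptm pauli (ω.2 (j, q) : Op1) (Q q) (R q)) * v ω Q) *
        ((∏ q, ptm pauli (ω.2 (j, q) : Op1) (Q' q) (R' q)) * v ω Q') ∂A.law
      = if R = R' then (∏ q, twirl (Q q) (R q)) * ∫ ω, v ω Q ^ 2 ∂A.law else 0 := by
    intro Q
    simp only [hterm]
    rw [Finset.sum_eq_single Q]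
    · simp only [true_and, ite_mul, zero_mul, ← pow_two]
    · intro S' _ hS'
      rw [if_neg fun h => hS' h.1.symm, zero_mul]
    · simp
  refine (Finset.sum_congr rfl fun S _ => this S).trans ?_
  split_ifs <;> simp

/-- In Heisenberg order the one-qubit gates act before the noise and remove all cross terms, so only
squares of the transfer entries of the noise survive. -/
theorem integral_noiseEvolve_sq (N : Op1 →ₗ[ℂ] Op1) (j : Fin L)
    {v : A.Config → PauliString n → ℝ} (hvc : Continuous v)
    {s : Set A.Gate} {t : Set (Fin L × Fin n)} (hv : A.DependsOnGates v s t)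
    (ht : ∀ q, (j, q) ∉ t) (R : PauliString n) :
    ∫ ω, A.noiseEvolve N ω j (v ω) R ^ 2 ∂A.law
      = ∑ Q : PauliString n, (∏ q, noiseKernel N (Q q) (R q)) * ∫ ω, v ω Q ^ 2 ∂A.law := by
  have hc : Continuous fun ω : A.Config => siteStep (fun q => ptm pauli (ω.2 (j, q) : Op1)) (v ω) :=
    continuous_siteStep (fun q P Q => continuous_ptm_single (j, q) P Q) hvc
  have hcR := fun Q : PauliString n => (continuous_apply Q).comp hc
  have hcT := fun Q : PauliString n =>
    (continuous_const (y := ∏ q, transferEntry N (Q q) (R q))).mul (hcR Q)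
  simp only [pow_two]
  refine (integral_sum_mul_sum hcT hcT).trans ?_
  have : ∀ Q : PauliString n, ∑ Q' : PauliString n, ∫ ω,
      ((∏ q, transferEntry N (Q q) (R q)) * siteStep (fun q => ptm pauli (ω.2 (j, q) : Op1)) (v ω) Q) *
      ((∏ q, transferEntry N (Q' q) (R q)) * siteStep (fun q => ptm pauli (ω.2 (j, q) : Op1)) (v ω) Q') ∂A.law
      = ∑ P : PauliString n, (∏ q, (twirl (P q) (Q q) * transferEntry N (Q q) (R q) ^ 2)) *
        ∫ ω, v ω P ^ 2 ∂A.law := by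
    intro Q
    simp only [mul_mul_mul_comm _ (siteStep _ _ _), integral_const_mul,
      integral_single_mul j hvc hv ht]
    rw [Finset.sum_eq_single Q]
    · rw [if_pos rfl, Finset.mul_sum]
      refine Finset.sum_congr rfl fun P _ => ?_
      rw [Finset.prod_mul_distrib, Finset.prod_pow]
      ring
    · intro Q' _ hQ'
      rw [if_neg (Ne.symm hQ'), mul_zero]
    · simp
  refine (Finset.sum_congr rfl fun Q _ => this Q).trans ?_
  rw [Finset.sum_comm]
  refine Finset.sum_congr rfl fun P _ => ?_
  rw [← Finset.sum_mul]
  simp only [noiseKernel]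
  rw [Finset.prod_univ_sum, Fintype.piFinset_univ]
  simp only [pow_two]

end Ansatz
end NoisyCircuit
end

noncomputable section

namespace NoisyCircuit

/-! ### The contraction coefficient -/

theorem twirl_zero_left {ι : Type} [Fintype ι] [DecidableEq ι] [Zero ι] (j : ι) :
    twirl 0 j = if j = 0 then (1 : ℝ) else 0 := by simp [twirl]

theorem twirl_zero_right {ι : Type} [Fintype ι] [DecidableEq ι] [Zero ι] (i : ι) :
    twirl i 0 = if i = 0 then (1 : ℝ) else 0 := by simp [twirl]

theorem twirl_nonneg {ι : Type} [Fintype ι] [DecidableEq ι] [Zero ι] (i j : ι) :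
    0 ≤ twirl i j := by
  have : (1 : ℝ) ≤ Fintype.card ι := by
    exact_mod_cast Fintype.card_pos_iff.2 ⟨0⟩
  unfold twirl
  have := div_nonneg zero_le_one (sub_nonneg.2 this)
  split_ifs <;> first | exact this | norm_num

section Channel

variable {N : Op1 →ₗ[ℂ] Op1}

theorem noiseKernel_nonneg (P R : Fin 4) : 0 ≤ noiseKernel N P R :=
  Finset.sum_nonneg fun _ _ => mul_nonneg (twirl_nonneg _ _) (sq_nonneg _)

theorem IsQuantumChannel.noiseKernel_zero (hN : IsQuantumChannel N) (R : Fin 4) :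
    noiseKernel N 0 R = if R = 0 then 1 else 0 := by
  simp only [noiseKernel, twirl_zero_left, ite_mul, one_mul, zero_mul, Finset.sum_ite_eq',
    Finset.mem_univ, if_true, hN.transferEntry_zero]
  split_ifs <;> simp

theorem noiseKernel_of_ne_zero {P : Fin 4} (hP : P ≠ 0) (R : Fin 4) :
    noiseKernel N P R = (∑ Q : Fin 3, transferEntry N Q.succ R ^ 2) / 3 := by
  rw [noiseKernel, Fin.sum_univ_succ, twirl_zero_right, if_neg hP, zero_mul, zero_add,
    Finset.sum_div]
  refine Finset.sum_congr rfl fun Q _ => ?_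
  rw [twirl, if_neg hP, if_neg (Fin.succ_ne_zero Q), Fintype.card_fin]
  norm_num
  ring

/-- The twirl makes a nontrivial label uniform over the three nontrivial ones, so the outgoing mass
is the average squared length of the corresponding rows. This explains the third in `contraction`.
-/
theorem sum_noiseKernel {P : Fin 4} (hP : P ≠ 0) : ∑ R, noiseKernel N P R = contraction N := by
  simp only [noiseKernel_of_ne_zero hP, contraction]
  rw [← Finset.sum_div, Finset.sum_comm]

theorem contraction_nonneg : 0 ≤ contraction N := by
  rw [← sum_noiseKernel (P := 1) (by decide)]
  exact Finset.sum_nonneg fun R _ => noiseKernel_nonneg _ _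

theorem IsQuantumChannel.map_pauli (hN : IsQuantumChannel N) (P : Fin 4) :
    N (pauli P) = ∑ Q, (transferEntry N Q P : ℂ) • pauli Q := by
  conv_lhs => rw [pauli_isPauliBasis.expand (N (pauli P))]
  simp only [hN.ofReal_transferEntry, Fintype.card_fin, Nat.cast_ofNat]

/-- The noise can create Pauli operators from the identity, on average. -/
theorem IsQuantumChannel.noiseKernel_one_zero_pos (hN : IsQuantumChannel N) (h : ¬ IsUnital N) :
    0 < noiseKernel N 1 0 := by
  refine lt_of_le_of_ne (noiseKernel_nonneg _ _) fun h0 => h ?_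
  rw [noiseKernel_of_ne_zero (by decide), eq_comm, div_eq_zero_iff] at h0
  have h1 := (Finset.sum_eq_zero_iff_of_nonneg fun _ _ => sq_nonneg _).1
    (h0.resolve_right (by norm_num))
  have h2 := hN.map_pauli 0
  rw [Fin.sum_univ_succ, hN.transferEntry_zero, pauli_isPauliBasis.zero] at h2
  rw [IsUnital, h2]
  simp only [fun Q => pow_eq_zero_iff (two_ne_zero) |>.1 (h1 Q (Finset.mem_univ _))]
  simp

/-- If all these entries vanished, the noise would annihilate `X`, `Y` and `Z`, and its output would
depend on the trace of the input only. -/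
theorem IsQuantumChannel.exists_noiseKernel_pos (hN : IsQuantumChannel N) (h : ¬ IsReplacer N) :
    ∃ s : Fin 4, s ≠ 0 ∧ 0 < noiseKernel N 1 s := by
  by_contra! hc
  refine h ⟨(1 / 2 : ℂ) • N 1, fun ρ hρ => ?_⟩
  have h1 : ∀ s : Fin 3, N (pauli s.succ) = 0 := by
    intro s
    have h2 := le_antisymm (hc s.succ (Fin.succ_ne_zero s)) (noiseKernel_nonneg _ _)
    rw [noiseKernel_of_ne_zero (by decide), div_eq_zero_iff] at h2
    have h3 := (Finset.sum_eq_zero_iff_of_nonneg fun _ _ => sq_nonneg _).1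
      (h2.resolve_right (by norm_num))
    rw [hN.map_pauli, Fin.sum_univ_succ, hN.transferEntry_zero, if_neg (Fin.succ_ne_zero s)]
    simp only [fun Q => pow_eq_zero_iff (two_ne_zero) |>.1 (h3 Q (Finset.mem_univ _))]
    simp
  conv_lhs => rw [pauli_isPauliBasis.expand ρ]
  rw [map_sum, Fin.sum_univ_succ]
  simp only [map_smul, h1, smul_zero, Finset.sum_const_zero, add_zero]
  rw [pauli_isPauliBasis.zero, one_mul, hρ.2]
  norm_num

theorem IsPauliBasis.trace_mul_sum {m ι : Type} [Fintype m] [DecidableEq m] [Fintype ι]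
    [DecidableEq ι] [Zero ι] {B : ι → Matrix m m ℂ} {anti : ι → ι → Bool}
    (hB : IsPauliBasis B anti) (a b : ι → ℝ) :
    ((∑ i, (a i : ℂ) • B i) * ∑ i, (b i : ℂ) • B i).trace
      = (((Fintype.card m : ℝ) * ∑ i, a i * b i : ℝ) : ℂ) := by
  simp only [Finset.sum_mul, Finset.mul_sum, Matrix.trace_sum, Matrix.smul_mul, Matrix.mul_smul,
    Matrix.trace_smul, hB.trace_mul, smul_eq_mul]
  push_cast
  refine Finset.sum_congr rfl fun i _ => ?_
  simp only [mul_ite, mul_zero, Finset.sum_ite_eq', Finset.mem_univ, if_true]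
  ring

theorem IsPauliBasis.sum_ptm_mul {m ι : Type} [Fintype m] [DecidableEq m] [Nonempty m] [Fintype ι]
    [DecidableEq ι] [Zero ι] {B : ι → Matrix m m ℂ} {anti : ι → ι → Bool}
    (hB : IsPauliBasis B anti) {U : Matrix m m ℂ}
    (hU : U ∈ Matrix.unitaryGroup m ℂ) (j k : ι) :
    ∑ i, ptm B U i j * ptm B U i k = if j = k then 1 else 0 := by
  have hU' : U.conjTranspose * U = 1 := Matrix.mem_unitaryGroup_iff'.1 hU
  have hd : (Fintype.card m : ℝ) ≠ 0 := by simp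
  have h : ∀ j, ∑ i, (ptm B U i j : ℂ) • B i = U * B j * U.conjTranspose := fun j =>
    (hB.expand_re (A := U * B j * U.conjTranspose)
      (by simp [Matrix.conjTranspose_mul, hB.herm, Matrix.mul_assoc])).symm
  have h1 := hB.trace_mul_sum (fun i => ptm B U i j) (fun i => ptm B U i k)
  have h3 : ((U * B j * U.conjTranspose) * (U * B k * U.conjTranspose)).trace = (B j * B k).trace := by
    rw [Matrix.trace_mul_comm, Matrix.trace_mul_comm (B j)]
    calc _ = (U * (B k * (U.conjTranspose * U) * B j) * U.conjTranspose).trace := by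
          simp only [Matrix.mul_assoc]
      _ = _ := by
          rw [hU', Matrix.mul_one, Matrix.trace_mul_comm, ← Matrix.mul_assoc, hU', Matrix.one_mul]
  rw [h, h, h3, hB.trace_mul] at h1
  have h4 : (if j = k then (Fintype.card m : ℝ) else 0)
      = (Fintype.card m : ℝ) * ∑ i, ptm B U i j * ptm B U i k := by
    split_ifs at h1 ⊢ <;> exact_mod_cast h1
  rw [← mul_right_inj' hd, ← h4]
  simp

/-- Parseval turns squared transfer entries into Hilbert-Schmidt norms of outputs, the row of the
identity contributing the 1. This form serves both for the normal form and for `contraction_lt_one`.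
-/
theorem IsQuantumChannel.sum_trace_sq (hN : IsQuantumChannel N) :
    ∑ P, (N (pauli P) * N (pauli P)).trace = ((2 * (1 + 3 * contraction N) : ℝ) : ℂ) := by
  have h : ∀ P, (N (pauli P) * N (pauli P)).trace
      = ((2 * ∑ Q, transferEntry N Q P ^ 2 : ℝ) : ℂ) := by
    intro P
    have := pauli_isPauliBasis.trace_mul_sum (fun Q => transferEntry N Q P)
      (fun Q => transferEntry N Q P)
    rw [hN.map_pauli, this]
    simp only [pow_two, Fintype.card_fin, Nat.cast_ofNat]
  simp only [h]
  rw [← Complex.ofReal_sum, ← Finset.mul_sum, Finset.sum_comm, Fin.sum_univ_succ]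
  simp only [hN.transferEntry_zero, contraction]
  congr 3
  · simp
  · ring

/-- In `sum_trace_sq` the outer unitary preserves the norm of each output, and the inner one acts on
the input basis by an orthogonal matrix (`sum_ptm_mul`), which preserves the sum of squared norms.
-/
theorem IsQuantumChannel.contraction_normalForm (hN : IsQuantumChannel N) {t D : Fin 3 → ℝ}
    (h : IsNormalForm N t D) : contraction N = normalFormContraction t D := by
  obtain ⟨U, hU, V, hV, h⟩ := h
  have hU' : U.conjTranspose * U = 1 := Matrix.mem_unitaryGroup_iff'.1 hU
  have hadd : ∀ A B, normalFormMap t D (A + B) = normalFormMap t D A + normalFormMap t D B := by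
    intro A B
    simp only [normalFormMap, Matrix.trace_add, mul_add, add_div, add_smul,
      Finset.sum_add_distrib]
    abel
  have hsmul : ∀ (c : ℂ) A, normalFormMap t D (c • A) = c • normalFormMap t D A := by
    intro c A
    simp only [normalFormMap, Matrix.trace_smul, Matrix.mul_smul, smul_eq_mul, smul_add,
      Finset.smul_sum, smul_smul]
    congr 1
    · simp only [mul_div_assoc, mul_assoc]
    · refine Finset.sum_congr rfl fun i _ => ?_
      congr 1
      ring
  let F : Op1 →ₗ[ℂ] Op1 := ⟨⟨normalFormMap t D, hadd⟩, hsmul⟩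
  have hF : ∀ A, F A = normalFormMap t D A := fun A => rfl
  have h1 : ∀ P, (N (pauli P) * N (pauli P)).trace
      = ∑ Q, ∑ R, ((ptm pauli V P Q * ptm pauli V P R : ℝ) : ℂ) * (F (pauli Q) * F (pauli R)).trace := by
    intro P
    rw [h, Matrix.trace_mul_comm, pauli_isPauliBasis.conj_expand, ← hF]
    have : ∀ X : Op1, (U * X * U.conjTranspose * (U * X * U.conjTranspose)).trace = (X * X).trace := by
      intro X
      calc _ = (U * (X * (U.conjTranspose * U) * X) * U.conjTranspose).trace := by
            simp only [Matrix.mul_assoc]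
        _ = _ := by
            rw [hU', Matrix.mul_one, Matrix.trace_mul_comm, ← Matrix.mul_assoc, hU', Matrix.one_mul]
    rw [this]
    simp only [map_sum, map_smul, Matrix.sum_mul, Matrix.trace_sum,
      Matrix.smul_mul, Matrix.mul_smul, Matrix.trace_smul, smul_eq_mul,
      Finset.mul_sum]
    rw [Finset.sum_comm]
    refine Finset.sum_congr rfl fun Q _ => Finset.sum_congr rfl fun R _ => ?_
    push_cast
    ring
  have h2 : ∑ P, (N (pauli P) * N (pauli P)).trace = ∑ Q, (F (pauli Q) * F (pauli Q)).trace := by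
    simp only [h1]
    rw [Finset.sum_comm]
    refine Finset.sum_congr rfl fun Q _ => ?_
    rw [Finset.sum_comm]
    simp only [← Finset.sum_mul, ← Complex.ofReal_sum, pauli_isPauliBasis.sum_ptm_mul hV]
    rw [Finset.sum_eq_single Q]
    · simp
    · intro R _ hR
      simp [Ne.symm hR]
    · simp
  have htr : ∀ P : Fin 4, (pauli P).trace = if P = 0 then 2 else 0 := by
    intro P
    have := pauli_isPauliBasis.trace_mul P 0
    rw [pauli_isPauliBasis.zero, mul_one] at this
    simpa using this
  have h3 : F (pauli 0) = ∑ Q, ((Fin.cons 1 t : Fin 4 → ℝ) Q : ℂ) • pauli Q := by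
    rw [hF, normalFormMap]
    conv_rhs => rw [Fin.sum_univ_succ]
    simp only [htr, pauli_isPauliBasis.trace_mul]
    simp only [Fin.succ_ne_zero, if_false, if_true, mul_zero,
      zero_div, zero_smul, Finset.sum_const_zero, add_zero, Fin.cons_zero, Fin.cons_succ,
      pauli_isPauliBasis.zero, div_self (two_ne_zero' ℂ), one_smul, Complex.ofReal_one]
  have h4 : ∀ i : Fin 3, F (pauli i.succ) = (D i : ℂ) • pauli i.succ := by
    intro i
    rw [hF, normalFormMap]
    simp only [htr, pauli_isPauliBasis.trace_mul, Fin.succ_ne_zero, if_false, Fin.succ_inj,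
      zero_div, zero_smul, zero_add]
    rw [Finset.sum_eq_single i]
    · simp
    · intro k _ hk
      simp [hk]
    · simp
  have h5 := pauli_isPauliBasis.trace_mul_sum (Fin.cons 1 t : Fin 4 → ℝ) (Fin.cons 1 t : Fin 4 → ℝ)
  rw [hN.sum_trace_sq, Fin.sum_univ_succ, h3, h5] at h2
  simp only [h4, Matrix.smul_mul, Matrix.mul_smul, Matrix.trace_smul, pauli_isPauliBasis.trace_mul,
    if_true, smul_eq_mul, Fintype.card_fin, Fin.sum_univ_succ (n := 3), Fin.cons_zero,
    Fin.cons_succ] at h2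
  have h6 : 2 * (1 + 3 * contraction N) = 2 * (1 * 1 + ∑ i, t i * t i) + ∑ i, D i * (D i * 2) := by
    exact_mod_cast h2
  rw [normalFormContraction]
  simp only [pow_two]
  simp only [← mul_assoc, ← Finset.sum_mul] at h6
  linarith

/-- The matrix entries as a vector, so that the scalar product is the Hilbert-Schmidt one. -/
def hsVec (X : Op1) : EuclideanSpace ℂ (Fin 2 × Fin 2) := WithLp.toLp 2 fun p => X p.1 p.2

theorem inner_hsVec (X Y : Op1) : inner ℂ (hsVec X) (hsVec Y) = (X.conjTranspose * Y).trace := by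
  simp only [hsVec, PiLp.inner_apply, RCLike.inner_apply, Fintype.sum_prod_type, Matrix.trace,
    Matrix.diag_apply, Matrix.mul_apply, Matrix.conjTranspose_apply]
  rw [Finset.sum_comm]
  refine Finset.sum_congr rfl fun i _ => Finset.sum_congr rfl fun j _ => ?_
  rw [mul_comm]
  rfl

theorem sum_pauli_mul_mul_pauli (X : Op1) : ∑ P, pauli P * X * pauli P = (2 * X.trace) • (1 : Op1) := by
  rw [Matrix.eta_fin_two X]
  ext i j
  fin_cases i <;> fin_cases j <;>
    simp [pauli, Fin.sum_univ_four, Matrix.trace_fin_two] <;>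
    simp only [mul_right_comm Complex.I, Complex.I_mul_I] <;> ring

/-- Summing over Pauli inputs depolarises `K_j† K_i` and leaves the squared modulus of its trace.
The outcome is a Gram sum, ready for Cauchy-Schwarz. -/
theorem one_add_contraction {r : ℕ} {K : Fin r → Op1} (hK : ∑ i, (K i).conjTranspose * K i = 1)
    (h : ∀ A, N A = ∑ i, K i * A * (K i).conjTranspose) :
    1 + 3 * contraction N = ∑ i, ∑ j, ‖inner ℂ (hsVec (K i)) (hsVec (K j))‖ ^ 2 := by
  have h1 := IsQuantumChannel.sum_trace_sq ⟨r, K, hK, h⟩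
  have h2 : ∑ P, (N (pauli P) * N (pauli P)).trace
      = ∑ i, ∑ j, ((2 * ‖inner ℂ (hsVec (K i)) (hsVec (K j))‖ ^ 2 : ℝ) : ℂ) := by
    simp only [h, Matrix.sum_mul, Matrix.mul_sum, Matrix.trace_sum]
    rw [Finset.sum_comm]
    refine Finset.sum_congr rfl fun i _ => ?_
    rw [Finset.sum_comm]
    refine Finset.sum_congr rfl fun j _ => ?_
    have h4 : ∀ P, (K j * pauli P * (K j).conjTranspose * (K i * pauli P * (K i).conjTranspose)).trace
        = (pauli P * ((K j).conjTranspose * K i) * pauli P * ((K i).conjTranspose * K j)).trace := by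
      intro P
      rw [Matrix.mul_assoc (K j), Matrix.mul_assoc (K j), Matrix.trace_mul_comm]
      simp only [Matrix.mul_assoc]
    have h5 : ((K j).conjTranspose * K i).trace = star ((K i).conjTranspose * K j).trace := by
      rw [← Matrix.trace_conjTranspose, Matrix.conjTranspose_mul, Matrix.conjTranspose_conjTranspose]
    simp only [h4]
    rw [← Matrix.trace_sum, ← Matrix.sum_mul, sum_pauli_mul_mul_pauli, Matrix.smul_mul,
      Matrix.one_mul, Matrix.trace_smul, smul_eq_mul, h5, inner_hsVec, mul_assoc, Complex.star_def,
      Complex.conj_mul']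
    push_cast
    rfl
  rw [h1] at h2
  have h3 : 2 * (1 + 3 * contraction N)
      = ∑ i, ∑ j, 2 * ‖inner ℂ (hsVec (K i)) (hsVec (K j))‖ ^ 2 := by exact_mod_cast h2
  simp only [← Finset.mul_sum] at h3
  linarith

theorem sum_norm_hsVec {r : ℕ} {K : Fin r → Op1} (hK : ∑ i, (K i).conjTranspose * K i = 1) :
    ∑ i, ‖hsVec (K i)‖ ^ 2 = 2 := by
  have h : ∀ i, ((‖hsVec (K i)‖ ^ 2 : ℝ) : ℂ) = ((K i).conjTranspose * K i).trace := by
    intro i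
    rw [← inner_hsVec, inner_self_eq_norm_sq_to_K]
    push_cast
    rfl
  have h2 : ((∑ i, ‖hsVec (K i)‖ ^ 2 : ℝ) : ℂ) = 2 := by
    rw [Complex.ofReal_sum]
    simp only [h]
    rw [← Matrix.trace_sum, hK, Matrix.trace_one]
    simp
  exact_mod_cast h2

/-- Cauchy-Schwarz bounds the Gram sum by `(∑ ‖K_i‖²)² = 4`, so `c ≤ 1`. Equality forces all Kraus
operators to be proportional, and then the channel is unitary. -/
theorem IsQuantumChannel.contraction_lt_one (hN : IsQuantumChannel N) (hU : ¬ IsUnitaryChannel N) :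
    contraction N < 1 := by
  obtain ⟨r, K, hK, h⟩ := hN
  have h1 := one_add_contraction hK h
  have h2 := sum_norm_hsVec hK
  have h3 : ∑ i, ∑ j, (‖hsVec (K i)‖ * ‖hsVec (K j)‖) ^ 2 = 4 := by
    simp only [mul_pow]
    rw [← Finset.sum_mul_sum, h2]
    norm_num
  have hcs : ∀ i j, ‖inner ℂ (hsVec (K i)) (hsVec (K j))‖ ^ 2 ≤ (‖hsVec (K i)‖ * ‖hsVec (K j)‖) ^ 2 :=
    fun i j => pow_le_pow_left₀ (norm_nonneg _) (norm_inner_le_norm _ _) 2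
  by_contra! hc
  have heq : ∀ i j, ‖inner ℂ (hsVec (K i)) (hsVec (K j))‖ ^ 2 = (‖hsVec (K i)‖ * ‖hsVec (K j)‖) ^ 2 := by
    have hle : ∀ i ∈ Finset.univ, ∑ j, ‖inner ℂ (hsVec (K i)) (hsVec (K j))‖ ^ 2
        ≤ ∑ j, (‖hsVec (K i)‖ * ‖hsVec (K j)‖) ^ 2 := fun i _ => Finset.sum_le_sum fun j _ => hcs i j
    have htot := (Finset.sum_eq_sum_iff_of_le hle).1
      (le_antisymm (Finset.sum_le_sum hle) (by linarith))
    intro i j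
    exact (Finset.sum_eq_sum_iff_of_le fun j _ => hcs i j).1 (htot i (Finset.mem_univ _)) j
      (Finset.mem_univ _)
  obtain ⟨i, hi⟩ : ∃ i, hsVec (K i) ≠ 0 := by
    by_contra! h0
    simp [h0] at h2
  have hpar : ∀ j, ∃ c : ℂ, K j = c • K i := by
    intro j
    have hvec : ∃ c : ℂ, hsVec (K j) = c • hsVec (K i) := by
      by_cases hj : hsVec (K j) = 0
      · exact ⟨0, by rw [hj, zero_smul]⟩
      · obtain ⟨c, -, hc⟩ := (norm_inner_eq_norm_iff hi hj).1
          ((pow_left_inj₀ (norm_nonneg _) (by positivity) two_ne_zero).1 (heq i j))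
        exact ⟨c, hc⟩
    obtain ⟨c, hc⟩ := hvec
    refine ⟨c, ?_⟩
    ext a b
    exact congrFun (congrArg WithLp.ofLp hc) (a, b)
  choose c hc using hpar
  have hs : (∑ j, star (c j) * c j) = (((Real.sqrt (∑ j, ‖c j‖ ^ 2)) : ℝ) : ℂ) *
      ((Real.sqrt (∑ j, ‖c j‖ ^ 2) : ℝ) : ℂ) := by
    rw [← Complex.ofReal_mul, Real.mul_self_sqrt (Finset.sum_nonneg fun _ _ => sq_nonneg _)]
    push_cast
    refine Finset.sum_congr rfl fun j _ => ?_
    rw [Complex.star_def, Complex.conj_mul']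
  -- With this scaling a single Kraus operator carries the contributions of all of them, and trace
  -- preservation makes it unitary.
  refine hU ⟨((Real.sqrt (∑ j, ‖c j‖ ^ 2) : ℝ) : ℂ) • K i, ?_, ?_⟩
  · rw [Matrix.mem_unitaryGroup_iff', Matrix.star_eq_conjTranspose, Matrix.conjTranspose_smul,
      Matrix.smul_mul, Matrix.mul_smul, smul_smul, Complex.star_def, Complex.conj_ofReal, ← hs,
      ← hK, Finset.sum_smul]
    refine Finset.sum_congr rfl fun j _ => ?_
    rw [hc j, Matrix.conjTranspose_smul, Matrix.smul_mul, Matrix.mul_smul, smul_smul]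
  · ext1 X
    change N X = (_ • K i) * X * (_ • K i).conjTranspose
    rw [Matrix.conjTranspose_smul,
      Matrix.smul_mul, Matrix.smul_mul, Matrix.mul_smul, smul_smul, Complex.star_def,
      Complex.conj_ofReal, ← hs, h, Finset.sum_smul]
    refine Finset.sum_congr rfl fun j _ => ?_
    rw [hc j, Matrix.conjTranspose_smul, Matrix.smul_mul, Matrix.smul_mul, Matrix.mul_smul,
      smul_smul, mul_comm]

end Channel
end NoisyCircuit
end

/-! ### Contraction of the mean squares, layer by layer -/

noncomputable section

namespace NoisyCircuit

theorem sum_twirl {ι : Type} [Fintype ι] [DecidableEq ι] [Zero ι] (h : 1 < Fintype.card ι) (i : ι) :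
    ∑ j, twirl i j = (1 : ℝ) := by
  by_cases hi : i = 0
  · subst hi
    simp [twirl_zero_left]
  · rw [← Finset.add_sum_erase _ _ (Finset.mem_univ (0 : ι)), twirl_zero_right, if_neg hi, zero_add]
    have h1 : (1 : ℝ) < Fintype.card ι := by exact_mod_cast h
    rw [Finset.sum_congr rfl (g := fun _ => 1 / ((Fintype.card ι : ℝ) - 1)) fun j hj => by
      rw [twirl, if_neg hi, if_neg (Finset.ne_of_mem_erase hj)], Finset.sum_const,
      Finset.card_erase_of_mem (Finset.mem_univ _), nsmul_eq_mul, Finset.card_univ,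
      Nat.cast_sub (by omega), Nat.cast_one]
    exact mul_one_div_cancel (by linarith)

theorem twirl_pair {S T : Fin 4 × Fin 4} (hS : S ≠ 0) (hT : T ≠ 0) : twirl S T = 1 / 15 := by
  rw [twirl, if_neg hS, if_neg hT]
  simp only [Fintype.card_prod, Fintype.card_fin]
  norm_num

variable {n : ℕ}

/-- The sum of a function over the Pauli strings other than the identity. -/
def sumNonId (p : PauliString n → ℝ) : ℝ := ∑ R, if R = 0 then 0 else p R

theorem setPair_eq_zero {a b : Fin n} (hab : a ≠ b) {R : PauliString n} {S : Fin 4 × Fin 4}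
    (hR : R = 0) : setPair R a b S = 0 ↔ S = 0 := by
  subst hR
  constructor
  · intro h
    have h1 := congrFun h a
    have h2 := congrFun h b
    rw [setPair_left hab] at h1
    rw [setPair_right] at h2
    exact Prod.ext h1 h2
  · rintro rfl
    exact setPair_self (a := a) (b := b) 0

theorem prod_ite_zero_eq_pow_weight (x : ℝ) (Q : PauliString n) : ∏ q, (if Q q = 0 then 1 else x) = x ^ weight Q := by
  rw [weight, Finset.prod_ite, Finset.prod_const_one, one_mul, Finset.prod_const]

namespace Ansatz

variable {L : ℕ} {A : Ansatz n L} {N : Op1 →ₗ[ℂ] Op1}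

/-- Mean squares of random Pauli coefficients. -/
def meanSq (A : Ansatz n L) (v : A.Config → PauliString n → ℝ) (R : PauliString n) : ℝ :=
  ∫ ω, v ω R ^ 2 ∂A.law

theorem meanSq_nonneg (v : A.Config → PauliString n → ℝ) (R : PauliString n) :
    0 ≤ A.meanSq v R := integral_nonneg fun _ => sq_nonneg _

theorem meanSq_const (v : PauliString n → ℝ) (R : PauliString n) :
    A.meanSq (fun _ => v) R = v R ^ 2 := by simp [meanSq]

/-- The mass leaving a source string is a row sum of `twirl`, which is 1, and the identity feeds
only itself. Hence a gate creates no mass off the identity. -/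
theorem sumNonId_gateStep (θ : A.Gate → ℝ) (g : A.Gate) {a b : Fin n} (hab : a ≠ b)
    {v : A.Config → PauliString n → ℝ} (hvc : Continuous v)
    {s : Set A.Gate} {t : Set (Fin L × Fin n)} (hv : A.DependsOnGates v s t) (hg : g ∉ s) :
    sumNonId (A.meanSq fun ω => gateStep a b (ptm pauli2 (A.gateOp ω θ g)) (v ω))
      ≤ sumNonId (A.meanSq v) := by
  have h : ∀ R, (if R = 0 then 0 else
        A.meanSq (fun ω => gateStep a b (ptm pauli2 (A.gateOp ω θ g)) (v ω)) R)
      = ∑ S, if R = 0 then 0 else twirl S (R a, R b) * A.meanSq v (setPair R a b S) := by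
    intro R
    split_ifs
    · simp
    · exact integral_gateStep_sq θ g hvc hv hg R
  rw [sumNonId, Finset.sum_congr rfl fun R _ => h R, sum_setPair hab, sumNonId]
  refine Finset.sum_le_sum fun R _ => ?_
  simp only [setPair_left hab, setPair_right, setPair_setPair hab, setPair_self, Prod.mk.eta]
  by_cases hR : R = 0
  · rw [if_pos hR]
    refine (Finset.sum_eq_zero fun S _ => ?_).le
    split_ifs with hS
    · rfl
    · rw [setPair_eq_zero hab hR] at hS
      subst hR
      rw [show (((0 : PauliString n) a, (0 : PauliString n) b) : Fin 4 × Fin 4) = 0 from rfl,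
        twirl_zero_left, if_neg hS, zero_mul]
  · rw [if_neg hR]
    calc _ ≤ ∑ S, twirl (R a, R b) S * A.meanSq v R := by
          refine Finset.sum_le_sum fun S _ => ?_
          split_ifs
          · exact mul_nonneg (twirl_nonneg _ _) (meanSq_nonneg _ _)
          · rfl
      _ = _ := by rw [← Finset.sum_mul, sum_twirl (by simp), one_mul]

theorem gate_notMem_of_nodup {j : Fin L} {i : Fin (A.numGates j)} {l : List (Fin (A.numGates j))}
    (hl : (i :: l).Nodup) {s : Set A.Gate} (hs : ∀ i, (⟨j, i⟩ : A.Gate) ∉ s) :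
    (⟨j, i⟩ : A.Gate) ∉ s ∪ {g | ∃ i' ∈ l, g = ⟨j, i'⟩} := by
  rintro (h | ⟨i', hi', h⟩)
  · exact hs i h
  · obtain rfl : i = i' := by simpa using h
    exact (List.nodup_cons.1 hl).1 hi'

theorem sumNonId_gatesEvolve (θ : A.Gate → ℝ) (j : Fin L) (l : List (Fin (A.numGates j)))
    (hl : l.Nodup) {v : A.Config → PauliString n → ℝ} (hvc : Continuous v)
    {s : Set A.Gate} {t : Set (Fin L × Fin n)} (hv : A.DependsOnGates v s t)
    (hs : ∀ i, (⟨j, i⟩ : A.Gate) ∉ s) :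
    sumNonId (A.meanSq fun ω => A.gatesEvolve ω θ j l (v ω)) ≤ sumNonId (A.meanSq v) := by
  induction l with
  | nil => exact le_rfl
  | cons i l ih =>
    exact (sumNonId_gateStep θ ⟨j, i⟩ (A.left_ne_right j i) (continuous_gatesEvolve θ j l hvc)
      (dependsOn_gatesEvolve θ j l hv) (gate_notMem_of_nodup hl hs)).trans
      (ih (List.nodup_cons.1 hl).2)

theorem prod_noiseKernel_zero_left (hN : IsQuantumChannel N) (R : PauliString n) :
    ∏ q, noiseKernel N ((0 : PauliString n) q) (R q) = if R = 0 then 1 else 0 := by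
  simp only [Pi.zero_apply, hN.noiseKernel_zero]
  rw [Finset.prod_ite_zero]
  simp [funext_iff]

/-- Each qubit in the support of `Q` passes on total mass `c`, each other qubit mass 1. The outputs
include the identity, whose share is simply dropped. -/
theorem sumNonId_noiseEvolve (hN : IsQuantumChannel N) (j : Fin L)
    {v : A.Config → PauliString n → ℝ} (hvc : Continuous v)
    {s : Set A.Gate} {t : Set (Fin L × Fin n)} (hv : A.DependsOnGates v s t)
    (ht : ∀ q, (j, q) ∉ t) :
    sumNonId (A.meanSq fun ω => A.noiseEvolve N ω j (v ω))
      ≤ sumNonId fun Q => contraction N ^ weight Q * A.meanSq v Q := by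
  have h : ∀ R, A.meanSq (fun ω => A.noiseEvolve N ω j (v ω)) R
      = ∑ Q : PauliString n, (∏ q, noiseKernel N (Q q) (R q)) * A.meanSq v Q :=
    integral_noiseEvolve_sq N j hvc hv ht
  have hsum : ∀ Q : PauliString n, ∑ R : PauliString n, ∏ q, noiseKernel N (Q q) (R q)
      = contraction N ^ weight Q := by
    intro Q
    rw [← Fintype.piFinset_univ, ← Finset.prod_univ_sum (fun _ => Finset.univ)
      (fun q => noiseKernel N (Q q)), ← prod_ite_zero_eq_pow_weight]
    refine Finset.prod_congr rfl fun q _ => ?_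
    split_ifs with hq
    · rw [hq]
      simp [hN.noiseKernel_zero]
    · exact sum_noiseKernel hq
  have h2 : ∀ R, (if R = 0 then 0 else A.meanSq (fun ω => A.noiseEvolve N ω j (v ω)) R)
      = ∑ Q : PauliString n, if R = 0 then 0 else
        (∏ q, noiseKernel N (Q q) (R q)) * A.meanSq v Q := by
    intro R
    rw [h]
    split_ifs <;> simp
  rw [sumNonId, Finset.sum_congr rfl fun R _ => h2 R, Finset.sum_comm]
  refine Finset.sum_le_sum fun Q _ => ?_
  split_ifs with hQ
  · subst hQ
    refine (Finset.sum_eq_zero fun R _ => ?_).le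
    rw [prod_noiseKernel_zero_left hN]
    split_ifs <;> simp
  · change _ ≤ contraction N ^ weight Q * A.meanSq v Q
    rw [← hsum, Finset.sum_mul]
    refine Finset.sum_le_sum fun R _ => ?_
    have := mul_nonneg (Finset.prod_nonneg fun q (_ : q ∈ Finset.univ) =>
      noiseKernel_nonneg (N := N) (Q q) (R q)) (meanSq_nonneg (A := A) v Q)
    split_ifs
    · exact this
    · rfl

theorem gate_notMem_gatesOf {j : Fin L} {l : List (Fin L)} (hj : j ∉ l) (i : Fin (A.numGates j)) :
    (⟨j, i⟩ : A.Gate) ∉ A.gatesOf l := hj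

/-- The layers contract the mean squares of the coefficients other than that of the identity. -/
theorem sumNonId_evolve (hN : IsQuantumChannel N) (hc : contraction N ≤ 1) (θ : A.Gate → ℝ)
    (l : List (Fin L)) (hl : l.Nodup) {P : PauliString n} (hP : P ≠ 0) (hl0 : l ≠ []) :
    sumNonId (A.meanSq fun ω => A.evolve N ω θ l (Pi.single P 1))
      ≤ contraction N ^ (weight P + l.length - 1) := by
  induction l with
  | nil => exact absurd rfl hl0
  | cons j l ih =>
    have hj := (List.nodup_cons.1 hl).1
    have h1 := sumNonId_gatesEvolve (A := A) θ j (List.finRange _) (List.nodup_finRange _)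
      (v := fun ω => A.noiseEvolve N ω j (A.evolve N ω θ l (Pi.single P 1)))
      (continuous_noiseEvolve N j (continuous_evolve N θ l _))
      (dependsOn_noiseEvolve N j (v := fun ω => A.evolve N ω θ l (Pi.single P 1))
        (dependsOn_evolve N θ l _)) (gate_notMem_gatesOf hj)
    have h2 := sumNonId_noiseEvolve (A := A) hN j
      (v := fun ω => A.evolve N ω θ l (Pi.single P 1)) (continuous_evolve N θ l _)
      (dependsOn_evolve N θ l _) fun _ => hj
    refine h1.trans (h2.trans ?_)
    -- The last layer acts on `P` itself and yields the full power `c^|P|`. Earlier layers see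
    -- nontrivial strings of unknown weight, so only one factor `c` is kept for each.
    by_cases hl1 : l = []
    · subst hl1
      rw [sumNonId, Finset.sum_eq_single P]
      · rw [if_neg hP]
        simp [evolve, meanSq_const]
      · intro Q _ hQ
        simp [evolve, meanSq_const, hQ]
      · simp
    · have h3 := ih (List.nodup_cons.1 hl).2 hl1
      have hw : 1 ≤ weight P := by
        rw [weight, Nat.one_le_iff_ne_zero, Finset.card_ne_zero]
        obtain ⟨q, hq⟩ := Function.ne_iff.1 hP
        exact ⟨q, by simpa using hq⟩
      rw [List.length_cons, show weight P + (l.length + 1) - 1 = (weight P + l.length - 1) + 1 by omega,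
        pow_succ']
      refine le_trans ?_ (mul_le_mul_of_nonneg_left h3 contraction_nonneg)
      rw [sumNonId, sumNonId, Finset.mul_sum]
      refine Finset.sum_le_sum fun Q _ => ?_
      split_ifs with hQ
      · simp
      · refine mul_le_mul_of_nonneg_right ?_ (meanSq_nonneg _ _)
        refine pow_le_of_le_one contraction_nonneg hc ?_
        rw [weight, Finset.card_ne_zero]
        obtain ⟨q, hq⟩ := Function.ne_iff.1 hQ
        exact ⟨q, by simpa using hq⟩

/-! ### Lower bounds -/

theorem gateStep_eq_self {a b : Fin n} {W : Op2} (hW : W ∈ Matrix.unitaryGroup (Fin 2 × Fin 2) ℂ)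
    (v : PauliString n → ℝ) {R : PauliString n} (ha : R a = 0) (hb : R b = 0) :
    gateStep a b (ptm pauli2 W) v R = v R := by
  have h0 : (R a, R b) = 0 := by rw [ha, hb]; rfl
  simp only [gateStep, h0, pauli2_isPauliBasis.ptm_zero_right hW, ite_mul, one_mul, zero_mul,
    Finset.sum_ite_eq', Finset.mem_univ, if_true]
  rw [← h0, setPair_self]

theorem gatesEvolve_zero (ω : A.Config) (θ : A.Gate → ℝ) (j : Fin L)
    (l : List (Fin (A.numGates j))) (v : PauliString n → ℝ) :
    A.gatesEvolve ω θ j l v 0 = v 0 := by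
  induction l with
  | nil => rfl
  | cons i l ih => exact (gateStep_eq_self (A.gateOp_mem ω θ _) _ rfl rfl).trans ih

theorem prod_noiseKernel_zero_right (hN : IsQuantumChannel N) (Q : PauliString n) :
    ∏ q, noiseKernel N (Q q) ((0 : PauliString n) q) = noiseKernel N 1 0 ^ weight Q := by
  rw [← prod_ite_zero_eq_pow_weight]
  refine Finset.prod_congr rfl fun q _ => ?_
  split_ifs with hq
  · rw [hq, hN.noiseKernel_zero]
    rfl
  · rw [Pi.zero_apply, noiseKernel_of_ne_zero hq, noiseKernel_of_ne_zero (by decide)]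

/-- The coefficient of the identity after at least one layer. -/
theorem le_meanSq_evolve_zero (hN : IsQuantumChannel N) (θ : A.Gate → ℝ) (l : List (Fin L))
    (hl : l.Nodup) (hl0 : l ≠ []) (v : PauliString n → ℝ) :
    ∑ Q, noiseKernel N 1 0 ^ weight Q * v Q ^ 2 ≤ A.meanSq (fun ω => A.evolve N ω θ l v) 0 := by
  induction l with
  | nil => exact absurd rfl hl0
  | cons j l ih =>
    have hj := (List.nodup_cons.1 hl).1
    have h1 : A.meanSq (fun ω => A.evolve N ω θ (j :: l) v) 0
        = ∑ Q, noiseKernel N 1 0 ^ weight Q * A.meanSq (fun ω => A.evolve N ω θ l v) Q := by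
      have h2 := integral_noiseEvolve_sq (A := A) N j
        (v := fun ω => A.evolve N ω θ l v) (continuous_evolve N θ l _)
        (dependsOn_evolve N θ l _) (fun _ => hj) 0
      simp only [prod_noiseKernel_zero_right hN] at h2
      refine Eq.trans ?_ h2
      refine integral_congr_ae (Filter.Eventually.of_forall fun ω => ?_)
      simp only [evolve, List.foldr_cons, gatesEvolve_zero]
    rw [h1]
    by_cases hl1 : l = []
    · subst hl1
      simp [evolve, meanSq_const]
    · refine (ih (List.nodup_cons.1 hl).2 hl1).trans ?_
      -- The identity has weight zero and passes with factor one, so mass that has reached it stays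
      -- there.
      have := Finset.single_le_sum (f := fun Q : PauliString n =>
        noiseKernel N 1 0 ^ weight Q * A.meanSq (fun ω => A.evolve N ω θ l v) Q)
        (fun Q _ => mul_nonneg (pow_nonneg (noiseKernel_nonneg _ _) _) (meanSq_nonneg _ _))
        (Finset.mem_univ 0)
      simpa [weight] using this

/-- The qubits on which the random operator can act nontrivially. -/
def active (A : Ansatz n L) (v : A.Config → PauliString n → ℝ) : Set (Fin n) :=
  {q | ∃ ω R, v ω R ≠ 0 ∧ R q ≠ 0}

theorem setPair_single {a b : Fin n} (hab : a ≠ b) {q : Fin n} (hq : q = a ∨ q = b) (s : Fin 4)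
    (S : Fin 4 × Fin 4) : setPair (Pi.single q s) a b S = setPair (0 : PauliString n) a b S := by
  ext1 p
  by_cases hb : p = b
  · subst hb; simp [setPair]
  by_cases ha : p = a
  · subst ha; simp [setPair, hab]
  rw [setPair_of_ne ha hb, setPair_of_ne ha hb, Pi.single_eq_of_ne]
  · rfl
  · rintro rfl
    exact hq.elim ha hb

theorem setPair_zero_left {a b : Fin n} (hab : a ≠ b) (s : Fin 4) :
    setPair (0 : PauliString n) a b (s, 0) = Pi.single a s := by
  ext1 p
  by_cases hb : p = b
  · subst hb; simp [setPair, hab.symm]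
  by_cases ha : p = a
  · subst ha; simp [setPair, hab]
  simp [setPair, ha, hb]

theorem setPair_zero_right {a b : Fin n} (s : Fin 4) :
    setPair (0 : PauliString n) a b (0, s) = Pi.single b s := by
  ext1 p
  by_cases hb : p = b
  · subst hb; simp [setPair]
  simp [setPair, hb]

/-- Each round, rather than each gate, costs a factor 1/15. If `q` is active after a gate on it,
then one of the two qubits of the gate was active before; the weight-one string there is spread
evenly over the 15 nontrivial labels, one of which is a weight-one string at `q`. The exponent `k`
is the number of rounds spent at `q`, and the last clause says that every remaining gate on `q` lies
in a round early enough to keep within the budget `r`. -/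
theorem le_meanSq_gatesEvolve (θ : A.Gate → ℝ) (j : Fin L) {r : ℕ}
    (round : Fin (A.numGates j) → Fin r)
    (hround : ∀ i i', i < i' → (A.left j i = A.left j i' ∨ A.left j i = A.right j i' ∨
      A.right j i = A.left j i' ∨ A.right j i = A.right j i') → round i < round i')
    {v : A.Config → PauliString n → ℝ} (hvc : Continuous v)
    {s : Set A.Gate} {t : Set (Fin L × Fin n)} (hv : A.DependsOnGates v s t)
    (hs : ∀ i, (⟨j, i⟩ : A.Gate) ∉ s) {B : ℝ} (hB : 0 ≤ B)
    (hvB : ∀ q ∈ A.active v, ∃ x : Fin 4, x ≠ 0 ∧ B ≤ A.meanSq v (Pi.single q x))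
    (l : List (Fin (A.numGates j))) (hl : l.Pairwise (· < ·)) :
    ∀ q ∈ A.active fun ω => A.gatesEvolve ω θ j l (v ω), ∃ k ≤ r, (∃ x : Fin 4, x ≠ 0 ∧
      B * (1 / 15) ^ k ≤ A.meanSq (fun ω => A.gatesEvolve ω θ j l (v ω)) (Pi.single q x)) ∧
      ∀ i, (∀ i' ∈ l, i < i') → (A.left j i = q ∨ A.right j i = q) → (round i : ℕ) + k + 1 ≤ r := by
  induction l with
  | nil =>
    intro q hq
    obtain ⟨x, hx, h⟩ := hvB q hq
    exact ⟨0, Nat.zero_le _, ⟨x, hx, by rw [pow_zero, mul_one]; exact h⟩, fun i _ _ => (round i).2⟩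
  | cons i l ih =>
    have ih' := ih (List.pairwise_cons.1 hl).2
    have hil := (List.pairwise_cons.1 hl).1
    have hnd : (i :: l).Nodup := hl.imp fun h => ne_of_lt h
    have hab := A.left_ne_right j i
    have hstep := integral_gateStep_sq θ ⟨j, i⟩ (a := A.left j i) (b := A.right j i)
      (continuous_gatesEvolve θ j l hvc) (dependsOn_gatesEvolve θ j l hv)
      (gate_notMem_of_nodup hnd hs)
    rintro q ⟨ω, R, hR, hRq⟩
    obtain ⟨S, -, hS⟩ := Finset.exists_ne_zero_of_sum_ne_zero
      (s := Finset.univ)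
      (f := fun S => ptm pauli2 (A.gateOp ω θ ⟨j, i⟩) S (R (A.left j i), R (A.right j i)) *
        A.gatesEvolve ω θ j l (v ω) (setPair R (A.left j i) (A.right j i) S)) hR
    have hS1 := left_ne_zero_of_mul hS
    have hS2 := right_ne_zero_of_mul hS
    by_cases hq : q = A.left j i ∨ q = A.right j i
    -- A unitary maps the identity on the pair to itself, so the source string is nontrivial on at
    -- least one of the two qubits.
    · have hS0 : S ≠ 0 := by
        rintro rfl
        rw [pauli2_isPauliBasis.ptm_zero_left (A.gateOp_mem ω θ _)] at hS1
        refine hS1 (if_neg fun h => hRq ?_)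
        rcases hq with rfl | rfl
        · exact congrArg Prod.fst h
        · exact congrArg Prod.snd h
      obtain ⟨k, hk, T, hT0, hx⟩ : ∃ k, (round i : ℕ) + k + 1 ≤ r ∧
          ∃ T : Fin 4 × Fin 4, T ≠ 0 ∧ B * (1 / 15) ^ k ≤
          A.meanSq (fun ω => A.gatesEvolve ω θ j l (v ω))
            (setPair 0 (A.left j i) (A.right j i) T) := by
        by_cases hS3 : S.1 = 0
        · have hS4 : S.2 ≠ 0 := fun h => hS0 (Prod.ext hS3 h)
          obtain ⟨k, -, ⟨x, hx, hx'⟩, hk⟩ := ih' (A.right j i)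
            ⟨ω, _, hS2, by rwa [setPair_right]⟩
          refine ⟨k, hk i hil (Or.inr rfl), (0, x), fun h => hx (congrArg Prod.snd h), ?_⟩
          rwa [setPair_zero_right]
        · obtain ⟨k, -, ⟨x, hx, hx'⟩, hk⟩ := ih' (A.left j i)
            ⟨ω, _, hS2, by rwa [setPair_left hab]⟩
          refine ⟨k, hk i hil (Or.inl rfl), (x, 0), fun h => hx (congrArg Prod.fst h), ?_⟩
          rwa [setPair_zero_left hab]
      -- The exponent `r - round i` may exceed `k + 1`, but it depends on the round alone; the
      -- budget of the remaining gates then follows because rounds increase strictly along gates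
      -- sharing a qubit.
      refine ⟨r - round i, Nat.sub_le _ _, ⟨1, by decide, ?_⟩, ?_⟩
      · have hU : ((Pi.single q 1 : PauliString n) (A.left j i),
            (Pi.single q 1 : PauliString n) (A.right j i)) ≠ 0 := by
          intro h
          rcases hq with rfl | rfl
          · simpa using congrArg Prod.fst h
          · simpa using congrArg Prod.snd h
        calc B * (1 / 15) ^ (r - round i) ≤ B * (1 / 15) ^ (k + 1) := by
              refine mul_le_mul_of_nonneg_left ?_ hB
              exact pow_le_pow_of_le_one (by norm_num) (by norm_num) (by omega)
          _ = 1 / 15 * (B * (1 / 15) ^ k) := by ring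
          _ ≤ twirl T ((Pi.single q 1 : PauliString n) (A.left j i),
                (Pi.single q 1 : PauliString n) (A.right j i)) *
              A.meanSq (fun ω => A.gatesEvolve ω θ j l (v ω))
                (setPair (Pi.single q 1) (A.left j i) (A.right j i) T) := by
              rw [twirl_pair hT0 hU, setPair_single hab hq]
              exact mul_le_mul_of_nonneg_left hx (by norm_num)
          _ ≤ _ := by
              refine (Finset.single_le_sum (f := fun T => twirl T
                ((Pi.single q 1 : PauliString n) (A.left j i),
                (Pi.single q 1 : PauliString n) (A.right j i)) *
                A.meanSq (fun ω => A.gatesEvolve ω θ j l (v ω))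
                (setPair (Pi.single q 1) (A.left j i) (A.right j i) T))
                (fun T _ => mul_nonneg (twirl_nonneg _ _) (meanSq_nonneg _ _))
                (Finset.mem_univ T)).trans ?_
              exact (hstep (Pi.single q 1)).ge
      · intro i' hi' hi'q
        have h1 : round i' < round i := by
          refine hround i' i (hi' i List.mem_cons_self) ?_
          rcases hi'q with h | h <;> rcases hq with h' | h' <;> simp [h, h']
        have h2 : (round i' : ℕ) < round i := h1
        have := (round i).2
        omega
    · push Not at hq
      obtain ⟨k, hk, ⟨x, hx, hx'⟩, hk'⟩ := ih' q
        ⟨ω, _, hS2, by rwa [setPair_of_ne hq.1 hq.2]⟩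
      refine ⟨k, hk, ⟨x, hx, ?_⟩, fun i' hi' hq' => hk' i' (fun i'' h => hi' i''
        (List.mem_cons_of_mem _ h)) hq'⟩
      refine hx'.trans (le_of_eq ?_)
      refine integral_congr_ae (Filter.Eventually.of_forall fun ω' => ?_)
      simp only
      rw [show A.gatesEvolve ω' θ j (i :: l) (v ω') (Pi.single q x) =
        A.gatesEvolve ω' θ j l (v ω') (Pi.single q x) from
        gateStep_eq_self (A.gateOp_mem ω' θ _) _ (Pi.single_eq_of_ne hq.1.symm _)
          (Pi.single_eq_of_ne hq.2.symm _)]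

end Ansatz
end NoisyCircuit
end

/-! ### Following a string of weight one through the layers -/

noncomputable section

namespace NoisyCircuit
namespace Ansatz

variable {n L : ℕ} {A : Ansatz n L} {N : Op1 →ₗ[ℂ] Op1}

/-- The hypothesis says that each factor fixes the identity up to scale, and a tensor product of
such maps cannot enlarge supports. -/
theorem exists_ne_zero_of_siteStep {t : Fin n → Fin 4 → Fin 4 → ℝ}
    (ht : ∀ q R, R ≠ 0 → t q 0 R = 0) {v : PauliString n → ℝ} {R : PauliString n} {q : Fin n}
    (h : siteStep t v R ≠ 0) (hR : R q ≠ 0) : ∃ Q, v Q ≠ 0 ∧ Q q ≠ 0 := by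
  obtain ⟨Q, -, hQ⟩ := Finset.exists_ne_zero_of_sum_ne_zero h
  refine ⟨Q, right_ne_zero_of_mul hQ, fun h0 => ?_⟩
  refine Finset.prod_ne_zero_iff.1 (left_ne_zero_of_mul hQ) q (Finset.mem_univ q) ?_
  rw [h0, ht q _ hR]

theorem active_noiseEvolve (hN : IsQuantumChannel N) (j : Fin L)
    (v : A.Config → PauliString n → ℝ) :
    A.active (fun ω => A.noiseEvolve N ω j (v ω)) ⊆ A.active v := by
  rintro q ⟨ω, R, h, hR⟩
  obtain ⟨Q, h1, hQ⟩ := exists_ne_zero_of_siteStep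
    (fun _ R hR => by rw [hN.transferEntry_zero, if_neg hR]) h hR
  obtain ⟨Q', h2, hQ'⟩ := exists_ne_zero_of_siteStep
    (fun q R hR => by rw [pauli_isPauliBasis.ptm_zero_left (ω.2 (j, q)).2, if_neg hR]) h1 hQ
  exact ⟨ω, Q', h2, hQ'⟩

theorem le_meanSq_noiseEvolve (j : Fin L)
    {v : A.Config → PauliString n → ℝ} (hvc : Continuous v)
    {s : Set A.Gate} {t : Set (Fin L × Fin n)} (hv : A.DependsOnGates v s t)
    (ht : ∀ q, (j, q) ∉ t) (Q R : PauliString n) :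
    (∏ q, noiseKernel N (Q q) (R q)) * A.meanSq v Q
      ≤ A.meanSq (fun ω => A.noiseEvolve N ω j (v ω)) R :=
  (Finset.single_le_sum (f := fun Q : PauliString n => (∏ q, noiseKernel N (Q q) (R q)) * A.meanSq v Q)
    (fun _ _ => mul_nonneg (Finset.prod_nonneg fun _ _ => noiseKernel_nonneg _ _)
      (meanSq_nonneg _ _)) (Finset.mem_univ Q)).trans
    (integral_noiseEvolve_sq N j hvc hv ht R).ge

/-- Every nontrivial label except the one at `q` is sent to the identity at cost `noiseKernel N 1
0`; qubits already carrying the identity cost nothing. -/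
theorem prod_noiseKernel_single (hN : IsQuantumChannel N) (Q : PauliString n) {q : Fin n}
    (hq : Q q ≠ 0) (x : Fin 4) :
    ∏ p, noiseKernel N (Q p) ((Pi.single q x : PauliString n) p)
      = noiseKernel N 1 x * noiseKernel N 1 0 ^ (weight Q - 1) := by
  rw [← Finset.mul_prod_erase _ _ (Finset.mem_univ q), Pi.single_eq_same, noiseKernel_of_ne_zero hq,
    ← noiseKernel_of_ne_zero (P := 1) (by decide)]
  congr 1
  rw [Finset.prod_congr rfl (g := fun p => if Q p = 0 then 1 else noiseKernel N 1 0) fun p hp => ?_,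
    Finset.prod_ite, Finset.prod_const_one, one_mul, Finset.prod_const, Finset.filter_erase,
    Finset.card_erase_of_mem (by simpa using hq), weight]
  rw [Pi.single_eq_of_ne (Finset.ne_of_mem_erase hp)]
  split_ifs with h
  · rw [h, hN.noiseKernel_zero]
    rfl
  · rw [noiseKernel_of_ne_zero h, noiseKernel_of_ne_zero (by decide)]

/-- Every qubit on which the evolved Pauli operator can act carries a Pauli operator of weight one
with a mean square that is not too small. -/
theorem le_meanSq_evolve (hN : IsQuantumChannel N) {r : ℕ} (hA : A.LayerDepthLE r)
    (hτ : noiseKernel N 1 0 ≤ 1) {x₀ : Fin 4} (hx₀ : x₀ ≠ 0) (θ : A.Gate → ℝ) (P : PauliString n)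
    (l : List (Fin L)) (hl : l.Nodup) (hl0 : l ≠ []) :
    ∀ q ∈ A.active fun ω => A.evolve N ω θ l (Pi.single P 1), ∃ x : Fin 4, x ≠ 0 ∧
      noiseKernel N 1 0 ^ weight P * (noiseKernel N 1 x₀ * (1 / 15) ^ r) ^ l.length
        ≤ A.meanSq (fun ω => A.evolve N ω θ l (Pi.single P 1)) (Pi.single q x) := by
  have hβ : 0 ≤ noiseKernel N 1 x₀ := noiseKernel_nonneg _ _
  have hτ0 : 0 ≤ noiseKernel N 1 0 := noiseKernel_nonneg _ _
  induction l with
  | nil => exact absurd rfl hl0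
  | cons j l ih =>
    have hj := (List.nodup_cons.1 hl).1
    obtain ⟨round, hround⟩ := hA j
    have hnoise : ∀ q ∈ A.active fun ω => A.noiseEvolve N ω j (A.evolve N ω θ l (Pi.single P 1)),
        noiseKernel N 1 0 ^ weight P * (noiseKernel N 1 x₀ * (1 / 15) ^ r) ^ l.length *
          noiseKernel N 1 x₀ ≤ A.meanSq
          (fun ω => A.noiseEvolve N ω j (A.evolve N ω θ l (Pi.single P 1))) (Pi.single q x₀) := by
      intro q hq
      have hq' := active_noiseEvolve hN j (fun ω => A.evolve N ω θ l (Pi.single P 1)) hq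
      have hle := fun Q => le_meanSq_noiseEvolve (A := A) (N := N) j
        (v := fun ω => A.evolve N ω θ l (Pi.single P 1)) (continuous_evolve N θ l _)
        (dependsOn_evolve N θ l _) (fun _ => hj) Q (Pi.single q x₀)
      -- Only the last layer must erase the rest of `P`, which gives the power of `noiseKernel N 1
      -- 0`. All other layers start from strings of weight one, with nothing left to erase.
      by_cases hl1 : l = []
      · subst hl1
        obtain ⟨ω, R, hR, hRq⟩ := hq'
        have hRP : R = P := by
          by_contra hne
          exact hR (Pi.single_eq_of_ne hne 1)
        subst hRP
        refine le_trans ?_ (hle R)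
        have h1 : A.meanSq (fun ω => A.evolve N ω θ [] (Pi.single R 1)) R = 1 := by
          simp [evolve, meanSq_const]
        rw [prod_noiseKernel_single hN R hRq, h1, List.length_nil, pow_zero, mul_one, mul_one, mul_comm]
        exact mul_le_mul_of_nonneg_left (pow_le_pow_of_le_one hτ0 hτ (Nat.sub_le _ _)) hβ
      · obtain ⟨x, hx, hx'⟩ := ih (List.nodup_cons.1 hl).2 hl1 q hq'
        refine le_trans ?_ (hle (Pi.single q x))
        have hw : weight (Pi.single q x : PauliString n) = 1 := by
          rw [weight, Finset.card_eq_one]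
          refine ⟨q, ?_⟩
          ext p
          by_cases hp : p = q
          · subst hp; simp [hx]
          · simp [hp]
        rw [prod_noiseKernel_single hN _ (by simpa using hx), hw, Nat.sub_self, pow_zero, mul_one,
          mul_comm]
        exact mul_le_mul_of_nonneg_left hx' hβ
    intro q hq
    obtain ⟨k, hk, ⟨x, hx, hle⟩, -⟩ := le_meanSq_gatesEvolve (A := A) θ j round hround
      (v := fun ω => A.noiseEvolve N ω j (A.evolve N ω θ l (Pi.single P 1)))
      (continuous_noiseEvolve N j (continuous_evolve N θ l _))
      (dependsOn_noiseEvolve N j (v := fun ω => A.evolve N ω θ l (Pi.single P 1))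
        (dependsOn_evolve N θ l _)) (gate_notMem_gatesOf hj) (by positivity)
      (fun q hq => ⟨x₀, hx₀, hnoise q hq⟩) (List.finRange _) (List.pairwise_lt_finRange _) q hq
    refine ⟨x, hx, le_trans ?_ hle⟩
    rw [List.length_cons, pow_succ]
    calc _ = noiseKernel N 1 0 ^ weight P * (noiseKernel N 1 x₀ * (1 / 15) ^ r) ^ l.length *
          noiseKernel N 1 x₀ * (1 / 15) ^ r := by ring
      _ ≤ _ := mul_le_mul_of_nonneg_left
          (pow_le_pow_of_le_one (by norm_num) (by norm_num) hk) (by positivity)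

theorem gatesEvolve_append (ω : A.Config) (θ : A.Gate → ℝ) (j : Fin L)
    (l l' : List (Fin (A.numGates j))) (v : PauliString n → ℝ) :
    A.gatesEvolve ω θ j (l ++ l') v = A.gatesEvolve ω θ j l (A.gatesEvolve ω θ j l' v) :=
  List.foldr_append

/-- Gates that do not touch the support of a Pauli string do not change its coefficient. -/
theorem gatesEvolve_eq_self (ω : A.Config) (θ : A.Gate → ℝ) (j : Fin L)
    (l : List (Fin (A.numGates j))) (v : PauliString n → ℝ) {R : PauliString n}
    (hR : ∀ i ∈ l, R (A.left j i) = 0 ∧ R (A.right j i) = 0) :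
    A.gatesEvolve ω θ j l v R = v R := by
  induction l with
  | nil => rfl
  | cons i l ih =>
    have h := hR i List.mem_cons_self
    exact (gateStep_eq_self (A.gateOp_mem ω θ _) _ h.1 h.2).trans
      (ih fun i' hi' => hR i' (List.mem_cons_of_mem _ hi'))

theorem finRange_split {m : ℕ} (i : Fin m) :
    ∃ l l', List.finRange m = l ++ i :: l' ∧ ∀ i' ∈ l, i' < i := by
  obtain ⟨l, l', h⟩ := List.append_of_mem (List.mem_finRange i)
  refine ⟨l, l', h, fun i' hi' => ?_⟩
  have := List.pairwise_lt_finRange m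
  rw [h, List.pairwise_append] at this
  exact this.2.2 i' hi' i List.mem_cons_self

/-- After a parametrised gate, the nontrivial Pauli operators on its two qubits have the same mean
square. -/
theorem meanSq_setPair_eq (θ : A.Gate → ℝ) (μ : A.Gate) (hμ : A.generator μ ≠ 0)
    {v : A.Config → PauliString n → ℝ} (hvc : Continuous v)
    {s : Set A.Gate} {t : Set (Fin L × Fin n)} (hv : A.DependsOnGates v s t)
    (hs : ∀ i, (⟨μ.1, i⟩ : A.Gate) ∉ s) {S T : Fin 4 × Fin 4} (hS : S ≠ 0) (hT : T ≠ 0) :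
    A.meanSq (fun ω => A.gatesEvolve ω θ μ.1 (List.finRange _) (v ω))
        (setPair 0 (A.left μ.1 μ.2) (A.right μ.1 μ.2) S)
      = A.meanSq (fun ω => A.gatesEvolve ω θ μ.1 (List.finRange _) (v ω))
        (setPair 0 (A.left μ.1 μ.2) (A.right μ.1 μ.2) T) := by
  obtain ⟨j, i⟩ := μ
  have hab := A.left_ne_right j i
  obtain ⟨l, l', hl, hlt⟩ := finRange_split i
  have hnd := List.nodup_finRange (A.numGates j)
  rw [hl] at hnd
  -- Parametrised gates start their layer, so in Heisenberg order the gates applied after this one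
  -- miss its pair. Its twirl is therefore the last operation there, and it is uniform over
  -- nontrivial labels.
  have key : ∀ S : Fin 4 × Fin 4, S ≠ 0 →
      A.meanSq (fun ω => A.gatesEvolve ω θ j (List.finRange _) (v ω))
        (setPair 0 (A.left j i) (A.right j i) S)
      = ∑ S', (if S' = 0 then 0 else 1 / 15) *
        A.meanSq (fun ω => A.gatesEvolve ω θ j l' (v ω)) (setPair 0 (A.left j i) (A.right j i) S') := by
    intro S hS
    have h1 := integral_gateStep_sq (A := A) θ ⟨j, i⟩ (a := A.left j i) (b := A.right j i)
      (continuous_gatesEvolve θ j l' hvc) (dependsOn_gatesEvolve θ j l' hv)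
      (gate_notMem_of_nodup (List.nodup_append.1 hnd).2.1 hs)
      (setPair 0 (A.left j i) (A.right j i) S)
    simp only [setPair_left hab, setPair_right, setPair_setPair hab, Prod.mk.eta] at h1
    refine Eq.trans ?_ (h1.trans ?_)
    · refine integral_congr_ae (Filter.Eventually.of_forall fun ω => ?_)
      simp only [hl, gatesEvolve_append]
      rw [gatesEvolve_eq_self]
      · rfl
      · intro i' hi'
        obtain ⟨h1, h2, h3, h4⟩ := A.generator_start j i hμ i' (hlt i' hi')
        rw [setPair_of_ne h1 h2, setPair_of_ne h3 h4]
        exact ⟨rfl, rfl⟩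
    · refine Finset.sum_congr rfl fun S' _ => ?_
      congr 1
      split_ifs with h
      · rw [h, twirl_zero_left, if_neg hS]
      · exact twirl_pair h hS
  exact (key S hS).trans (key T hT).symm

end Ansatz
end NoisyCircuit
end

noncomputable section

namespace NoisyCircuit

/-! ### The partial derivative of the cost -/

section Lists

variable {L : ℕ} (k : Fin L)

theorem finRange_eq_append :
    List.finRange L = (List.finRange L).filter (fun j => j < k) ++
      (List.finRange L).filter fun j => k ≤ j := by
  obtain ⟨l, l', h, hl⟩ := Ansatz.finRange_split k
  have hp := List.pairwise_lt_finRange L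
  rw [h, List.pairwise_append, List.pairwise_cons] at hp
  have e1 : l.filter (fun j => j < k) = l := List.filter_eq_self.2 fun i hi => by simpa using hl i hi
  have e2 : l.filter (fun j => k ≤ j) = [] := List.filter_eq_nil_iff.2 fun i hi => by
    simpa using hl i hi
  have e3 : l'.filter (fun j => j < k) = [] := List.filter_eq_nil_iff.2 fun i hi => by
    simpa using (hp.2.1.1 i hi).le
  have e4 : l'.filter (fun j => k ≤ j) = l' := List.filter_eq_self.2 fun i hi => by
    simpa using (hp.2.1.1 i hi).le
  rw [h, List.filter_append, List.filter_append, List.filter_cons, List.filter_cons, e1, e2, e3, e4]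
  simp

theorem filter_le_eq_cons :
    (List.finRange L).filter (fun j => k ≤ j) = k :: (List.finRange L).filter fun j => k < j := by
  obtain ⟨l, l', h, hl⟩ := Ansatz.finRange_split k
  have hp := List.pairwise_lt_finRange L
  rw [h, List.pairwise_append, List.pairwise_cons] at hp
  have e1 : l.filter (fun j => k < j) = [] := List.filter_eq_nil_iff.2 fun i hi => by
    simpa using (hl i hi).le
  have e2 : l.filter (fun j => k ≤ j) = [] := List.filter_eq_nil_iff.2 fun i hi => by
    simpa using hl i hi
  have e3 : l'.filter (fun j => k < j) = l' := List.filter_eq_self.2 fun i hi => by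
    simpa using hp.2.1.1 i hi
  have e4 : l'.filter (fun j => k ≤ j) = l' := List.filter_eq_self.2 fun i hi => by
    simpa using (hp.2.1.1 i hi).le
  rw [h, List.filter_append, List.filter_append, List.filter_cons, List.filter_cons, e1, e2, e3, e4]
  simp

theorem nodup_filter_finRange (p : Fin L → Bool) : ((List.finRange L).filter p).Nodup :=
  (List.nodup_finRange L).filter _

/-- Layer `k` itself is included, so there is one layer more than counted by `layersAfter`; this
shift reappears in all exponents. -/
theorem length_filter_le : ((List.finRange L).filter fun j => k ≤ j).length = L - (k + 1) + 1 := by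
  have h : ((List.finRange L).filter fun j => k ≤ j).toFinset = Finset.Ici k := by
    ext j
    simp
  rw [← List.toFinset_card_of_nodup (nodup_filter_finRange _), h, Fin.card_Ici]
  omega

theorem filter_lt_ne_nil (hk : 0 < (k : ℕ)) :
    (List.finRange L).filter (fun j => j < k) ≠ [] :=
  List.ne_nil_of_mem (a := ⟨0, hk.trans k.2⟩)
    (List.mem_filter.2 ⟨List.mem_finRange _, by simpa [Fin.lt_def] using hk⟩)

end Lists

section Generator

variable {n : ℕ}

/-- The coefficient of the Pauli operator `t` in `i [H, s]`. -/
def commMatrix (H : Op2) (s t : Fin 4 × Fin 4) : ℝ :=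
  (pauli2 t * (Complex.I • (H * pauli2 s - pauli2 s * H))).trace.re / 4

theorem commMatrix_expand {H : Op2} (hH : H.IsHermitian) (s : Fin 4 × Fin 4) :
    Complex.I • (H * pauli2 s - pauli2 s * H) = ∑ t, (commMatrix H s t : ℂ) • pauli2 t := by
  have h : (Complex.I • (H * pauli2 s - pauli2 s * H)).conjTranspose
      = Complex.I • (H * pauli2 s - pauli2 s * H) := by
    rw [Matrix.conjTranspose_smul, Matrix.conjTranspose_sub, Matrix.conjTranspose_mul,
      Matrix.conjTranspose_mul, hH.eq, pauli2_isPauliBasis.herm]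
    simp only [Complex.star_def, Complex.conj_I, neg_smul, ← smul_neg, neg_sub]
  conv_lhs => rw [pauli2_isPauliBasis.expand_re h]
  refine Finset.sum_congr rfl fun t _ => ?_
  rw [commMatrix]
  norm_num [Fintype.card_prod]

theorem embF_sub {a b : Fin n} (K K' : Op2) (F : Fin n → Op1) :
    embF a b (K - K') F = embF a b K F - embF a b K' F := by
  ext x y
  simp only [embF, Matrix.of_apply, Matrix.sub_apply, sub_mul]

theorem commutator_embed_ofVec {a b : Fin n} (hab : a ≠ b) {H : Op2} (hH : H.IsHermitian)
    (v : PauliString n → ℝ) :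
    Complex.I • (embed a b H * ofVec v - ofVec v * embed a b H)
      = ofVec (gateStep a b (commMatrix H) v) := by
  have key : ∀ R : PauliString n, Complex.I • (embed a b H * pauliOp R - pauliOp R * embed a b H)
      = ∑ S, (commMatrix H (R a, R b) S : ℂ) • pauliOp (setPair R a b S) := by
    intro R
    rw [embed_mul_pauliOp hab, pauliOp_mul_embed hab, ← embF_sub, ← embF_smul,
      commMatrix_expand hH]
    simp only [embF_sum, embF_smul, embF_pauli2 hab]
  have h : Complex.I • (embed a b H * ofVec v - ofVec v * embed a b H)
      = ∑ R, (v R : ℂ) • Complex.I • (embed a b H * pauliOp R - pauliOp R * embed a b H) := by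
    simp only [ofVec, Matrix.mul_sum, Matrix.sum_mul, Matrix.mul_smul, Matrix.smul_mul,
      ← Finset.sum_sub_distrib, Finset.smul_sum, ← smul_sub, smul_comm Complex.I]
  rw [h]
  simp only [key, ofVec, gateStep, Finset.smul_sum]
  push_cast
  simp only [Finset.sum_smul]
  rw [sum_setPair hab]
  refine Finset.sum_congr rfl fun R _ => Finset.sum_congr rfl fun S _ => ?_
  rw [setPair_setPair hab, setPair_self, setPair_left hab, setPair_right, smul_smul, mul_comm]

end Generator

section Derivative

-- Derivatives need a norm on matrices; a submultiplicative one is chosen so that the calculus of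
-- the exponential applies.
attribute [local instance] Matrix.linftyOpNormedRing Matrix.linftyOpNormedAlgebra

variable {m : Type} [Fintype m] [DecidableEq m]

theorem hasDerivAt_exp_smul (G : Matrix m m ℂ) :
    HasDerivAt (fun s : ℝ => NormedSpace.exp ((s : ℂ) • G)) G 0 := by
  have h := hasDerivAt_exp_smul_const (𝕂 := ℝ) G 0
  simp only [zero_smul, NormedSpace.exp_zero, one_mul] at h
  have h' : (fun s : ℝ => NormedSpace.exp ((s : ℂ) • G))
      = fun s : ℝ => NormedSpace.exp (s • G) := by
    ext1 s
    rw [Complex.coe_smul]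
  rw [h']
  exact h

/-- The derivative at `0` of `Tr(V E(s) σ E(s)†)`, where `E` is the image of the one-parameter group
generated by `-i H` under an algebra homomorphism. -/
theorem hasDerivAt_trace_conj {m' : Type} [Fintype m'] [DecidableEq m']
    (e : Matrix m' m' ℂ →ₗ[ℂ] Matrix m m ℂ) (he : e 1 = 1) (G G' : Matrix m' m' ℂ)
    (V σ : Matrix m m ℂ) :
    HasDerivAt (fun s : ℝ => ((V * (e (NormedSpace.exp ((s : ℂ) • G)) * σ *
      e (NormedSpace.exp ((s : ℂ) • G')))).trace).re) ((V * (e G * σ + σ * e G')).trace).re 0 := by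
  have hE : ∀ G : Matrix m' m' ℂ,
      HasDerivAt (fun s : ℝ => e (NormedSpace.exp ((s : ℂ) • G))) (e G) 0 := fun G =>
    ((e.restrictScalars ℝ).toContinuousLinearMap.hasFDerivAt).comp_hasDerivAt (0 : ℝ)
      (hasDerivAt_exp_smul G)
  have h0 : ∀ G : Matrix m' m' ℂ, e (NormedSpace.exp (((0 : ℝ) : ℂ) • G)) = 1 := by
    intro G
    rw [Complex.ofReal_zero, zero_smul, NormedSpace.exp_zero, he]
  let tr : Matrix m m ℂ →ₗ[ℝ] ℝ := Complex.reLm ∘ₗ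
    ((Matrix.traceLinearMap m ℂ ℂ) ∘ₗ (LinearMap.mulLeft ℂ V)).restrictScalars ℝ
  have h1 := ((hE G).mul (hasDerivAt_const (0 : ℝ) σ)).mul (hE G')
  have h2 := (tr.toContinuousLinearMap.hasFDerivAt).comp_hasDerivAt (0 : ℝ) h1
  refine h2.congr_deriv ?_
  simp only [h0, mul_one, mul_zero, add_zero, Pi.mul_apply, one_mul]
  rfl

end Derivative

namespace Ansatz

variable {n L : ℕ} (A : Ansatz n L) {N : Op1 →ₗ[ℂ] Op1}

theorem gatesOp_append (ω : A.Config) (θ : A.Gate → ℝ) (j : Fin L)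
    (l l' : List (Fin (A.numGates j))) :
    A.gatesOp ω θ j (l ++ l') = A.gatesOp ω θ j l' * A.gatesOp ω θ j l := by
  induction l with
  | nil => exact (mul_one _).symm
  | cons i l ih =>
    rw [List.cons_append]
    change A.gatesOp ω θ j (l ++ l') * _ = _ * (A.gatesOp ω θ j l * _)
    rw [ih, mul_assoc]

theorem gateOp_update_of_ne (ω : A.Config) (θ : A.Gate → ℝ) {μ g : A.Gate} (hg : g ≠ μ) (s : ℝ) :
    A.gateOp ω (Function.update θ μ s) g = A.gateOp ω θ g := by
  rw [gateOp, gateOp, Function.update_of_ne hg]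

theorem gateOp_update (ω : A.Config) (θ : A.Gate → ℝ) (μ : A.Gate) (s : ℝ) :
    A.gateOp ω (Function.update θ μ s) μ = A.gateOp ω θ μ *
      NormedSpace.exp (((s - θ μ : ℝ) : ℂ) • -(Complex.I • A.generator μ)) := by
  rw [gateOp, gateOp, Function.update_self, mul_assoc, ← Matrix.exp_add_of_commute]
  · congr 2
    rw [smul_neg, smul_smul, neg_smul, neg_smul, ← neg_add, ← add_smul]
    push_cast
    ring_nf
  · exact (((Commute.refl _).smul_left _).smul_right _).neg_right.smul_right _

theorem gatesOp_update_of_notMem (ω : A.Config) (θ : A.Gate → ℝ) {μ : A.Gate} {j : Fin L}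
    {l : List (Fin (A.numGates j))} (hl : ∀ i ∈ l, (⟨j, i⟩ : A.Gate) ≠ μ) (s : ℝ) :
    A.gatesOp ω (Function.update θ μ s) j l = A.gatesOp ω θ j l := by
  induction l with
  | nil => rfl
  | cons i l ih =>
    change A.gatesOp ω _ j l * _ = A.gatesOp ω θ j l * _
    rw [ih fun i' hi' => hl i' (List.mem_cons_of_mem _ hi'),
      A.gateOp_update_of_ne ω θ (hl i List.mem_cons_self)]

/-- The generator of a gate commutes with the earlier gates of the layer. -/
theorem gatesOp_commute (ω : A.Config) (θ : A.Gate → ℝ) {j : Fin L} (i : Fin (A.numGates j))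
    (hi : A.generator ⟨j, i⟩ ≠ 0)
    {l : List (Fin (A.numGates j))} (hl : ∀ i' ∈ l, i' < i) (E : Op2) :
    Commute (A.gatesOp ω θ j l) (embed (A.left j i) (A.right j i) E) := by
  induction l with
  | nil => exact Commute.one_left _
  | cons i' l ih =>
    refine Commute.mul_left (ih fun i' h => hl i' (List.mem_cons_of_mem _ h)) ?_
    obtain ⟨h1, h2, h3, h4⟩ := A.generator_start j i hi i' (hl i' List.mem_cons_self)
    exact embed_commute_of_disjoint (A.left_ne_right j i') (A.left_ne_right j i) h1.symm h3.symm
      h2.symm h4.symm _ _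

/-- The shift of the parameter appears to the right of its own gate and commutes with the earlier
gates of the layer, so it can be moved to the start of the layer. For a gate with zero generator it
is the identity. -/
theorem layerUnitary_update (ω : A.Config) (θ : A.Gate → ℝ) (μ : A.Gate) (s : ℝ) :
    A.layerUnitary ω (Function.update θ μ s) μ.1 = A.layerUnitary ω θ μ.1 *
      embed (A.left μ.1 μ.2) (A.right μ.1 μ.2)
        (NormedSpace.exp (((s - θ μ : ℝ) : ℂ) • -(Complex.I • A.generator μ))) := by
  obtain ⟨j, i⟩ := μ
  have hab := A.left_ne_right j i
  obtain ⟨l, l', hl, hlt⟩ := finRange_split i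
  have hnd := List.nodup_finRange (A.numGates j)
  rw [hl, List.nodup_append, List.nodup_cons] at hnd
  have h1 : ∀ i' ∈ l, (⟨j, i'⟩ : A.Gate) ≠ ⟨j, i⟩ := fun i' hi' h => by
    obtain rfl : i' = i := by simpa using h
    exact lt_irrefl _ (hlt i' hi')
  have h2 : ∀ i' ∈ l', (⟨j, i'⟩ : A.Gate) ≠ ⟨j, i⟩ := fun i' hi' h => by
    obtain rfl : i' = i := by simpa using h
    exact hnd.2.1.1 hi'
  have hcomm : Commute (A.gatesOp ω θ j l) (embed (A.left j i) (A.right j i)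
      (NormedSpace.exp (((s - θ ⟨j, i⟩ : ℝ) : ℂ) • -(Complex.I • A.generator ⟨j, i⟩)))) := by
    by_cases h0 : A.generator ⟨j, i⟩ = 0
    · rw [h0, smul_zero, neg_zero, smul_zero, NormedSpace.exp_zero, embed_one hab]
      exact Commute.one_right _
    · exact A.gatesOp_commute ω θ i h0 hlt _
  rw [layerUnitary_eq, layerUnitary_eq, hl, gatesOp_append, gatesOp_append,
    A.gatesOp_update_of_notMem ω θ h1, mul_assoc (A.gatesOp ω θ j (i :: l')), hcomm.eq]
  change A.gatesOp ω _ j l' * _ * _ = A.gatesOp ω θ j l' * _ * _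
  rw [A.gatesOp_update_of_notMem ω θ h2, gateOp_update, ← embed_mul hab]
  simp only [mul_assoc]

theorem layerMap_update_of_ne (N : Op1 →ₗ[ℂ] Op1) (ω : A.Config) (θ : A.Gate → ℝ) {μ : A.Gate}
    {j : Fin L} (hj : j ≠ μ.1) (s : ℝ) :
    A.layerMap N ω (Function.update θ μ s) j = A.layerMap N ω θ j := by
  rw [layerMap, layerMap, layerUnitary_eq, layerUnitary_eq, A.gatesOp_update_of_notMem]
  rintro i - rfl
  exact hj rfl

theorem layersMap_update_of_notMem (N : Op1 →ₗ[ℂ] Op1) (ω : A.Config) (θ : A.Gate → ℝ)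
    {μ : A.Gate} {l : List (Fin L)} (hl : μ.1 ∉ l) (s : ℝ) :
    A.layersMap N ω (Function.update θ μ s) l = A.layersMap N ω θ l := by
  induction l with
  | nil => simp only [layersMap, List.foldl_nil]
  | cons j l ih =>
    rw [List.mem_cons, not_or] at hl
    rw [layersMap_cons, layersMap_cons, ih hl.2, A.layerMap_update_of_ne N ω θ (Ne.symm hl.1)]

theorem conjMap_mul {m : Type} [Fintype m] (U V : Matrix m m ℂ) :
    conjMap (U * V) = conjMap U ∘ₗ conjMap V := by
  ext1 B
  simp [conjMap, Matrix.conjTranspose_mul, Matrix.mul_assoc]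

theorem layerMap_update (N : Op1 →ₗ[ℂ] Op1) (ω : A.Config) (θ : A.Gate → ℝ) (μ : A.Gate) (s : ℝ) :
    A.layerMap N ω (Function.update θ μ s) μ.1 = A.layerMap N ω θ μ.1 ∘ₗ
      conjMap (embed (A.left μ.1 μ.2) (A.right μ.1 μ.2)
        (NormedSpace.exp (((s - θ μ : ℝ) : ℂ) • -(Complex.I • A.generator μ)))) := by
  rw [layerMap, layerUnitary_update, conjMap_mul]
  rfl

/-- The varied parameter now enters at one cut only, between two pieces of circuit that keep the
original parameters. -/
theorem circuit_update (N : Op1 →ₗ[ℂ] Op1) (ω : A.Config) (θ : A.Gate → ℝ) (μ : A.Gate) (s : ℝ) :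
    A.circuit N ω (Function.update θ μ s) = A.circuitFrom N ω θ μ.1 ∘ₗ
      conjMap (embed (A.left μ.1 μ.2) (A.right μ.1 μ.2)
        (NormedSpace.exp (((s - θ μ : ℝ) : ℂ) • -(Complex.I • A.generator μ)))) ∘ₗ
      A.layersMap N ω θ ((List.finRange L).filter fun j => j < μ.1) := by
  have h := congrArg (A.layersMap N ω (Function.update θ μ s)) (finRange_eq_append μ.1)
  rw [circuit, h, layersMap_append, circuitFrom, filter_le_eq_cons,
    layersMap_cons, layersMap_cons, A.layersMap_update_of_notMem N ω θ (by simp),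
    A.layersMap_update_of_notMem N ω θ (by simp), layerMap_update, LinearMap.comp_assoc,
    LinearMap.comp_assoc, LinearMap.comp_assoc]

/-- The state that enters the layer of the gate `μ`. -/
def stateBefore (N : Op1 →ₗ[ℂ] Op1) (ρ₀ : Op n) (θ : A.Gate → ℝ) (μ : A.Gate) (ω : A.Config) :
    Op n :=
  A.layersMap N ω θ ((List.finRange L).filter fun j => j < μ.1) ρ₀

/-- The coefficients of the observable, evolved back to the start of the layer of `μ`. -/
def obsAfter (N : Op1 →ₗ[ℂ] Op1) (P : PauliString n) (θ : A.Gate → ℝ) (μ : A.Gate)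
    (ω : A.Config) : PauliString n → ℝ :=
  A.evolve N ω θ ((List.finRange L).filter fun j => μ.1 ≤ j) (Pi.single P 1)

/-- The coefficients of `i [H_μ, A]` in terms of those of `A`. -/
def genStep (μ : A.Gate) (v : PauliString n → ℝ) : PauliString n → ℝ :=
  gateStep (A.left μ.1 μ.2) (A.right μ.1 μ.2) (commMatrix (A.generator μ)) v

/-- At the cut, differentiating the conjugation by the one-parameter group produces a commutator
with the state; cyclicity of the trace moves it to the observable. -/
theorem partialCost_eq (hN : IsQuantumChannel N) (ρ₀ : Op n) (P : PauliString n)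
    (θ : A.Gate → ℝ) (μ : A.Gate) (ω : A.Config) :
    A.partialCost N ρ₀ P θ μ ω = ((ofVec (A.genStep μ (A.obsAfter N P θ μ ω)) *
      A.stateBefore N ρ₀ θ μ ω).trace).re := by
  have hab := A.left_ne_right μ.1 μ.2
  set V := ofVec (A.obsAfter N P θ μ ω) with hV
  set σ := A.stateBefore N ρ₀ θ μ ω with hσ
  let e : Op2 →ₗ[ℂ] Op n :=
    { toFun := embed (A.left μ.1 μ.2) (A.right μ.1 μ.2)
      map_add' := fun x y => by
        simpa using embed_sum (Finset.univ : Finset (Fin 2)) 1 ![x, y]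
      map_smul' := embed_smul }
  have hcost : ∀ s : ℝ, A.cost N ρ₀ P ω (Function.update θ μ s)
      = ((V * (e (NormedSpace.exp (((s - θ μ : ℝ) : ℂ) • -(Complex.I • A.generator μ))) * σ *
        e (NormedSpace.exp (((s - θ μ : ℝ) : ℂ) • (Complex.I • A.generator μ))))).trace).re := by
    intro s
    have h1 := A.isDual_layersMap hN ω θ ((List.finRange L).filter fun j => μ.1 ≤ j)
      (Pi.single P 1)
    rw [ofVec_single] at h1
    rw [cost, circuit_update]
    refine congrArg Complex.re ((h1 _).trans ?_)
    change (V * (e _ * σ * (e _).conjTranspose)).trace = _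
    congr 4
    change (embed _ _ _).conjTranspose = embed _ _ _
    rw [embed_conjTranspose, ← Matrix.exp_conjTranspose]
    simp [Matrix.conjTranspose_smul, (A.generator_hermitian μ).eq]
  have hd := (hasDerivAt_trace_conj e (embed_one hab) (-(Complex.I • A.generator μ))
    (Complex.I • A.generator μ) V σ)
  have hd2 : HasDerivAt (fun s : ℝ => s - θ μ) 1 (θ μ) := (hasDerivAt_id _).sub_const _
  rw [← sub_self (θ μ)] at hd
  have hd3 := HasDerivAt.comp (h := fun s : ℝ => s - θ μ) (θ μ) hd hd2
  rw [partialCost, funext hcost]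
  refine hd3.deriv.trans ?_
  rw [mul_one, genStep, ← commutator_embed_ofVec hab (A.generator_hermitian μ)]
  refine congrArg Complex.re ?_
  have e1 : e (-(Complex.I • A.generator μ))
      = -(Complex.I • embed (A.left μ.1 μ.2) (A.right μ.1 μ.2) (A.generator μ)) := by
    rw [map_neg, map_smul]; rfl
  have e2 : e (Complex.I • A.generator μ)
      = Complex.I • embed (A.left μ.1 μ.2) (A.right μ.1 μ.2) (A.generator μ) := by
    rw [map_smul]; rfl
  rw [e1, e2]
  simp only [Matrix.mul_add, Matrix.neg_mul, Matrix.mul_neg, Matrix.smul_mul, Matrix.mul_smul,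
    Matrix.sub_mul, Matrix.trace_add, Matrix.trace_neg, Matrix.trace_smul, Matrix.trace_sub,
    ← hV]
  rw [← Matrix.mul_assoc, ← Matrix.mul_assoc, Matrix.trace_mul_comm (V * σ), ← Matrix.mul_assoc,
    smul_sub]
  ring

end Ansatz

end NoisyCircuit
end

noncomputable section

namespace NoisyCircuit

/-! ### The variance as a sum over Pauli strings -/

theorem gateStep_eq_sum {n : ℕ} (a b : Fin n) (c : Fin 4 × Fin 4 → Fin 4 × Fin 4 → ℝ)
    (v : PauliString n → ℝ) :
    gateStep a b c v = ∑ R, v R • gateStep a b c (Pi.single R 1) := by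
  ext1 Q
  simp only [gateStep, Finset.sum_apply, Pi.smul_apply, smul_eq_mul, Finset.mul_sum]
  rw [Finset.sum_comm]
  refine Finset.sum_congr rfl fun S _ => ?_
  rw [Finset.sum_eq_single (setPair Q a b S)]
  · simp [mul_comm]
  · intro R _ hR
    rw [Pi.single_eq_of_ne (Ne.symm hR), mul_zero, mul_zero]
  · simp

theorem ofVec_sum_smul {n : ℕ} {κ : Type} (s : Finset κ) (c : κ → ℝ) (v : κ → PauliString n → ℝ) :
    ofVec (∑ i ∈ s, c i • v i) = ∑ i ∈ s, (c i : ℂ) • ofVec (v i) := by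
  simp only [ofVec, Finset.sum_apply, Pi.smul_apply, smul_eq_mul, Finset.smul_sum, smul_smul]
  rw [Finset.sum_comm]
  refine Finset.sum_congr rfl fun R _ => ?_
  push_cast
  rw [Finset.sum_smul]

theorem commMatrix_zero_left (H : Op2) (t : Fin 4 × Fin 4) : commMatrix H 0 t = 0 := by
  simp [commMatrix, pauli2_isPauliBasis.zero]

namespace Ansatz

variable {n L : ℕ} {A : Ansatz n L} {N : Op1 →ₗ[ℂ] Op1}

/-- The expectation of `i [H_μ, R]` in the state that enters the layer of the gate `μ`. -/
def genExpect (A : Ansatz n L) (N : Op1 →ₗ[ℂ] Op1) (ρ₀ : Op n) (θ : A.Gate → ℝ) (μ : A.Gate)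
    (R : PauliString n) (ω : A.Config) : ℝ :=
  ((ofVec (A.genStep μ (Pi.single R 1)) * A.stateBefore N ρ₀ θ μ ω).trace).re

/-- Separates the randomness: the coefficients depend on the layers from that of `μ` on, the
expectations on the earlier ones. -/
theorem partialCost_eq_sum (hN : IsQuantumChannel N) (ρ₀ : Op n) (P : PauliString n)
    (θ : A.Gate → ℝ) (μ : A.Gate) (ω : A.Config) :
    A.partialCost N ρ₀ P θ μ ω
      = ∑ R, A.obsAfter N P θ μ ω R * A.genExpect N ρ₀ θ μ R ω := by
  rw [partialCost_eq A hN, genStep, gateStep_eq_sum, ofVec_sum_smul, Matrix.sum_mul,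
    Matrix.trace_sum, Complex.re_sum]
  refine Finset.sum_congr rfl fun R _ => ?_
  rw [Matrix.smul_mul, Matrix.trace_smul, smul_eq_mul, Complex.re_ofReal_mul]
  rfl

theorem genExpect_eq_sum (hN : IsQuantumChannel N) (ρ₀ : Op n) (θ : A.Gate → ℝ) (μ : A.Gate)
    (R : PauliString n) (ω : A.Config) :
    A.genExpect N ρ₀ θ μ R ω
      = ∑ Q, A.evolve N ω θ ((List.finRange L).filter fun j => j < μ.1)
          (A.genStep μ (Pi.single R 1)) Q * (pauliOp Q * ρ₀).trace.re := by
  have h := A.isDual_layersMap hN ω θ ((List.finRange L).filter fun j => j < μ.1)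
    (A.genStep μ (Pi.single R 1)) ρ₀
  rw [genExpect, stateBefore, h]
  conv_lhs => rw [ofVec]
  rw [Matrix.sum_mul, Matrix.trace_sum, Complex.re_sum]
  refine Finset.sum_congr rfl fun Q _ => ?_
  rw [Matrix.smul_mul, Matrix.trace_smul, smul_eq_mul, Complex.re_ofReal_mul]

theorem continuous_genExpect (hN : IsQuantumChannel N) (ρ₀ : Op n) (θ : A.Gate → ℝ) (μ : A.Gate)
    (R : PauliString n) : Continuous (A.genExpect N ρ₀ θ μ R) := by
  rw [funext (genExpect_eq_sum hN ρ₀ θ μ R)]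
  exact continuous_finsetSum _ fun Q _ =>
    ((continuous_apply Q).comp (continuous_evolve N θ _ _)).mul continuous_const

theorem dependsOn_genExpect (hN : IsQuantumChannel N) (ρ₀ : Op n) (θ : A.Gate → ℝ) (μ : A.Gate)
    (R : PauliString n) : A.DependsOnGates (A.genExpect N ρ₀ θ μ R)
      (A.gatesOf ((List.finRange L).filter fun j => j < μ.1))
      (singlesOf ((List.finRange L).filter fun j => j < μ.1)) := by
  rw [funext (genExpect_eq_sum hN ρ₀ θ μ R)]
  exact (dependsOn_evolve N θ _ _).comp fun v => ∑ Q, v Q * (pauliOp Q * ρ₀).trace.re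

theorem continuous_obsAfter (P : PauliString n) (θ : A.Gate → ℝ) (μ : A.Gate) :
    Continuous (A.obsAfter N P θ μ) := continuous_evolve N θ _ _

theorem disjoint_gatesOf (k : Fin L) :
    Disjoint (A.gatesOf ((List.finRange L).filter fun j => k ≤ j))
      (A.gatesOf ((List.finRange L).filter fun j => j < k)) := by
  refine Set.disjoint_left.2 fun g hg hg' => ?_
  simp only [gatesOf, Set.mem_ofPred_eq, List.mem_filter, decide_eq_true_eq] at hg hg'
  exact absurd hg'.2 (not_lt.2 hg.2)

theorem disjoint_singlesOf (k : Fin L) :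
    Disjoint (singlesOf ((List.finRange L).filter fun j => k ≤ j) : Set (Fin L × Fin n))
      (singlesOf ((List.finRange L).filter fun j => j < k)) := by
  refine Set.disjoint_left.2 fun g hg hg' => ?_
  simp only [singlesOf, Set.mem_ofPred_eq, List.mem_filter, decide_eq_true_eq] at hg hg'
  exact absurd hg'.2 (not_lt.2 hg.2)

/-- Two different strings differ on some qubit, and by `covers` that qubit is touched by a gate of
the first layer of the list. -/
theorem integral_evolve_mul (θ : A.Gate → ℝ) {l : List (Fin L)} (hl : l.Nodup) (hl0 : l ≠ [])
    (v : PauliString n → ℝ) {R R' : PauliString n} (hR : R ≠ R') :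
    ∫ ω, A.evolve N ω θ l v R * A.evolve N ω θ l v R' ∂A.law = 0 := by
  obtain ⟨j, l, rfl⟩ := List.exists_cons_of_ne_nil hl0
  obtain ⟨q, hq⟩ := Function.ne_iff.1 hR
  obtain ⟨i, hi⟩ := A.covers j q
  have hd := dependsOn_noiseEvolve (A := A) N j (v := fun ω => A.evolve N ω θ l v)
    (dependsOn_evolve N θ _ _)
  exact integral_gatesEvolve_mul_eq_zero θ j
    (continuous_noiseEvolve N _ (continuous_evolve N θ _ _))
    (continuous_noiseEvolve N _ (continuous_evolve N θ _ _)) hd hd _ (List.nodup_finRange _)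
    (gate_notMem_gatesOf (List.nodup_cons.1 hl).1) hq ⟨i, List.mem_finRange i, hi⟩

/-- Gates keep the identity coefficient of the identity operator equal to 1. Decorrelating the
coefficient of `R` from this constant shows that its mean is zero. -/
theorem integral_evolve (θ : A.Gate → ℝ) {l : List (Fin L)} (hl : l.Nodup) (hl0 : l ≠ [])
    (v : PauliString n → ℝ) {R : PauliString n} (hR : R ≠ 0) :
    ∫ ω, A.evolve N ω θ l v R ∂A.law = 0 := by
  obtain ⟨j, l, rfl⟩ := List.exists_cons_of_ne_nil hl0
  obtain ⟨q, hq⟩ := Function.ne_iff.1 hR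
  obtain ⟨i, hi⟩ := A.covers j q
  have hd := dependsOn_noiseEvolve (A := A) N j (v := fun ω => A.evolve N ω θ l v)
    (dependsOn_evolve N θ _ _)
  have h := integral_gatesEvolve_mul_eq_zero θ j (w := fun _ => Pi.single 0 1)
    (continuous_noiseEvolve N _ (continuous_evolve N θ _ _)) continuous_const hd
    (fun _ _ _ _ => rfl) _ (List.nodup_finRange _)
    (gate_notMem_gatesOf (List.nodup_cons.1 hl).1) hq ⟨i, List.mem_finRange i, hi⟩
  simp only [gatesEvolve_zero, Pi.single_eq_same, mul_one] at h
  exact h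

theorem filter_le_ne_nil (k : Fin L) : (List.finRange L).filter (fun j => k ≤ j) ≠ [] := by
  rw [filter_le_eq_cons]
  exact List.cons_ne_nil _ _

theorem genStep_single_eq_zero (μ : A.Gate) {R : PauliString n} (ha : R (A.left μ.1 μ.2) = 0)
    (hb : R (A.right μ.1 μ.2) = 0) : A.genStep μ (Pi.single R 1) = 0 := by
  ext1 Q
  rw [genStep, gateStep, Pi.zero_apply]
  refine Finset.sum_eq_zero fun S _ => ?_
  by_cases h : setPair Q (A.left μ.1 μ.2) (A.right μ.1 μ.2) S = R
  · have h1 : S = 0 := by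
      subst h
      rw [setPair_left (A.left_ne_right _ _)] at ha
      rw [setPair_right] at hb
      exact Prod.ext ha hb
    rw [h1, commMatrix_zero_left, zero_mul]
  · rw [Pi.single_eq_of_ne h, mul_zero]

theorem genExpect_eq_zero (ρ₀ : Op n) (θ : A.Gate → ℝ) (μ : A.Gate) {R : PauliString n}
    (ha : R (A.left μ.1 μ.2) = 0) (hb : R (A.right μ.1 μ.2) = 0) (ω : A.Config) :
    A.genExpect N ρ₀ θ μ R ω = 0 := by
  rw [genExpect, genStep_single_eq_zero μ ha hb]
  simp [ofVec]

theorem continuous_partialCost (hN : IsQuantumChannel N) (ρ₀ : Op n) (P : PauliString n)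
    (θ : A.Gate → ℝ) (μ : A.Gate) : Continuous (A.partialCost N ρ₀ P θ μ) := by
  rw [funext (partialCost_eq_sum hN ρ₀ P θ μ)]
  exact continuous_finsetSum _ fun R _ =>
    ((continuous_apply R).comp (continuous_obsAfter P θ μ)).mul (continuous_genExpect hN ρ₀ θ μ R)

theorem integral_partialCost (hN : IsQuantumChannel N) (ρ₀ : Op n) (P : PauliString n)
    (θ : A.Gate → ℝ) (μ : A.Gate) : ∫ ω, A.partialCost N ρ₀ P θ μ ω ∂A.law = 0 := by
  have hv := fun R : PauliString n => (continuous_apply R).comp (continuous_obsAfter (N := N) P θ μ)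
  rw [funext (partialCost_eq_sum hN ρ₀ P θ μ)]
  refine (integral_finsetSum _ fun R _ =>
    A.integrable ((hv R).mul (continuous_genExpect hN ρ₀ θ μ R))).trans ?_
  refine Finset.sum_eq_zero fun R _ => ?_
  by_cases hR : R = 0
  · subst hR
    simp [genExpect_eq_zero ρ₀ θ μ (R := 0) rfl rfl]
  · refine (integral_mul_of_disjoint (hv R) (continuous_genExpect hN ρ₀ θ μ R)
      ((dependsOn_evolve N θ _ _).comp fun v => v R) (dependsOn_genExpect hN ρ₀ θ μ R)
      (disjoint_gatesOf μ.1) (disjoint_singlesOf μ.1)).trans ?_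
    exact mul_eq_zero_of_left (integral_evolve θ (nodup_filter_finRange _) (filter_le_ne_nil μ.1) _ hR) _

/-- The mean vanishes, so the variance is a second moment. Independence splits each term of the
double sum, and the coefficients of distinct strings are uncorrelated, which leaves the diagonal. -/
theorem varPartial_eq (hN : IsQuantumChannel N) (ρ₀ : Op n) (P : PauliString n)
    (θ : A.Gate → ℝ) (μ : A.Gate) :
    A.varPartial N ρ₀ P θ μ
      = ∑ R, A.meanSq (A.obsAfter N P θ μ) R * ∫ ω, A.genExpect N ρ₀ θ μ R ω ^ 2 ∂A.law := by
  have hv := fun R : PauliString n => (continuous_apply R).comp (continuous_obsAfter (N := N) P θ μ)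
  have hx := fun R => continuous_genExpect (A := A) hN ρ₀ θ μ R
  rw [varPartial, variance_of_integral_eq_zero
    (continuous_partialCost hN ρ₀ P θ μ).measurable.aemeasurable
    (integral_partialCost hN ρ₀ P θ μ)]
  simp only [pow_two, partialCost_eq_sum hN]
  refine (integral_sum_mul_sum (fun R => (hv R).mul (hx R)) fun R => (hv R).mul (hx R)).trans ?_
  refine Finset.sum_congr rfl fun R _ => ?_
  have h : ∀ R', ∫ ω, A.obsAfter N P θ μ ω R * A.genExpect N ρ₀ θ μ R ω *
        (A.obsAfter N P θ μ ω R' * A.genExpect N ρ₀ θ μ R' ω) ∂A.law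
      = (∫ ω, A.obsAfter N P θ μ ω R * A.obsAfter N P θ μ ω R' ∂A.law) *
        ∫ ω, A.genExpect N ρ₀ θ μ R ω * A.genExpect N ρ₀ θ μ R' ω ∂A.law := by
    intro R'
    simp only [mul_mul_mul_comm _ (A.genExpect N ρ₀ θ μ R _)]
    exact integral_mul_of_disjoint ((hv R).mul (hv R')) ((hx R).mul (hx R'))
      ((dependsOn_evolve N θ _ _).comp fun v => v R * v R')
      (fun ω ω' h1 h2 => by
        rw [dependsOn_genExpect hN ρ₀ θ μ R ω ω' h1 h2, dependsOn_genExpect hN ρ₀ θ μ R' ω ω' h1 h2])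
      (disjoint_gatesOf μ.1) (disjoint_singlesOf μ.1)
  refine (Finset.sum_congr rfl fun R' _ => h R').trans ?_
  rw [Finset.sum_eq_single R]
  · simp only [meanSq, pow_two]
  · intro R' _ hR'
    exact mul_eq_zero_of_left (integral_evolve_mul θ (nodup_filter_finRange _)
      (filter_le_ne_nil μ.1) _ hR'.symm) _
  · simp

/-! ### Outside the light cone -/

theorem trace_pauliOp_mul_embed {a b : Fin n} (hab : a ≠ b) (H : Op2) (U : Fin 4 × Fin 4)
    (h : (pauli2 U * H).trace ≠ 0) :
    (pauliOp (setPair 0 a b U) * embed a b H).trace ≠ 0 := by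
  rw [pauliOp_mul_embed hab, trace_embF hab, setPair_left hab, setPair_right]
  refine mul_ne_zero h (Finset.prod_ne_zero_iff.2 fun q hq => ?_)
  simp only [Finset.mem_erase, Finset.mem_univ, and_true] at hq
  rw [setPair_of_ne hq.2 hq.1, Pi.zero_apply, pauli_isPauliBasis.zero]
  simp

theorem left_mem_genSupport (μ : A.Gate) {U : Fin 4 × Fin 4}
    (h : (pauli2 U * A.generator μ).trace ≠ 0) (hU : U.1 ≠ 0) :
    A.left μ.1 μ.2 ∈ A.genSupport μ :=
  ⟨_, trace_pauliOp_mul_embed (A.left_ne_right _ _) _ U h, by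
    rwa [setPair_left (A.left_ne_right _ _)]⟩

theorem right_mem_genSupport (μ : A.Gate) {U : Fin 4 × Fin 4}
    (h : (pauli2 U * A.generator μ).trace ≠ 0) (hU : U.2 ≠ 0) :
    A.right μ.1 μ.2 ∈ A.genSupport μ :=
  ⟨_, trace_pauliOp_mul_embed (A.left_ne_right _ _) _ U h, by rwa [setPair_right]⟩

/-- On each qubit, `S` or the given Pauli term of `H` is the identity, so all terms of `H` commute
with `S`. -/
theorem commMatrix_eq_zero {H : Op2} {S : Fin 4 × Fin 4}
    (h : ∀ U, (pauli2 U * H).trace ≠ 0 → (U.1 = 0 ∨ S.1 = 0) ∧ (U.2 = 0 ∨ S.2 = 0))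
    (T : Fin 4 × Fin 4) : commMatrix H S T = 0 := by
  have hcomm : H * pauli2 S = pauli2 S * H := by
    rw [pauli2_isPauliBasis.expand H]
    simp only [Matrix.mul_sum, Matrix.sum_mul, Matrix.mul_smul, Matrix.smul_mul]
    refine Finset.sum_congr rfl fun U _ => ?_
    by_cases hU : (pauli2 U * H).trace = 0
    · rw [hU]; simp
    · rw [pauli2_isPauliBasis.comm U S, if_neg]
      · rw [one_smul]
      · obtain ⟨h1, h2⟩ := h U hU
        have h0 : ∀ s, pauliAnti 0 s = false ∧ pauliAnti s 0 = false := by decide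
        rcases h1 with h1 | h1 <;> rcases h2 with h2 | h2 <;> simp [h1, h2, h0]
  rw [commMatrix, hcomm, sub_self]
  simp

/-- The support of the law has full measure. On it, all strings occurring in the evolved observable
lie in the light cone and commute with the generator, so the derivative vanishes almost surely. -/
theorem varPartial_eq_zero (hN : IsQuantumChannel N) (ρ₀ : Op n) (P : PauliString n)
    (θ : A.Gate → ℝ) (μ : A.Gate) (hd : Disjoint (A.genSupport μ) (A.lightCone N θ μ.1 P)) :
    A.varPartial N ρ₀ P θ μ = 0 := by
  have h0 : A.partialCost N ρ₀ P θ μ =ᵐ[A.law] 0 := by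
    filter_upwards [Measure.support_mem_ae (μ := A.law)] with ω hω
    have hcone : ∀ R, A.obsAfter N P θ μ ω R ≠ 0 → ∀ q, R q ≠ 0 → q ∈ A.lightCone N θ μ.1 P := by
      intro R hR q hq
      refine Set.mem_biUnion hω ?_
      rw [A.hsAdjoint_circuitFrom hN, mem_opSupport_ofVec]
      exact ⟨R, hR, hq⟩
    have hz : A.genStep μ (A.obsAfter N P θ μ ω) = 0 := by
      ext1 R
      rw [genStep, gateStep, Pi.zero_apply]
      refine Finset.sum_eq_zero fun S _ => ?_
      by_cases hv : A.obsAfter N P θ μ ω (setPair R (A.left μ.1 μ.2) (A.right μ.1 μ.2) S) = 0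
      · rw [hv, mul_zero]
      · rw [commMatrix_eq_zero, zero_mul]
        intro U hU
        constructor
        · by_contra! h
          refine Set.disjoint_left.1 hd (left_mem_genSupport μ hU h.1) (hcone _ hv _ ?_)
          rw [setPair_left (A.left_ne_right _ _)]
          exact h.2
        · by_contra! h
          refine Set.disjoint_left.1 hd (right_mem_genSupport μ hU h.1) (hcone _ hv _ ?_)
          rw [setPair_right]
          exact h.2
    rw [partialCost_eq A hN, hz]
    simp [ofVec]
  rw [varPartial, variance_congr h0]
  exact variance_zero _

end Ansatz
end NoisyCircuit
end

noncomputable section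

namespace NoisyCircuit

/-! ### The upper bound -/

section Density

variable {m : Type} [Fintype m] [DecidableEq m]

open scoped MatrixOrder in
theorem exists_eq_conjTranspose_mul_self {K : Matrix m m ℂ} (hK : K.PosSemidef) :
    ∃ X : Matrix m m ℂ, K = X.conjTranspose * X := by
  refine ⟨CFC.sqrt K, ?_⟩
  have h : (CFC.sqrt K).conjTranspose = CFC.sqrt K := 
    (Matrix.nonneg_iff_posSemidef.1 (CFC.sqrt_nonneg K)).isHermitian
  rw [h, CFC.sqrt_mul_sqrt_self K hK.nonneg]

theorem posSemidef_one_sub_of_opNorm_le {H : Matrix m m ℂ} (hH : opNorm H ≤ 1) :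
    (1 - H.conjTranspose * H).PosSemidef := by
  refine .of_dotProduct_mulVec_nonneg ?_ fun x => ?_
  · simp [Matrix.IsHermitian, Matrix.conjTranspose_mul]
  · have h1 : ‖WithLp.toLp 2 (H.mulVec x)‖ ≤ ‖WithLp.toLp 2 x‖ := by
      have := (Matrix.toEuclideanCLM (n := m) (𝕜 := ℂ) H).le_of_opNorm_le hH (WithLp.toLp 2 x)
      rwa [one_mul, Matrix.toEuclideanCLM_toLp] at this
    have h2 : ∀ y : m → ℂ, star y ⬝ᵥ y = ((‖WithLp.toLp 2 y‖ ^ 2 : ℝ) : ℂ) := by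
      intro y
      have := inner_self_eq_norm_sq_to_K (𝕜 := ℂ) (WithLp.toLp 2 y)
      rw [EuclideanSpace.inner_eq_star_dotProduct, dotProduct_comm] at this
      rw [this]
      push_cast
      rfl
    have h3 : star x ⬝ᵥ (1 - H.conjTranspose * H).mulVec x
        = ((‖WithLp.toLp 2 x‖ ^ 2 - ‖WithLp.toLp 2 (H.mulVec x)‖ ^ 2 : ℝ) : ℂ) := by
      rw [Matrix.sub_mulVec, dotProduct_sub, Matrix.one_mulVec, ← Matrix.mulVec_mulVec,
        Matrix.dotProduct_mulVec _ H.conjTranspose, ← Matrix.star_mulVec, h2, h2]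
      push_cast
      rfl
    rw [h3, Complex.zero_le_real, sub_nonneg]
    exact pow_le_pow_left₀ (norm_nonneg _) h1 2

omit [DecidableEq m] in
theorem trace_conjTranspose_mul_mul_nonneg {σ : Matrix m m ℂ} (hσ : σ.PosSemidef)
    (X : Matrix m m ℂ) : 0 ≤ ((X.conjTranspose * X * σ).trace).re := by
  have h := (hσ.mul_mul_conjTranspose_same X).trace_nonneg
  rw [Matrix.mul_assoc, Matrix.trace_mul_comm]
  exact (Complex.le_def.1 h).1

/-- The positive operators `(H ± iR)†(H ± iR)` equal `H² + 1 ± i[H, R]`. Their expectations bound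
the commutator in absolute value by `Tr(H²σ) + 1 ≤ 2`. -/
theorem abs_trace_commutator_le {H R σ : Matrix m m ℂ} (hH : H.IsHermitian)
    (hH1 : (1 - H * H).PosSemidef) (hR : R.IsHermitian) (hR1 : R * R = 1) (hσ : IsDensity σ) :
    |((Complex.I • (H * R - R * H) * σ).trace).re| ≤ 2 := by
  obtain ⟨X, hX⟩ := exists_eq_conjTranspose_mul_self hH1
  have h1 := trace_conjTranspose_mul_mul_nonneg hσ.1 X
  rw [← hX, Matrix.sub_mul, Matrix.one_mul, Matrix.trace_sub, hσ.2, Complex.sub_re,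
    Complex.one_re] at h1
  have h2 := trace_conjTranspose_mul_mul_nonneg hσ.1 (H - Complex.I • R)
  have h3 := trace_conjTranspose_mul_mul_nonneg hσ.1 (H + Complex.I • R)
  have e2 : (H - Complex.I • R).conjTranspose * (H - Complex.I • R)
      = H * H + 1 - Complex.I • (H * R - R * H) := by
    rw [Matrix.conjTranspose_sub, Matrix.conjTranspose_smul, hH.eq, hR.eq, Matrix.sub_mul,
      Matrix.mul_sub, Matrix.mul_sub, Matrix.smul_mul, Matrix.smul_mul, Matrix.mul_smul,
      Matrix.mul_smul, hR1, smul_smul]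
    simp only [Complex.star_def, Complex.conj_I, neg_mul, Complex.I_mul_I, neg_neg, one_smul,
      smul_sub, neg_smul]
    abel
  have e3 : (H + Complex.I • R).conjTranspose * (H + Complex.I • R)
      = H * H + 1 + Complex.I • (H * R - R * H) := by
    rw [Matrix.conjTranspose_add, Matrix.conjTranspose_smul, hH.eq, hR.eq, Matrix.add_mul,
      Matrix.mul_add, Matrix.mul_add, Matrix.smul_mul, Matrix.smul_mul, Matrix.mul_smul,
      Matrix.mul_smul, hR1, smul_smul]
    simp only [Complex.star_def, Complex.conj_I, neg_mul, Complex.I_mul_I, neg_neg, one_smul,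
      smul_sub, neg_smul]
    abel
  rw [e2, Matrix.sub_mul, Matrix.add_mul, Matrix.one_mul, Matrix.trace_sub, Matrix.trace_add,
    hσ.2, Complex.sub_re, Complex.add_re, Complex.one_re] at h2
  rw [e3, Matrix.add_mul, Matrix.add_mul, Matrix.one_mul, Matrix.trace_add, Matrix.trace_add,
    hσ.2, Complex.add_re, Complex.add_re, Complex.one_re] at h3
  rw [abs_le]
  constructor <;> linarith

theorem IsDensity.conjMap {σ U : Matrix m m ℂ} (hσ : IsDensity σ)
    (hU : U.conjTranspose * U = 1) : IsDensity (conjMap U σ) := by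
  refine ⟨hσ.1.mul_mul_conjTranspose_same U, ?_⟩
  change (U * σ * U.conjTranspose).trace = 1
  rw [Matrix.trace_mul_comm, ← Matrix.mul_assoc, hU, Matrix.one_mul, hσ.2]

end Density

variable {n : ℕ} {N : Op1 →ₗ[ℂ] Op1}

theorem posSemidef_embed {a b : Fin n} (hab : a ≠ b) {K : Op2} (hK : K.PosSemidef) :
    (embed a b K : Op n).PosSemidef := by
  obtain ⟨X, rfl⟩ := exists_eq_conjTranspose_mul_self hK
  rw [← embed_mul hab, ← embed_conjTranspose]
  exact Matrix.posSemidef_conjTranspose_mul_self _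

theorem conjTranspose_tensorOp_mul_self {V : Fin n → Op1} (hV : ∀ q, (V q).conjTranspose * V q = 1) :
    (tensorOp V).conjTranspose * tensorOp V = 1 := by
  rw [tensorOp_conjTranspose, tensorOp_mul]
  simp only [hV, tensorOp_one]

/-- Tensor products of one-qubit Kraus operators represent the layer; this shows that the noise maps
states to states. -/
theorem IsQuantumChannel.noiseLayer_eq_sum (hN : IsQuantumChannel N) :
    ∃ (κ : Type) (_ : Fintype κ) (K : κ → Op n), ∑ f, (K f).conjTranspose * K f = 1 ∧
      ∀ B, noiseLayer n N B = ∑ f, K f * B * (K f).conjTranspose := by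
  obtain ⟨r, K, hK, h⟩ := hN
  refine ⟨Fin n → Fin r, inferInstance, fun f => tensorOp fun q => K (f q), ?_, fun B => ?_⟩
  · simp only [tensorOp_conjTranspose, tensorOp_mul]
    have := tensorOp_sum (fun (_ : Fin n) (_ : Fin r) => (1 : ℂ)) fun _ i => (K i).conjTranspose * K i
    simp only [one_smul, Finset.prod_const_one, hK, tensorOp_one] at this
    exact this.symm
  · have hs : ∀ u v : Fin n → Fin 2, tensorOp (fun q => N (Matrix.single (u q) (v q) 1))
        = ∑ f : Fin n → Fin r, (tensorOp fun q => K (f q)) * Matrix.single u v 1 *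
          (tensorOp fun q => K (f q)).conjTranspose := by
      intro u v
      have h0 : (Matrix.single u v 1 : Op n) = tensorOp fun q => Matrix.single (u q) (v q) 1 := by
        ext x y
        simp only [tensorOp, Matrix.of_apply, Matrix.single_apply, Finset.prod_ite_zero,
          Finset.mem_univ, true_imp_iff, Finset.prod_const_one, forall_and, funext_iff]
      have := tensorOp_sum (fun (_ : Fin n) (_ : Fin r) => (1 : ℂ)) fun q i =>
        K i * Matrix.single (u q) (v q) 1 * (K i).conjTranspose
      simp only [one_smul, Finset.prod_const_one, ← h] at this
      rw [this]
      simp only [h0, tensorOp_conjTranspose, tensorOp_mul]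
    have hB : B = ∑ u, ∑ v, B u v • Matrix.single u v (1 : ℂ) := by
      conv_lhs => rw [Matrix.matrix_eq_sum_single B]
      simp [Matrix.smul_single]
    let Ψ : Op n →ₗ[ℂ] Op n := ∑ f : Fin n → Fin r, conjMap (tensorOp fun q => K (f q))
    have hΨ : ∀ B, Ψ B = ∑ f : Fin n → Fin r, (tensorOp fun q => K (f q)) * B *
        (tensorOp fun q => K (f q)).conjTranspose := fun B => LinearMap.sum_apply _ _ _
    rw [← hΨ]
    conv_rhs => rw [hB]
    simp only [map_sum, map_smul]
    simp only [hΨ, ← hs]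
    rfl

theorem IsDensity.noiseLayer (hN : IsQuantumChannel N) {σ : Op n} (hσ : IsDensity σ) :
    IsDensity (noiseLayer n N σ) := by
  obtain ⟨κ, _, K, hK, h⟩ := hN.noiseLayer_eq_sum (n := n)
  rw [h]
  refine ⟨Matrix.posSemidef_sum _ fun f _ => hσ.1.mul_mul_conjTranspose_same _, ?_⟩
  rw [Matrix.trace_sum]
  simp only [Matrix.trace_mul_comm _ (K _).conjTranspose, ← Matrix.mul_assoc]
  rw [← Matrix.trace_sum, ← Matrix.sum_mul, hK, Matrix.one_mul, hσ.2]

namespace Ansatz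

variable {L : ℕ} {A : Ansatz n L}

theorem conjTranspose_gatesOp_mul_self (ω : A.Config) (θ : A.Gate → ℝ) (j : Fin L)
    (l : List (Fin (A.numGates j))) :
    (A.gatesOp ω θ j l).conjTranspose * A.gatesOp ω θ j l = 1 := by
  induction l with
  | nil => simp [gatesOp]
  | cons i l ih =>
    have hU : (A.gateOp ω θ ⟨j, i⟩).conjTranspose * A.gateOp ω θ ⟨j, i⟩ = 1 :=
      Matrix.mem_unitaryGroup_iff'.1 (A.gateOp_mem ω θ ⟨j, i⟩)
    change (A.gatesOp ω θ j l * embed _ _ _).conjTranspose * (A.gatesOp ω θ j l * embed _ _ _) = 1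
    rw [Matrix.conjTranspose_mul, Matrix.mul_assoc, ← Matrix.mul_assoc _ (A.gatesOp ω θ j l), ih,
      Matrix.one_mul, embed_conjTranspose, embed_mul (A.left_ne_right j i), hU,
      embed_one (A.left_ne_right j i)]

theorem isDensity_layersMap (hN : IsQuantumChannel N) (ω : A.Config) (θ : A.Gate → ℝ)
    (l : List (Fin L)) {ρ : Op n} (hρ : IsDensity ρ) : IsDensity (A.layersMap N ω θ l ρ) := by
  induction l generalizing ρ with
  | nil => simpa only [layersMap, List.foldl_nil, LinearMap.id_apply] using hρ
  | cons j l ih =>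
    rw [layersMap_cons]
    have h1 : (A.layerUnitary ω θ j).conjTranspose * A.layerUnitary ω θ j = 1 := by
      rw [layerUnitary_eq]
      exact conjTranspose_gatesOp_mul_self ω θ j _
    have h2 := conjTranspose_tensorOp_mul_self (V := fun q => (ω.2 (j, q) : Op1))
      fun q => Matrix.mem_unitaryGroup_iff'.1 (ω.2 (j, q)).2
    rw [LinearMap.comp_apply, layerMap, LinearMap.comp_apply, LinearMap.comp_apply]
    have h3 := ((hρ.conjMap h1).noiseLayer hN).conjMap h2
    exact ih h3

theorem abs_genExpect_le (hN : IsQuantumChannel N) {ρ₀ : Op n} (hρ : IsDensity ρ₀)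
    (θ : A.Gate → ℝ) (μ : A.Gate) (R : PauliString n) (ω : A.Config) :
    |A.genExpect N ρ₀ θ μ R ω| ≤ 2 := by
  have hab := A.left_ne_right μ.1 μ.2
  have hH := A.generator_hermitian μ
  rw [genExpect, genStep, ← commutator_embed_ofVec hab hH, ofVec_single]
  refine abs_trace_commutator_le ?_ ?_ (pauliOp_conjTranspose R) (pauliOp_sq R)
    (isDensity_layersMap hN ω θ _ hρ)
  · rw [Matrix.IsHermitian, embed_conjTranspose, hH.eq]
  · rw [embed_mul hab, ← embed_one hab, ← embed_sub]
    have := posSemidef_one_sub_of_opNorm_le (A.generator_norm_le μ)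
    rw [hH.eq] at this
    exact posSemidef_embed hab this

theorem integral_genExpect_sq_le (hN : IsQuantumChannel N) {ρ₀ : Op n} (hρ : IsDensity ρ₀)
    (θ : A.Gate → ℝ) (μ : A.Gate) (R : PauliString n) :
    ∫ ω, A.genExpect N ρ₀ θ μ R ω ^ 2 ∂A.law ≤ if R = 0 then 0 else 4 := by
  split_ifs with hR
  · subst hR
    simp [genExpect_eq_zero ρ₀ θ μ (R := 0) rfl rfl]
  · calc _ ≤ ∫ _, (4 : ℝ) ∂A.law := by
          refine integral_mono (A.integrable ((continuous_genExpect hN ρ₀ θ μ R).pow 2))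
            (integrable_const _) fun ω => ?_
          have := sq_le_sq' (by linarith [(abs_le.1 (abs_genExpect_le hN hρ θ μ R ω)).1])
            (abs_le.1 (abs_genExpect_le hN hρ θ μ R ω)).2
          norm_num at this
          exact this
      _ = 4 := by simp

theorem varPartial_le_sumNonId (hN : IsQuantumChannel N) {ρ₀ : Op n} (hρ : IsDensity ρ₀)
    (P : PauliString n) (θ : A.Gate → ℝ) (μ : A.Gate) :
    A.varPartial N ρ₀ P θ μ ≤ 4 * sumNonId (A.meanSq (A.obsAfter N P θ μ)) := by
  rw [varPartial_eq hN, sumNonId, Finset.mul_sum]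
  refine Finset.sum_le_sum fun R _ => ?_
  have h := mul_le_mul_of_nonneg_left (integral_genExpect_sq_le hN hρ θ μ R)
    (meanSq_nonneg (A.obsAfter N P θ μ) R)
  refine h.trans (le_of_eq ?_)
  split_ifs <;> ring

/-- The cost is the trace of a state, a constant. The identity is kept apart because
`sumNonId_evolve` requires a nontrivial `P`. -/
theorem varPartial_zero (hN : IsQuantumChannel N) {ρ₀ : Op n} (hρ : IsDensity ρ₀)
    (θ : A.Gate → ℝ) (μ : A.Gate) : A.varPartial N ρ₀ 0 θ μ = 0 := by
  have h : ∀ ω θ, A.cost N ρ₀ 0 ω θ = 1 := by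
    intro ω θ
    rw [cost, pauliOp_zero, Matrix.one_mul, circuit, (isDensity_layersMap hN ω θ _ hρ).2,
      Complex.one_re]
  have h' : A.partialCost N ρ₀ 0 θ μ = 0 := by
    ext1 ω
    simp only [partialCost, h, deriv_const, Pi.zero_apply]
  rw [varPartial, h']
  exact variance_zero _

/-- Counting the layer of `μ` itself, `sumNonId_evolve` gives the exponent `|P| + L - k`, one better
than the final statement asks for. -/
theorem varPartial_le (hN : IsQuantumChannel N) (hc : contraction N ≤ 1) {ρ₀ : Op n}
    (hρ : IsDensity ρ₀) {P : PauliString n} (hP : P ≠ 0) (θ : A.Gate → ℝ) (μ : A.Gate) :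
    A.varPartial N ρ₀ P θ μ ≤ 4 * contraction N ^ (weight P + A.layersAfter μ) := by
  refine (varPartial_le_sumNonId hN hρ P θ μ).trans (mul_le_mul_of_nonneg_left ?_ (by norm_num))
  have h := sumNonId_evolve (A := A) hN hc θ ((List.finRange L).filter fun j => μ.1 ≤ j)
    (nodup_filter_finRange _) hP (filter_le_ne_nil _)
  rw [length_filter_le] at h
  exact h

end Ansatz
end NoisyCircuit
end

noncomputable section

namespace NoisyCircuit

/-! ### The lower bound -/

/-- Cauchy-Schwarz in each row compares the operator norm with the Hilbert-Schmidt norm. -/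
theorem opNorm_sq_le_trace {m : Type} [Fintype m] [DecidableEq m] (X : Matrix m m ℂ) :
    opNorm X ^ 2 ≤ (X * X.conjTranspose).trace.re := by
  have hF : (X * X.conjTranspose).trace.re = ∑ i, ∑ j, ‖X i j‖ ^ 2 := by
    simp only [Matrix.trace, Matrix.diag_apply, Matrix.mul_apply, Matrix.conjTranspose_apply,
      Complex.re_sum]
    refine Finset.sum_congr rfl fun i _ => Finset.sum_congr rfl fun j _ => ?_
    rw [Complex.star_def, Complex.mul_conj, Complex.ofReal_re, Complex.normSq_eq_norm_sq]
  have h0 : 0 ≤ ∑ i, ∑ j, ‖X i j‖ ^ 2 := by positivity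
  rw [hF, ← Real.sq_sqrt h0]
  refine pow_le_pow_left₀ (norm_nonneg _) ?_ 2
  refine ContinuousLinearMap.opNorm_le_bound _ (Real.sqrt_nonneg _) fun x => ?_
  refine le_of_sq_le_sq ?_ (by positivity)
  rw [mul_pow, Real.sq_sqrt h0, EuclideanSpace.norm_sq_eq, EuclideanSpace.norm_sq_eq,
    Finset.sum_mul]
  refine Finset.sum_le_sum fun i _ => ?_
  calc _ ≤ (∑ j, ‖X i j‖ * ‖x j‖) ^ 2 := by
        refine pow_le_pow_left₀ (norm_nonneg _) ?_ 2
        refine (norm_sum_le _ _).trans (le_of_eq ?_)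
        exact Finset.sum_congr rfl fun j _ => norm_mul _ _
    _ ≤ _ := Finset.sum_mul_sq_le_sq_mul_sq _ _ _

/-- The coefficients of a two-qubit operator in the Pauli basis. -/
def coeff (H : Op2) (U : Fin 4 × Fin 4) : ℝ := (pauli2 U * H).trace.re / 4

theorem eq_sum_coeff {H : Op2} (hH : H.IsHermitian) : H = ∑ U, (coeff H U : ℂ) • pauli2 U := by
  have h := pauli2_isPauliBasis.expand_re hH
  simp only [Fintype.card_prod, Fintype.card_fin] at h
  norm_num at h
  simpa [coeff] using h

/-- Up to unitary factors `i[H, S]` is `H - S H S`, which keeps exactly the Pauli terms of `H` that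
anticommute with `S`, doubled. Parseval does the rest. -/
theorem sum_commMatrix_sq {H : Op2} (hH : H.IsHermitian) (S : Fin 4 × Fin 4) :
    ∑ T, commMatrix H S T ^ 2 = ∑ U, (if xor (pauliAnti S.1 U.1) (pauliAnti S.2 U.2) then
      2 * coeff H U else 0) ^ 2 := by
  have hsq := pauli2_isPauliBasis.sq S
  have h1 := pauli2_isPauliBasis.trace_mul_sum (commMatrix H S) (commMatrix H S)
  have h2 := pauli2_isPauliBasis.trace_mul_sum
    (fun U => if xor (pauliAnti S.1 U.1) (pauliAnti S.2 U.2) then 2 * coeff H U else 0)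
    (fun U => if xor (pauliAnti S.1 U.1) (pauliAnti S.2 U.2) then 2 * coeff H U else 0)
  have hD : H - pauli2 S * H * pauli2 S = ∑ U, (((if xor (pauliAnti S.1 U.1) (pauliAnti S.2 U.2) then
      2 * coeff H U else 0 : ℝ)) : ℂ) • pauli2 U := by
    conv_lhs => rw [eq_sum_coeff hH]
    simp only [Matrix.mul_sum, Matrix.sum_mul, Matrix.mul_smul, Matrix.smul_mul,
      ← Finset.sum_sub_distrib, pauli2_isPauliBasis.conj_basis]
    refine Finset.sum_congr rfl fun U _ => ?_
    rw [smul_smul, ← sub_smul]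
    congr 1
    split_ifs
    · push_cast; ring
    · simp
  rw [← hD] at h2
  rw [← commMatrix_expand hH] at h1
  have h3 : (Complex.I • (H * pauli2 S - pauli2 S * H)) * (Complex.I • (H * pauli2 S - pauli2 S * H))
      = (H - pauli2 S * H * pauli2 S) * (H - pauli2 S * H * pauli2 S) := by
    have e1 : H * pauli2 S - pauli2 S * H = (H - pauli2 S * H * pauli2 S) * pauli2 S := by
      rw [Matrix.sub_mul, Matrix.mul_assoc (pauli2 S * H), hsq, Matrix.mul_one]
    have e2 : H * pauli2 S - pauli2 S * H = -(pauli2 S * (H - pauli2 S * H * pauli2 S)) := by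
      rw [Matrix.mul_sub, ← Matrix.mul_assoc, ← Matrix.mul_assoc, hsq,
        Matrix.one_mul, neg_sub]
    conv_lhs =>
      congr
      · rw [e1]
      · rw [e2]
    rw [Matrix.smul_mul, Matrix.mul_smul, smul_smul, Complex.I_mul_I, Matrix.mul_neg, smul_neg,
      neg_one_smul, neg_neg, Matrix.mul_assoc, ← Matrix.mul_assoc (pauli2 S), hsq, Matrix.one_mul]
  rw [h3, h2] at h1
  have h4 := Complex.ofReal_injective h1
  have h5 : (Fintype.card (Fin 2 × Fin 2) : ℝ) ≠ 0 := by simp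
  have h6 := mul_left_cancel₀ h5 h4
  simp only [← pow_two] at h6
  exact h6.symm

theorem tracelessPart_eq {H : Op2} (hH : H.IsHermitian) :
    tracelessPart H = ∑ U, ((if U = 0 then 0 else coeff H U : ℝ) : ℂ) • pauli2 U := by
  have h0 : (H.trace / 4) • (1 : Op2) = (coeff H 0 : ℂ) • pauli2 0 := by
    have := pauli2_isPauliBasis.trace_im hH 0
    rw [coeff, pauli2_isPauliBasis.zero, Matrix.one_mul] at *
    push_cast
    rw [this]
  have h1 : (coeff H 0 : ℂ) • pauli2 0
      = ∑ U, ((if U = 0 then coeff H U else 0 : ℝ) : ℂ) • pauli2 U := by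
    rw [Finset.sum_eq_single 0]
    · rw [if_pos rfl]
    · intro U _ hU
      simp [hU]
    · simp
  rw [tracelessPart, h0, sub_eq_iff_eq_add, h1, ← Finset.sum_add_distrib]
  refine (eq_sum_coeff hH).trans (Finset.sum_congr rfl fun U _ => ?_)
  split_ifs <;> simp

theorem opNorm_tracelessPart_sq_le {H : Op2} (hH : H.IsHermitian) :
    opNorm (tracelessPart H) ^ 2 ≤ 4 * ∑ U, (if U = 0 then 0 else coeff H U) ^ 2 := by
  refine (opNorm_sq_le_trace _).trans (le_of_eq ?_)
  have h1 := pauli2_isPauliBasis.trace_mul_sum (fun U => if U = 0 then 0 else coeff H U)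
    fun U => if U = 0 then 0 else coeff H U
  have h2 : (tracelessPart H).conjTranspose = tracelessPart H := by
    simp only [tracelessPart_eq hH, Matrix.conjTranspose_sum, Matrix.conjTranspose_smul,
      pauli2_isPauliBasis.herm, Complex.star_def, Complex.conj_ofReal]
  rw [h2, tracelessPart_eq hH, h1, Complex.ofReal_re]
  simp only [Fintype.card_prod, Fintype.card_fin, ← pow_two]
  norm_num

/-- Every nontrivial Pauli operator anticommutes with some `S`, so each coefficient of the traceless
part is counted at least once. The factor 4 of the Hilbert-Schmidt normalisation matches the square
of the doubling in `sum_commMatrix_sq`. -/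
theorem opNorm_tracelessPart_sq_le_sum {H : Op2} (hH : H.IsHermitian) :
    opNorm (tracelessPart H) ^ 2 ≤ ∑ S, ∑ T, commMatrix H S T ^ 2 := by
  refine (opNorm_tracelessPart_sq_le hH).trans ?_
  simp only [sum_commMatrix_sq hH]
  rw [Finset.sum_comm, Finset.mul_sum]
  refine Finset.sum_le_sum fun U _ => ?_
  split_ifs with hU
  · rw [zero_pow (by norm_num), mul_zero]
    exact Finset.sum_nonneg fun _ _ => sq_nonneg _
  · obtain ⟨S, hS⟩ : ∃ S : Fin 4 × Fin 4,
        xor (pauliAnti S.1 U.1) (pauliAnti S.2 U.2) = true := by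
      revert U
      decide
    refine le_trans (le_of_eq ?_) (Finset.single_le_sum (fun _ _ => sq_nonneg _)
      (Finset.mem_univ S))
    rw [if_pos hS]
    ring

namespace Ansatz

variable {n L : ℕ} {A : Ansatz n L} {N : Op1 →ₗ[ℂ] Op1}

/-- `active` ranges over all configurations, not only over the support of the law. The lower bounds
hold there as well, because mean squares depend only on second moments. -/
theorem lightCone_subset_active (hN : IsQuantumChannel N) (P : PauliString n) (θ : A.Gate → ℝ)
    (μ : A.Gate) : A.lightCone N θ μ.1 P ⊆ A.active (A.obsAfter N P θ μ) := by
  intro q hq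
  obtain ⟨ω, -, hq⟩ := Set.mem_iUnion₂.1 hq
  rw [A.hsAdjoint_circuitFrom hN, mem_opSupport_ofVec] at hq
  exact ⟨ω, hq⟩

/-- Decorrelation makes the second moment a sum of nonnegative terms over strings, and the identity
term does not depend on the state since `Tr ρ₀ = 1`. A layer before that of `μ` is needed for the
decorrelation, hence `hμ`. -/
theorem meanSq_evolve_zero_le_integral_genExpect (hN : IsQuantumChannel N) {ρ₀ : Op n}
    (hρ : IsDensity ρ₀) (θ : A.Gate → ℝ) (μ : A.Gate) (hμ : 0 < (μ.1 : ℕ)) (R : PauliString n) :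
    A.meanSq (fun ω => A.evolve N ω θ ((List.finRange L).filter fun j => j < μ.1)
        (A.genStep μ (Pi.single R 1))) 0 ≤ ∫ ω, A.genExpect N ρ₀ θ μ R ω ^ 2 ∂A.law := by
  set l := (List.finRange L).filter fun j => j < μ.1 with hl
  set α := A.genStep μ (Pi.single R 1) with hα
  have hy : ∀ Q : PauliString n, Continuous fun ω =>
      A.evolve N ω θ l α Q * (pauliOp Q * ρ₀).trace.re := fun Q =>
    ((continuous_apply Q).comp (continuous_evolve (A := A) N θ l α)).mul continuous_const
  have h1 : ∫ ω, A.genExpect N ρ₀ θ μ R ω ^ 2 ∂A.law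
      = ∑ Q, (pauliOp Q * ρ₀).trace.re ^ 2 * A.meanSq (fun ω => A.evolve N ω θ l α) Q := by
    simp only [pow_two, genExpect_eq_sum hN]
    refine (integral_sum_mul_sum hy hy).trans ?_
    refine Finset.sum_congr rfl fun Q _ => ?_
    rw [Finset.sum_eq_single Q]
    · rw [meanSq, ← integral_const_mul]
      congr 1
      ext ω
      ring
    · intro Q' _ hQ'
      simp only [mul_mul_mul_comm _ ((pauliOp Q * ρ₀).trace.re), integral_mul_const]
      exact mul_eq_zero_of_left (integral_evolve_mul θ (nodup_filter_finRange _)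
        (filter_lt_ne_nil _ hμ) α hQ'.symm) _
    · simp
  rw [h1]
  have h2 := Finset.single_le_sum (f := fun Q : PauliString n =>
    (pauliOp Q * ρ₀).trace.re ^ 2 * A.meanSq (fun ω => A.evolve N ω θ l α) Q)
    (fun Q _ => mul_nonneg (sq_nonneg _) (meanSq_nonneg _ _)) (Finset.mem_univ 0)
  refine le_trans (le_of_eq ?_) h2
  simp only [pauliOp_zero, hρ.2, Complex.one_re, one_pow, one_mul]

theorem setPair_injective {a b : Fin n} (hab : a ≠ b) {R : PauliString n} :
    Function.Injective (setPair R a b) := by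
  intro T T' h
  have h1 := congrFun h a
  have h2 := congrFun h b
  rw [setPair_left hab, setPair_left hab] at h1
  rw [setPair_right, setPair_right] at h2
  exact Prod.ext h1 h2

theorem sum_setPair_le {a b : Fin n} (hab : a ≠ b) {f : PauliString n → ℝ} (hf : ∀ R, 0 ≤ f R) :
    ∑ T, f (setPair 0 a b T) ≤ ∑ R, f R := by
  rw [← Finset.sum_image (f := f) fun _ _ _ _ h => setPair_injective hab h]
  exact Finset.sum_le_univ_sum_of_nonneg hf

theorem weight_setPair_zero_le {a b : Fin n} (T : Fin 4 × Fin 4) :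
    weight (setPair (0 : PauliString n) a b T) ≤ 2 := by
  refine (Finset.card_le_card (t := {a, b}) fun q hq => ?_).trans Finset.card_le_two
  by_contra h
  simp only [Finset.mem_insert, Finset.mem_singleton, not_or] at h
  simp [setPair_of_ne h.1 h.2] at hq

/-- The commutator has weight at most two on the pair, so at most two factors `noiseKernel N 1 0`
are paid for turning it into the identity. -/
theorem le_integral_genExpect (hN : IsQuantumChannel N) (hτ : noiseKernel N 1 0 ≤ 1) {ρ₀ : Op n}
    (hρ : IsDensity ρ₀) (θ : A.Gate → ℝ) (μ : A.Gate) (hμ : 0 < (μ.1 : ℕ)) (S : Fin 4 × Fin 4) :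
    noiseKernel N 1 0 ^ 2 * ∑ T, commMatrix (A.generator μ) S T ^ 2
      ≤ ∫ ω, A.genExpect N ρ₀ θ μ
        (setPair 0 (A.left μ.1 μ.2) (A.right μ.1 μ.2) S) ω ^ 2 ∂A.law := by
  have hab := A.left_ne_right μ.1 μ.2
  have hτ0 : 0 ≤ noiseKernel N 1 0 := noiseKernel_nonneg _ _
  refine le_trans ?_ (meanSq_evolve_zero_le_integral_genExpect hN hρ θ μ hμ _)
  refine le_trans ?_ (le_meanSq_evolve_zero hN θ _ (nodup_filter_finRange _)
    (filter_lt_ne_nil _ hμ) _)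
  set α := A.genStep μ (Pi.single (setPair 0 (A.left μ.1 μ.2) (A.right μ.1 μ.2) S) 1) with hα
  have hα' : ∀ T, α (setPair 0 (A.left μ.1 μ.2) (A.right μ.1 μ.2) T)
      = commMatrix (A.generator μ) S T := by
    intro T
    rw [hα, genStep, gateStep, Finset.sum_eq_single S]
    · simp [setPair_setPair hab, setPair_left hab, setPair_right]
    · intro S' _ hS'
      rw [setPair_setPair hab, Pi.single_eq_of_ne (fun h => hS' (setPair_injective hab h)), mul_zero]
    · simp
  rw [Finset.mul_sum]
  calc _ ≤ ∑ T : Fin 4 × Fin 4, noiseKernel N 1 0 ^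
          weight (setPair (0 : PauliString n) (A.left μ.1 μ.2) (A.right μ.1 μ.2) T) *
          α (setPair 0 (A.left μ.1 μ.2) (A.right μ.1 μ.2) T) ^ 2 := by
        refine Finset.sum_le_sum fun T _ => ?_
        rw [hα']
        exact mul_le_mul_of_nonneg_right (pow_le_pow_of_le_one hτ0 hτ (weight_setPair_zero_le T))
          (sq_nonneg _)
    _ ≤ _ := sum_setPair_le hab (f := fun Q => noiseKernel N 1 0 ^ weight Q * α Q ^ 2)
        fun Q => by positivity

/-- Only strings on the pair of the gate are kept in `varPartial_eq`. The light cone makes one of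
them heavy, the gate gives all nontrivial ones the same mass, and summing the commutators over them
recovers the norm of the traceless part. -/
theorem le_varPartial (hN : IsQuantumChannel N) {r : ℕ} (hA : A.LayerDepthLE r)
    (hτ : noiseKernel N 1 0 ≤ 1) {x₀ : Fin 4} (hx₀ : x₀ ≠ 0) {ρ₀ : Op n} (hρ : IsDensity ρ₀)
    (P : PauliString n) (θ : A.Gate → ℝ) (μ : A.Gate) (hμ : 0 < (μ.1 : ℕ))
    (hcone : A.genSupport μ ⊆ A.lightCone N θ μ.1 P) :
    opNorm (tracelessPart (A.generator μ)) ^ 2 * (noiseKernel N 1 0 ^ (weight P + 2) *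
        (noiseKernel N 1 x₀ * (1 / 15) ^ r) ^ (A.layersAfter μ + 1))
      ≤ A.varPartial N ρ₀ P θ μ := by
  have hab := A.left_ne_right μ.1 μ.2
  have hH := A.generator_hermitian μ
  have hτ0 : 0 ≤ noiseKernel N 1 0 := noiseKernel_nonneg _ _
  have hβ : 0 ≤ noiseKernel N 1 x₀ := noiseKernel_nonneg _ _
  by_cases h0 : ∃ U : Fin 4 × Fin 4, U ≠ 0 ∧ coeff (A.generator μ) U ≠ 0
  swap
  · push Not at h0
    have h1 : opNorm (tracelessPart (A.generator μ)) ^ 2 = 0 := by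
      refine le_antisymm ((opNorm_tracelessPart_sq_le hH).trans (le_of_eq ?_)) (sq_nonneg _)
      rw [mul_eq_zero]
      refine Or.inr (Finset.sum_eq_zero fun U _ => ?_)
      split_ifs with hU
      · norm_num
      · rw [h0 U hU]
        norm_num
    rw [h1, zero_mul]
    exact variance_nonneg _ _
  obtain ⟨U, hU0, hU⟩ := h0
  have htr : (pauli2 U * A.generator μ).trace ≠ 0 := fun h => hU (by rw [coeff, h]; simp)
  have hgen : A.generator μ ≠ 0 := fun h => htr (by rw [h]; simp)
  obtain ⟨S, hS0, hS⟩ : ∃ S : Fin 4 × Fin 4, S ≠ 0 ∧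
      noiseKernel N 1 0 ^ weight P *
        (noiseKernel N 1 x₀ * (1 / 15) ^ r) ^ (A.layersAfter μ + 1)
      ≤ A.meanSq (A.obsAfter N P θ μ) (setPair 0 (A.left μ.1 μ.2) (A.right μ.1 μ.2) S) := by
    have hle := le_meanSq_evolve (A := A) hN hA hτ hx₀ θ P
      ((List.finRange L).filter fun j => μ.1 ≤ j) (nodup_filter_finRange _) (filter_le_ne_nil _)
    rw [length_filter_le] at hle
    by_cases hU1 : U.1 = 0
    · have hU2 : U.2 ≠ 0 := fun h => hU0 (Prod.ext hU1 h)
      obtain ⟨x, hx, hx'⟩ := hle _ (lightCone_subset_active hN P θ μ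
        (hcone (right_mem_genSupport μ htr hU2)))
      refine ⟨(0, x), fun h => hx (congrArg Prod.snd h), ?_⟩
      rw [setPair_zero_right]
      exact hx'
    · obtain ⟨x, hx, hx'⟩ := hle _ (lightCone_subset_active hN P θ μ
        (hcone (left_mem_genSupport μ htr hU1)))
      refine ⟨(x, 0), fun h => hx (congrArg Prod.fst h), ?_⟩
      rw [setPair_zero_left hab]
      exact hx'
  have hall : ∀ T : Fin 4 × Fin 4, T ≠ 0 → noiseKernel N 1 0 ^ weight P *
        (noiseKernel N 1 x₀ * (1 / 15) ^ r) ^ (A.layersAfter μ + 1)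
      ≤ A.meanSq (A.obsAfter N P θ μ) (setPair 0 (A.left μ.1 μ.2) (A.right μ.1 μ.2) T) := by
    intro T hT
    refine hS.trans (le_of_eq ?_)
    have h1 := meanSq_setPair_eq (A := A) θ μ hgen
      (continuous_noiseEvolve N μ.1 (continuous_evolve N θ
        ((List.finRange L).filter fun j => μ.1 < j) (Pi.single P 1)))
      (dependsOn_noiseEvolve N μ.1 (v := fun ω => A.evolve N ω θ
        ((List.finRange L).filter fun j => μ.1 < j) (Pi.single P 1)) (dependsOn_evolve N θ _ _))
      (gate_notMem_gatesOf (by simp)) hS0 hT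
    have h2 : A.obsAfter N P θ μ = fun ω => A.gatesEvolve ω θ μ.1 (List.finRange _)
        (A.noiseEvolve N ω μ.1 (A.evolve N ω θ
          ((List.finRange L).filter fun j => μ.1 < j) (Pi.single P 1))) := by
      ext1 ω
      rw [obsAfter, filter_le_eq_cons]
      rfl
    rw [h2]
    exact h1
  set C := noiseKernel N 1 0 ^ weight P *
    (noiseKernel N 1 x₀ * (1 / 15) ^ r) ^ (A.layersAfter μ + 1) with hC
  have hC0 : 0 ≤ C := by positivity
  calc _ = C * (noiseKernel N 1 0 ^ 2 * opNorm (tracelessPart (A.generator μ)) ^ 2) := by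
        rw [hC, pow_add]; ring
    _ ≤ C * (noiseKernel N 1 0 ^ 2 * ∑ S, ∑ T, commMatrix (A.generator μ) S T ^ 2) :=
        mul_le_mul_of_nonneg_left (mul_le_mul_of_nonneg_left
          (opNorm_tracelessPart_sq_le_sum hH) (by positivity)) hC0
    _ = ∑ S, C * (noiseKernel N 1 0 ^ 2 * ∑ T, commMatrix (A.generator μ) S T ^ 2) := by
        rw [Finset.mul_sum, Finset.mul_sum]
    _ ≤ ∑ S : Fin 4 × Fin 4, A.meanSq (A.obsAfter N P θ μ)
          (setPair 0 (A.left μ.1 μ.2) (A.right μ.1 μ.2) S) * ∫ ω, A.genExpect N ρ₀ θ μ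
          (setPair 0 (A.left μ.1 μ.2) (A.right μ.1 μ.2) S) ω ^ 2 ∂A.law := by
        refine Finset.sum_le_sum fun S _ => ?_
        by_cases hS : S = 0
        · subst hS
          simp only [commMatrix_zero_left]
          norm_num
          exact mul_nonneg (meanSq_nonneg _ _) (integral_nonneg fun _ => sq_nonneg _)
        · have h1 := le_integral_genExpect (A := A) hN hτ hρ θ μ hμ S
          have h2 : 0 ≤ noiseKernel N 1 0 ^ 2 * ∑ T, commMatrix (A.generator μ) S T ^ 2 :=
            mul_nonneg (sq_nonneg _) (Finset.sum_nonneg fun _ _ => sq_nonneg _)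
          exact mul_le_mul (hall S hS) h1 h2 (meanSq_nonneg _ _)
    _ ≤ A.varPartial N ρ₀ P θ μ := by
        rw [varPartial_eq hN]
        exact sum_setPair_le hab (f := fun R => A.meanSq (A.obsAfter N P θ μ) R *
          ∫ ω, A.genExpect N ρ₀ θ μ R ω ^ 2 ∂A.law) fun R =>
          mul_nonneg (meanSq_nonneg _ _) (integral_nonneg fun _ => sq_nonneg _)

end Ansatz
end NoisyCircuit
end

noncomputable section

namespace NoisyCircuit

/-! ### Explicit bounds for the variance -/

variable {N : Op1 →ₗ[ℂ] Op1}

theorem not_isUnitaryChannel (h : ¬ IsUnital N) : ¬ IsUnitaryChannel N := by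
  rintro ⟨U, hU, rfl⟩
  refine h ?_
  change U * 1 * U.conjTranspose = 1
  rw [Matrix.mul_one]
  exact Matrix.mem_unitaryGroup_iff.1 hU

theorem weight_eq_zero {n : ℕ} {P : PauliString n} : weight P = 0 ↔ P = 0 := by
  simp [weight, Finset.card_eq_zero, Finset.filter_eq_empty_iff, funext_iff]

theorem exists_lower_bound (hN : IsQuantumChannel N) (hu : ¬ IsUnital N) (hr : ¬ IsReplacer N)
    (r : ℕ) : ∃ b : ℝ, 0 < b ∧ ∀ (n L : ℕ) (A : Ansatz n L) (ρ₀ : Op n)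
      (P : PauliString n) (θ : A.Gate → ℝ) (μ : A.Gate),
      A.LayerDepthLE r → IsDensity ρ₀ → 0 < (μ.1 : ℕ) →
      A.genSupport μ ⊆ A.lightCone N θ μ.1 P →
      opNorm (tracelessPart (A.generator μ)) ^ 2 *
          Real.exp (-(b * ((weight P : ℝ) * ((A.layersAfter μ : ℝ) + 1))))
        ≤ A.varPartial N ρ₀ P θ μ := by
  obtain ⟨x₀, hx₀, hβ⟩ := hN.exists_noiseKernel_pos hr
  have hτ := hN.noiseKernel_one_zero_pos hu
  have hc := hN.contraction_lt_one (not_isUnitaryChannel hu)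
  have hsum : noiseKernel N 1 0 + noiseKernel N 1 x₀ ≤ contraction N := by
    rw [← sum_noiseKernel (N := N) (P := 1) (by decide), ← Finset.sum_pair hx₀.symm]
    exact Finset.sum_le_univ_sum_of_nonneg fun _ => noiseKernel_nonneg _ _
  set τ := noiseKernel N 1 0 with hτd
  set γ := noiseKernel N 1 x₀ * (1 / 15) ^ r with hγd
  have hτ1 : τ < 1 := by linarith
  have hγ : 0 < γ := by positivity
  have hγ1 : γ ≤ 1 := mul_le_one₀ (by linarith) (by positivity)
    (pow_le_one₀ (by norm_num) (by norm_num))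
  have hb0 : 0 < τ ^ 3 * γ := by positivity
  have hb1 : τ ^ 3 * γ < 1 :=
    (mul_le_of_le_one_right (by positivity) hγ1).trans_lt (pow_lt_one₀ hτ.le hτ1 (by norm_num))
  -- For weight `w ≥ 1` and `m` later layers, `w + 2 ≤ 3 w (m + 1)` and `m + 1 ≤ w (m + 1)`, so both
  -- powers are absorbed in `(τ³γ)^(w(m+1))`.
  refine ⟨-Real.log (τ ^ 3 * γ), neg_pos.2 (Real.log_neg hb0 hb1), ?_⟩
  intro n L A ρ₀ P θ μ hA hρ hμ hcone
  have h := Ansatz.le_varPartial hN hA hτ1.le hx₀ hρ P θ μ hμ hcone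
  rw [← hτd, ← hγd] at h
  -- For the identity the variance is zero, and the bound just obtained forces the traceless part of
  -- the generator to vanish, so the claim holds trivially.
  by_cases hP : weight P = 0
  · rw [weight_eq_zero] at hP
    subst hP
    rw [Ansatz.varPartial_zero hN hρ] at h ⊢
    have h0 : opNorm (tracelessPart (A.generator μ)) ^ 2 ≤ 0 :=
      nonpos_of_mul_nonpos_left h (by positivity)
    exact mul_nonpos_of_nonpos_of_nonneg h0 (Real.exp_pos _).le
  · refine le_trans (mul_le_mul_of_nonneg_left ?_ (sq_nonneg _)) h
    set w := weight P
    set m := A.layersAfter μ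
    have hw : 1 ≤ w := Nat.one_le_iff_ne_zero.2 hP
    have hexp : Real.exp (-(-Real.log (τ ^ 3 * γ) * ((w : ℝ) * ((m : ℝ) + 1))))
        = (τ ^ 3 * γ) ^ (w * (m + 1)) := by
      have h1 := Real.exp_nat_mul (Real.log (τ ^ 3 * γ)) (w * (m + 1))
      rw [Real.exp_log hb0] at h1
      rw [← h1, neg_mul, neg_neg, mul_comm]
      push_cast
      rfl
    rw [hexp, mul_pow, ← pow_mul]
    refine mul_le_mul (pow_le_pow_of_le_one hτ.le hτ1.le ?_)
      (pow_le_pow_of_le_one hγ.le hγ1 (Nat.le_mul_of_pos_left _ hw)) (by positivity) (by positivity)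
    nlinarith [Nat.zero_le (w * m)]

/-- The exponent is an integer because it equals `-1` when `P` is the identity and no layer follows;
the variance is zero in that case. -/
theorem varPartial_le_zpow (hN : IsQuantumChannel N) (hc : contraction N ≤ 1) {n L : ℕ}
    (A : Ansatz n L) {ρ₀ : Op n} (hρ : IsDensity ρ₀) (P : PauliString n) (θ : A.Gate → ℝ)
    (μ : A.Gate) : A.varPartial N ρ₀ P θ μ
      ≤ 4 * contraction N ^ ((weight P : ℤ) + (A.layersAfter μ : ℤ) - 1) := by
  by_cases hP : P = 0
  · subst hP
    rw [Ansatz.varPartial_zero hN hρ]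
    exact mul_nonneg (by norm_num) (zpow_nonneg contraction_nonneg _)
  · have hw : 1 ≤ weight P := Nat.one_le_iff_ne_zero.2 (mt weight_eq_zero.1 hP)
    refine (Ansatz.varPartial_le hN hc hρ hP θ μ).trans
      (mul_le_mul_of_nonneg_left ?_ (by norm_num))
    rw [show (weight P : ℤ) + (A.layersAfter μ : ℤ) - 1
      = ((weight P + A.layersAfter μ - 1 : ℕ) : ℤ) by omega, zpow_natCast]
    exact pow_le_pow_of_le_one contraction_nonneg hc (Nat.sub_le _ _)

theorem exists_two_sided_bound (hN : IsQuantumChannel N) (hu : ¬ IsUnital N)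
    (hr : ¬ IsReplacer N) (r w : ℕ) (h : ℝ) (hh : 0 < h) :
    ∃ (a b : ℝ) (K : ℕ), 0 < a ∧ 0 < b ∧
      ∀ (n L : ℕ) (A : Ansatz n L) (ρ₀ : Op n) (P : PauliString n) (θ : A.Gate → ℝ) (μ : A.Gate),
        A.LayerDepthLE r → IsDensity ρ₀ → weight P ≤ w →
        h ≤ opNorm (tracelessPart (A.generator μ)) →
        0 < (μ.1 : ℕ) → A.genSupport μ ⊆ A.lightCone N θ μ.1 P → K ≤ A.layersAfter μ →
        Real.exp (-(b * (A.layersAfter μ : ℝ))) ≤ A.varPartial N ρ₀ P θ μ ∧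
          A.varPartial N ρ₀ P θ μ ≤ Real.exp (-(a * (A.layersAfter μ : ℝ))) := by
  obtain ⟨b, hb, hlow⟩ := exists_lower_bound hN hu hr r
  have hc := hN.contraction_lt_one (not_isUnitaryChannel hu)
  -- The contraction may be 0, where the real logarithm has the default value 0; the maximum with
  -- 1/2 keeps the rate positive.
  set c := max (contraction N) (1 / 2) with hcd
  have hc0 : 0 < c := lt_max_of_lt_right (by norm_num)
  have hc1 : c < 1 := max_lt hc (by norm_num)
  have ha : 0 < -Real.log c / 2 := div_pos (neg_pos.2 (Real.log_neg hc0 hc1)) two_pos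
  set a := -Real.log c / 2 with had
  -- With `m ≥ 1` one has `m + 1 ≤ 2m`, and `|log h²|` is at most its multiple by `m`. With `m ≥ log
  -- 4 / a` the prefactor 4 uses up half of the decay rate `2a`.
  refine ⟨a, 2 * b * w + |Real.log (h ^ 2)| + 1, max 1 ⌈Real.log 4 / a⌉₊, ha, by positivity, ?_⟩
  intro n L A ρ₀ P θ μ hA hρ hw hH hμ hcone hK
  set m := A.layersAfter μ
  have hm : (1 : ℝ) ≤ m := by exact_mod_cast (le_max_left _ _).trans hK
  constructor
  · refine le_trans ?_ (hlow n L A ρ₀ P θ μ hA hρ hμ hcone)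
    have h2 : h ^ 2 = Real.exp (Real.log (h ^ 2)) := (Real.exp_log (by positivity)).symm
    refine le_trans ?_ (mul_le_mul_of_nonneg_right (pow_le_pow_left₀ hh.le hH 2)
      (Real.exp_pos _).le)
    rw [h2, ← Real.exp_add, ← h2, Real.exp_le_exp]
    have hw' : (weight P : ℝ) ≤ w := by exact_mod_cast hw
    have e1 : (weight P : ℝ) * ((m : ℝ) + 1) ≤ w * (2 * m) :=
      mul_le_mul hw' (by linarith) (by positivity) (by positivity)
    have e2 := mul_le_mul_of_nonneg_left e1 hb.le
    have e3 : |Real.log (h ^ 2)| ≤ |Real.log (h ^ 2)| * m :=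
      le_mul_of_one_le_right (abs_nonneg _) hm
    have e4 := neg_abs_le (Real.log (h ^ 2))
    change -((2 * b * w + |Real.log (h ^ 2)| + 1) * (m : ℝ))
      ≤ Real.log (h ^ 2) + -(b * ((weight P : ℝ) * ((m : ℝ) + 1)))
    nlinarith
  · by_cases hP : P = 0
    · subst hP
      rw [Ansatz.varPartial_zero hN hρ]
      exact (Real.exp_pos _).le
    · refine (Ansatz.varPartial_le hN hc.le hρ hP θ μ).trans ?_
      have e1 : contraction N ^ (weight P + m) ≤ c ^ m :=
        (pow_le_pow_of_le_one contraction_nonneg hc.le (Nat.le_add_left _ _)).trans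
          (pow_le_pow_left₀ contraction_nonneg (le_max_left _ _) _)
      have e2 : c ^ m = Real.exp (-(2 * a * m)) := by
        rw [← Real.rpow_natCast, Real.rpow_def_of_pos hc0, had]
        congr 1
        ring
      have e3 : Real.log 4 ≤ a * m := by
        rw [← div_le_iff₀' ha]
        exact (Nat.le_ceil _).trans (by exact_mod_cast (le_max_right _ _).trans hK)
      calc 4 * contraction N ^ (weight P + m) ≤ Real.exp (Real.log 4) * Real.exp (-(2 * a * m)) := by
            rw [Real.exp_log (by norm_num), ← e2]
            exact mul_le_mul_of_nonneg_left e1 (by norm_num)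
        _ ≤ _ := by
            rw [← Real.exp_add, Real.exp_le_exp]
            linarith

end NoisyCircuit
end

theorem mainTheorem3 (N : NoisyCircuit.Op1 →ₗ[ℂ] NoisyCircuit.Op1)
    (hN : NoisyCircuit.IsQuantumChannel N) :
    -- for local Pauli operators the variance is `exp(-Θ(L - k))`
    (¬ NoisyCircuit.IsUnital N → ¬ NoisyCircuit.IsReplacer N →
      ∀ (r w : ℕ) (h : ℝ), 0 < h → ∃ (a b : ℝ) (K : ℕ), 0 < a ∧ 0 < b ∧
        ∀ (n L : ℕ) (A : NoisyCircuit.Ansatz n L) (ρ₀ : NoisyCircuit.Op n)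
          (P : NoisyCircuit.PauliString n) (θ : A.Gate → ℝ) (μ : A.Gate),
          A.LayerDepthLE r → NoisyCircuit.IsDensity ρ₀ → NoisyCircuit.weight P ≤ w →
          h ≤ NoisyCircuit.opNorm (NoisyCircuit.tracelessPart (A.generator μ)) →
          0 < (μ.1 : ℕ) → A.genSupport μ ⊆ A.lightCone N θ μ.1 P → K ≤ A.layersAfter μ →
          Real.exp (-(b * (A.layersAfter μ : ℝ))) ≤ A.varPartial N ρ₀ P θ μ ∧
            A.varPartial N ρ₀ P θ μ ≤ Real.exp (-(a * (A.layersAfter μ : ℝ)))) ∧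
    -- the contraction coefficient in terms of the normal form of the noise
    (∀ t D : Fin 3 → ℝ, NoisyCircuit.IsNormalForm N t D →
      NoisyCircuit.contraction N = NoisyCircuit.normalFormContraction t D) ∧
    -- general upper bound
    (¬ NoisyCircuit.IsUnitaryChannel N →
      NoisyCircuit.contraction N < 1 ∧
      ∀ (n L : ℕ) (A : NoisyCircuit.Ansatz n L) (ρ₀ : NoisyCircuit.Op n)
        (P : NoisyCircuit.PauliString n) (θ : A.Gate → ℝ) (μ : A.Gate),
        NoisyCircuit.IsDensity ρ₀ →
        A.varPartial N ρ₀ P θ μ ≤ 4 * NoisyCircuit.contraction N ^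
          ((NoisyCircuit.weight P : ℤ) + (A.layersAfter μ : ℤ) - 1)) ∧
    -- general lower bound inside the light cone
    (¬ NoisyCircuit.IsUnital N → ¬ NoisyCircuit.IsReplacer N →
      ∀ r : ℕ, ∃ b : ℝ, 0 < b ∧
        ∀ (n L : ℕ) (A : NoisyCircuit.Ansatz n L) (ρ₀ : NoisyCircuit.Op n)
          (P : NoisyCircuit.PauliString n) (θ : A.Gate → ℝ) (μ : A.Gate),
          A.LayerDepthLE r → NoisyCircuit.IsDensity ρ₀ →
          0 < (μ.1 : ℕ) → A.genSupport μ ⊆ A.lightCone N θ μ.1 P →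
          NoisyCircuit.opNorm (NoisyCircuit.tracelessPart (A.generator μ)) ^ 2 *
              Real.exp (-(b * ((NoisyCircuit.weight P : ℝ) * ((A.layersAfter μ : ℝ) + 1))))
            ≤ A.varPartial N ρ₀ P θ μ) ∧
    -- vanishing outside the light cone
    (∀ (n L : ℕ) (A : NoisyCircuit.Ansatz n L) (ρ₀ : NoisyCircuit.Op n)
      (P : NoisyCircuit.PauliString n) (θ : A.Gate → ℝ) (μ : A.Gate),
      NoisyCircuit.IsDensity ρ₀ → Disjoint (A.genSupport μ) (A.lightCone N θ μ.1 P) →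
      A.varPartial N ρ₀ P θ μ = 0) := by
  exact ⟨fun hu hr r w h hh => NoisyCircuit.exists_two_sided_bound hN hu hr r w h hh,
    fun t D h => hN.contraction_normalForm h,
    fun hU => ⟨hN.contraction_lt_one hU, fun n L A ρ₀ P θ μ hρ =>
      NoisyCircuit.varPartial_le_zpow hN (hN.contraction_lt_one hU).le A hρ P θ μ⟩,
    fun hu hr r => NoisyCircuit.exists_lower_bound hN hu hr r,
    fun n L A ρ₀ P θ μ _ hd => NoisyCircuit.Ansatz.varPartial_eq_zero hN ρ₀ P θ μ hd⟩
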